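/- **Setting.** Let $d\in\{2,3\}$ and let $\Omega\subset\mathbb R^d$ be the interior of the union of a finite, geometrically conforming triangulation $\mathcal T$ into nondegenerate closed $d$-simplices. Let $\partial\Omega=\Gamma_D\cup\Gamma_N$ with $\Gamma_D,\Gamma_N$ disjoint and measurable. Let $T>0$, $\nu>0$, $f\in L^2(0,T;[L^2(\Omega)]^d)$, and write $(\nabla u)_{ij}=\partial_j u_i$, $\epsilon(u)=\tfrac12(\nabla u+(\nabla u)^\top)$, $\sigma(u,p)=2\nu\epsilon(u)-pI$. Write $\langle\cdot,\cdot\rangle_S$ for the $L^2(S)$ inner product (surface measure if $S$ is part of a cell boundary; no subscript means $S=\Omega$), and $n$ for the outward unit normal (of $\Omega$ on $\Gamma_N$, of $K$ on $\partial K$). *Discrete solution.* Let $V_h$ be the continuous piecewise quadratic vector fields and $Q_h$ the continuous piecewise linear functions on $\mathcal T$. Let $0=t_0<\dots<t_M=T$, let $U^n\in V_h$, $P^n\in Q_h$ ($0\le n\le M$) be arbitrary (for instance computed by a splitting scheme), and let $U,P$ be their continuous piecewise linear interpolants in time. *Test functions.* Let $\hat W$ be the set of pairs $(v,q)$ with $v\in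 L^2(0,T;[H^1(\Omega)]^d)$, $v|_{\Gamma_D}=0$ in the sense of traces, and $q\in L^2(0,T;L^2(\Omega))$. Let $\pi_h$ be any map from $\hat W$ into the semi-discrete space of those $(v,q)\in\hat W$ with $v(\cdot,t)\in V_h$ and $q(\cdot,t)\in Q_h$ for almost every $t$. Let $\tilde z=(z,y)\in\hat W$, for instance the solution of the dual problem, and write $\pi_h\tilde z=(\pi_h z,\pi_h y)$. *Residual.* The weak residual of $(U,P)$ is $r((v,q))=L((v,q))-a((U,P);(v,q))$ with $L((v,q))=\int_0^T\langle v,f\rangle\,dt$ and $$a((u,p);(v,q))=\int_0^T\langle v,\dot u+(u\cdot\nabla)u\rangle+\langle\epsilon(v),\sigma(u,p)\rangle-\langle v,\nu(\nabla u)^\top n-pn\rangle_{\Gamma_N}+\langle q,\nabla\cdot u\rangle\,dt .$$ The space discretization error is $\eta_h=r(\tilde z-\pi_h\tilde z)$. **Space discretization error estimate.** For each cell $K\in\mathcal T$ and time $t$ put $\eta_K=|\eta_K^1|+|\eta_K^2|+|\eta_K^3|+|\eta_K^4|$ with $$\eta_K^1=\langle z-\pi_hz,\ \dot U+(U\cdot\nabla)U-\nabla\cdot\sigma(U,P)-f\rangle_K,$$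 $$\eta_K^2=\langle z-\pi_hz,\ \tfrac12[\![\sigma(U,P)]\!]_n\rangle_{\partial K\setminus\partial\Omega},$$ $$\eta_K^3=\langle z-\pi_hz,\ \nu\nabla U\,n\rangle_{\partial K\cap\Gamma_N},\qquad \eta_K^4=\langle y-\pi_hy,\ \nabla\cdot U\rangle_K,$$ where derivatives of $U$ on $\partial K$ in $\eta_K^3$ are taken from inside $K$ and $[\![\sigma(U,P)]\!]_n=\sigma(U^+,P^+)n^++\sigma(U^-,P^-)n^-$ is the jump of the normal stress across an interior facet. Then the time integrands of $L$ and $a$ (at the test pair $\tilde z-\pi_h\tilde z$) and each $\eta_K$ are integrable on $(0,T)$, and $$\eta_h\ \le\ |\eta_h|\ \le\ E_h:=\int_0^T\sum_{K\in\mathcal T}\eta_K\,dt .$$ -/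

import Mathlib

open MeasureTheory Set Filter Topology
open scoped ContDiff Matrix

noncomputable section

namespace NavierStokesFEM

/-- Euclidean space of dimension `d`. -/
abbrev Sp (d : ℕ) := EuclideanSpace ℝ (Fin d)

variable {d : ℕ}

/-! ### Matrix calculus -/

/-- The Jacobian matrix of a derivative `A`: the entry `(i, j)` is the partial derivative of the
`i`-th component in direction `j`. In particular `(U ⬝ ∇) U = (∇ U) U`. -/
def jac (A : Sp d →L[ℝ] Sp d) : Matrix (Fin d) (Fin d) ℝ :=
  Matrix.of fun i j => A (EuclideanSpace.single j 1) i

/-- The symmetric gradient `ε = (∇ u + (∇ u)ᵀ) / 2`, as a function of the gradient. -/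
def symGrad (A : Matrix (Fin d) (Fin d) ℝ) : Matrix (Fin d) (Fin d) ℝ :=
  (1 / 2 : ℝ) • (A + Aᵀ)

/-- The Cauchy stress `σ = 2 ν ε - p I`, as a function of the velocity gradient and pressure. -/
def stress (ν : ℝ) (A : Matrix (Fin d) (Fin d) ℝ) (p : ℝ) : Matrix (Fin d) (Fin d) ℝ :=
  (2 * ν) • symGrad A - p • (1 : Matrix (Fin d) (Fin d) ℝ)

/-- The Frobenius inner product of two matrices. -/
def frob (A B : Matrix (Fin d) (Fin d) ℝ) : ℝ := ∑ i, ∑ j, A i j * B i j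

/-! ### Triangulations -/

/-- The closed simplex with vertex set `s`. -/
def cell (s : Finset (Sp d)) : Set (Sp d) := convexHull ℝ (s : Set (Sp d))

open scoped Classical in
/-- A (finite, geometrically conforming) triangulation of `Ω` into nondegenerate closed
`d`-simplices, each of which is given by its set of `d + 1` vertices. -/
structure Triangulation (Ω : Set (Sp d)) where
  cells : Finset (Finset (Sp d))
  card_vertices : ∀ s ∈ cells, s.card = d + 1
  affineIndependent : ∀ s ∈ cells, AffineIndependent ℝ ((↑) : s → Sp d)
  conforming : ∀ s ∈ cells, ∀ t ∈ cells, cell s ∩ cell t = cell (s ∩ t)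
  interior_iUnion : interior (⋃ s ∈ cells, cell s) = Ω

open scoped Classical in
/-- The vertex set of the facet of the simplex `s` opposite to the vertex `p`. -/
def facet (s : Finset (Sp d)) (p : Sp d) : Finset (Sp d) := s.erase p

/-- A vector orthogonal to the facet of `s` opposite to `p` that points out of the simplex:
the component, orthogonal to the facet, of the vector from `p` to the barycenter of the facet. -/
def outwardVector (s : Finset (Sp d)) (p : Sp d) : Sp d :=
  (vectorSpan ℝ (facet s p : Set (Sp d)))ᗮ.starProjection
    ((facet s p).centroid ℝ id - p)

/-- The outward unit normal of the simplex `s` on its facet opposite to the vertex `p`. -/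
def outwardNormal (s : Finset (Sp d)) (p : Sp d) : Sp d :=
  ‖outwardVector s p‖⁻¹ • outwardVector s p

/-- Surface measure: the `(d - 1)`-dimensional Hausdorff measure, normalized such that it is
Lebesgue measure on hyperplanes. -/
def surf (d : ℕ) : Measure (Sp d) := Measure.euclideanHausdorffMeasure (d - 1)

/-! ### Sobolev functions and traces -/

/-- `G` is the weak derivative of the vector field `v` on the open set `O`. -/
def IsWeakDeriv (O : Set (Sp d)) (v : Sp d → Sp d) (G : Sp d → (Sp d →L[ℝ] Sp d)) : Prop :=
  ∀ φ : Sp d → ℝ, ContDiff ℝ ∞ φ → HasCompactSupport φ → tsupport φ ⊆ O →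
    ∀ e : Sp d, ∫ x in O, (fderiv ℝ φ x e) • v x = - ∫ x in O, φ x • G x e

/-- `v ∈ [L²(O)]^d` has the weak derivative `G ∈ [L²(O)]^(d × d)`. -/
def HasWeakDerivL2 (O : Set (Sp d)) (v : Sp d → Sp d) (G : Sp d → (Sp d →L[ℝ] Sp d)) : Prop :=
  MemLp v 2 (volume.restrict O) ∧ MemLp G 2 (volume.restrict O) ∧ IsWeakDeriv O v G

/-- Membership in `[H¹(O)]^d`. -/
def IsH1 (O : Set (Sp d)) (v : Sp d → Sp d) : Prop := ∃ G, HasWeakDerivL2 O v G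

open scoped Classical in
/-- The weak derivative of `v ∈ [H¹(O)]^d` (zero if `v` is not in this space). -/
def weakDeriv (O : Set (Sp d)) (v : Sp d → Sp d) : Sp d → (Sp d →L[ℝ] Sp d) :=
  if h : IsH1 O v then h.choose else 0

/-- `γ ∈ [L²(∂K)]^d` is the trace on the boundary of the simplex `K = cell s` of
`v ∈ [H¹(K)]^d`: there are fields, smooth up to the boundary, that converge to `v` in `H¹(K)` and
whose restrictions to `∂K` converge to `γ` in `L²(∂K)`. -/
def IsTrace (s : Finset (Sp d)) (v γ : Sp d → Sp d) : Prop :=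
  IsH1 (interior (cell s)) v ∧
  MemLp γ 2 ((surf d).restrict (frontier (cell s))) ∧
  ∃ φ : ℕ → Sp d → Sp d, (∀ k, ContDiff ℝ ∞ (φ k)) ∧
    Tendsto (fun k => eLpNorm (fun x => φ k x - v x) 2
      (volume.restrict (interior (cell s)))) atTop (𝓝 0) ∧
    Tendsto (fun k => eLpNorm (fun x => fderiv ℝ (φ k) x - weakDeriv (interior (cell s)) v x) 2
      (volume.restrict (interior (cell s)))) atTop (𝓝 0) ∧
    Tendsto (fun k => eLpNorm (fun x => φ k x - γ x) 2
      ((surf d).restrict (frontier (cell s)))) atTop (𝓝 0)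

open scoped Classical in
/-- The trace on `∂K`, `K = cell s`, of a field in `[H¹(K)]^d` (zero if there is no trace). -/
def trace (s : Finset (Sp d)) (v : Sp d → Sp d) : Sp d → Sp d :=
  if h : ∃ γ, IsTrace s v γ then h.choose else 0

/-! ### Finite element spaces and time interpolation -/

/-- Continuous functions on the closure of `Ω` that agree on each cell with a polynomial of total
degree at most `k`. -/
def IsPiecewisePoly {Ω : Set (Sp d)} (𝒯 : Triangulation Ω) (k : ℕ) (g : Sp d → ℝ) : Prop :=
  ContinuousOn g (closure Ω) ∧
  ∀ s ∈ 𝒯.cells, ∃ P : MvPolynomial (Fin d) ℝ, P.totalDegree ≤ k ∧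
    ∀ x ∈ cell s, g x = MvPolynomial.eval (fun i => x i) P

/-- The velocity space `V_h` of continuous piecewise quadratic vector fields. -/
def IsVh {Ω : Set (Sp d)} (𝒯 : Triangulation Ω) (v : Sp d → Sp d) : Prop :=
  ∀ i, IsPiecewisePoly 𝒯 2 (fun x => v x i)

/-- The pressure space `Q_h` of continuous piecewise linear functions. -/
def IsQh {Ω : Set (Sp d)} (𝒯 : Triangulation Ω) (q : Sp d → ℝ) : Prop :=
  IsPiecewisePoly 𝒯 1 q

/-- A partition `0 = t_0 < t_1 < ⋯ < t_M = T` of the time interval. -/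
structure TimeGrid (T : ℝ) where
  M : ℕ
  node : Fin (M + 1) → ℝ
  strictMono : StrictMono node
  node_zero : node 0 = 0
  node_last : node (Fin.last M) = T

/-- `W` is, on `[0, T]`, the continuous piecewise linear interpolant in time of the functions
`Wn n` at the time nodes. -/
def IsTimeInterpolant {T : ℝ} {F : Type*} [AddCommGroup F] [Module ℝ F] (τ : TimeGrid T)
    (Wn : Fin (τ.M + 1) → Sp d → F) (W : ℝ → Sp d → F) : Prop :=
  ∀ n : Fin τ.M, ∀ t ∈ Icc (τ.node n.castSucc) (τ.node n.succ), ∀ x,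
    W t x =
      ((τ.node n.succ - t) / (τ.node n.succ - τ.node n.castSucc)) • Wn n.castSucc x +
      ((t - τ.node n.castSucc) / (τ.node n.succ - τ.node n.castSucc)) • Wn n.succ x

/-! ### Space-time test functions -/

/-- The measure on the space-time cylinder `(0, T) × Ω`. -/
def cylinder (T : ℝ) (Ω : Set (Sp d)) : Measure (ℝ × Sp d) :=
  (volume.restrict (Ioc 0 T)).prod (volume.restrict Ω)

/-- A pair of a velocity `v ∈ L²(0, T; [H¹(Ω)]^d)` with `v = 0` on `Γ_D` in the sense of traces,
and a pressure `q ∈ L²(0, T; L²(Ω))`. -/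
structure IsTestPair {Ω : Set (Sp d)} (𝒯 : Triangulation Ω) (ΓD : Set (Sp d)) (T : ℝ)
    (w : (ℝ → Sp d → Sp d) × (ℝ → Sp d → ℝ)) : Prop where
  velocity : MemLp (fun a : ℝ × Sp d => w.1 a.1 a.2) 2 (cylinder T Ω)
  gradient : ∃ G : ℝ → Sp d → (Sp d →L[ℝ] Sp d),
    MemLp (fun a : ℝ × Sp d => G a.1 a.2) 2 (cylinder T Ω) ∧
    ∀ᵐ t ∂(volume.restrict (Ioc 0 T)), IsWeakDeriv Ω (w.1 t) (G t)
  dirichlet : ∀ᵐ t ∂(volume.restrict (Ioc 0 T)), ∀ s ∈ 𝒯.cells,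
    ∀ᵐ x ∂((surf d).restrict (frontier (cell s) ∩ ΓD)), trace s (w.1 t) x = 0
  pressure : MemLp (fun a : ℝ × Sp d => w.2 a.1 a.2) 2 (cylinder T Ω)

/-- The semi-discrete test space: test pairs that belong to `V_h × Q_h` at (almost) each time. -/
def IsSemiDiscrete {Ω : Set (Sp d)} (𝒯 : Triangulation Ω) (ΓD : Set (Sp d)) (T : ℝ)
    (w : (ℝ → Sp d → Sp d) × (ℝ → Sp d → ℝ)) : Prop :=
  IsTestPair 𝒯 ΓD T w ∧
  ∀ᵐ t ∂(volume.restrict (Ioc 0 T)), IsVh 𝒯 (w.1 t) ∧ IsQh 𝒯 (w.2 t)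

/-! ### The weak residual -/

/-- The Jacobian matrix of `u` on the simplex with vertex set `s`, up to the boundary (one-sided
derivatives from inside the simplex). -/
def cellGrad (s : Finset (Sp d)) (u : Sp d → Sp d) (x : Sp d) : Matrix (Fin d) (Fin d) ℝ :=
  jac (fderivWithin ℝ u (cell s) x)

/-- The time derivative `u̇` at time `t`. -/
def timeDeriv (u : ℝ → Sp d → Sp d) (t : ℝ) (x : Sp d) : Sp d := deriv (fun r => u r x) t

/-- The boundary term `⟨v, ν (∇ u)ᵀ n - p n⟩` on `Γ_N`, assembled from the boundary facets. -/
def neumannTerm {Ω : Set (Sp d)} (𝒯 : Triangulation Ω) (ΓN : Set (Sp d)) (ν : ℝ)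
    (u : Sp d → Sp d) (p : Sp d → ℝ) (v : Sp d → Sp d) : ℝ :=
  ∑ s ∈ 𝒯.cells, ∑ a ∈ s, ∫ x in cell (facet s a) ∩ ΓN,
    (trace s v x).ofLp ⬝ᵥ
      (ν • ((cellGrad s u x)ᵀ *ᵥ (outwardNormal s a).ofLp) - p x • (outwardNormal s a).ofLp)
    ∂(surf d)

/-- The integrand at time `t` of the nonlinear form `a((u, p); (v, q))`. -/
def formIntegrand {Ω : Set (Sp d)} (𝒯 : Triangulation Ω) (ΓN : Set (Sp d)) (ν : ℝ)
    (u : ℝ → Sp d → Sp d) (p : ℝ → Sp d → ℝ) (w : (ℝ → Sp d → Sp d) × (ℝ → Sp d → ℝ))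
    (t : ℝ) : ℝ :=
  (∫ x in Ω, (w.1 t x).ofLp ⬝ᵥ
      ((timeDeriv u t x).ofLp + jac (weakDeriv Ω (u t) x) *ᵥ (u t x).ofLp)) +
  (∫ x in Ω, frob (symGrad (jac (weakDeriv Ω (w.1 t) x)))
      (stress ν (jac (weakDeriv Ω (u t) x)) (p t x))) -
  neumannTerm 𝒯 ΓN ν (u t) (p t) (w.1 t) +
  ∫ x in Ω, w.2 t x * (jac (weakDeriv Ω (u t) x)).trace

/-- The integrand at time `t` of the linear form `L((v, q))`. -/
def loadIntegrand (Ω : Set (Sp d)) (f : ℝ → Sp d → Sp d)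
    (w : (ℝ → Sp d → Sp d) × (ℝ → Sp d → ℝ)) (t : ℝ) : ℝ :=
  ∫ x in Ω, (w.1 t x).ofLp ⬝ᵥ (f t x).ofLp

/-- The weak residual `r(w) = L(w) - a((u, p); w)`. -/
def weakResidual {Ω : Set (Sp d)} (𝒯 : Triangulation Ω) (ΓN : Set (Sp d)) (T ν : ℝ)
    (f : ℝ → Sp d → Sp d) (u : ℝ → Sp d → Sp d) (p : ℝ → Sp d → ℝ)
    (w : (ℝ → Sp d → Sp d) × (ℝ → Sp d → ℝ)) : ℝ :=
  (∫ t in (0 : ℝ)..T, loadIntegrand Ω f w t) -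
    ∫ t in (0 : ℝ)..T, formIntegrand 𝒯 ΓN ν u p w t

/-! ### Cell error indicators -/

/-- The stress `σ(u, p)` on the simplex with vertex set `s`, up to the boundary. -/
def cellStress (s : Finset (Sp d)) (ν : ℝ) (u : Sp d → Sp d) (p : Sp d → ℝ) (x : Sp d) :
    Matrix (Fin d) (Fin d) ℝ :=
  stress ν (cellGrad s u x) (p x)

/-- The row-wise divergence `∇ ⬝ σ(u, p)` on the simplex with vertex set `s`. -/
def cellDivStress (s : Finset (Sp d)) (ν : ℝ) (u : Sp d → Sp d) (p : Sp d → ℝ) (x : Sp d) :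
    Fin d → ℝ :=
  fun i => ∑ j, fderivWithin ℝ (fun y => cellStress s ν u p y i j) (cell s) x
    (EuclideanSpace.single j 1)

open scoped Classical in
/-- The jump of the normal stress over the facet with vertex set `F`: the sum of `σ n`, with the
respective outward normal `n`, over the cells that have this facet (two cells if the facet is in
the interior of the domain). -/
def jump {Ω : Set (Sp d)} (𝒯 : Triangulation Ω) (ν : ℝ) (u : Sp d → Sp d) (p : Sp d → ℝ)
    (F : Finset (Sp d)) (x : Sp d) : Fin d → ℝ :=
  ∑ s ∈ 𝒯.cells, ∑ a ∈ s,
    if facet s a = F then cellStress s ν u p x *ᵥ (outwardNormal s a).ofLp else 0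

/-- `η_K^1`: the interior momentum residual on the cell, weighted by `v`. -/
def eta1 (s : Finset (Sp d)) (ν : ℝ) (f u : ℝ → Sp d → Sp d) (p : ℝ → Sp d → ℝ)
    (v : ℝ → Sp d → Sp d) (t : ℝ) : ℝ :=
  ∫ x in cell s, (v t x).ofLp ⬝ᵥ
    ((timeDeriv u t x).ofLp + cellGrad s (u t) x *ᵥ (u t x).ofLp
      - cellDivStress s ν (u t) (p t) x - (f t x).ofLp)

/-- `η_K^2`: half the jump of the normal stress on `∂K ∖ ∂Ω`, weighted by `v`. -/
def eta2 {Ω : Set (Sp d)} (𝒯 : Triangulation Ω) (s : Finset (Sp d)) (ν : ℝ)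
    (u : ℝ → Sp d → Sp d) (p : ℝ → Sp d → ℝ) (v : ℝ → Sp d → Sp d) (t : ℝ) : ℝ :=
  ∑ a ∈ s, ∫ x in cell (facet s a) \ frontier Ω,
    (trace s (v t) x).ofLp ⬝ᵥ ((1 / 2 : ℝ) • jump 𝒯 ν (u t) (p t) (facet s a) x) ∂(surf d)

/-- `η_K^3`: the boundary term `ν ∇ u n` on `∂K ∩ Γ_N`, weighted by `v`. -/
def eta3 (s : Finset (Sp d)) (ΓN : Set (Sp d)) (ν : ℝ)
    (u : ℝ → Sp d → Sp d) (v : ℝ → Sp d → Sp d) (t : ℝ) : ℝ :=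
  ∑ a ∈ s, ∫ x in cell (facet s a) ∩ ΓN,
    (trace s (v t) x).ofLp ⬝ᵥ (ν • (cellGrad s (u t) x *ᵥ (outwardNormal s a).ofLp)) ∂(surf d)

/-- `η_K^4`: the continuity residual on the cell, weighted by `q`. -/
def eta4 (s : Finset (Sp d)) (u : ℝ → Sp d → Sp d) (q : ℝ → Sp d → ℝ) (t : ℝ) : ℝ :=
  ∫ x in cell s, q t x * (cellGrad s (u t) x).trace

/-- The cell indicator `η_K = |η_K^1| + |η_K^2| + |η_K^3| + |η_K^4|` at time `t`, with the
weight `w = (v, q)`. -/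
def etaCell {Ω : Set (Sp d)} (𝒯 : Triangulation Ω) (ΓN : Set (Sp d)) (ν : ℝ)
    (f u : ℝ → Sp d → Sp d) (p : ℝ → Sp d → ℝ) (w : (ℝ → Sp d → Sp d) × (ℝ → Sp d → ℝ))
    (s : Finset (Sp d)) (t : ℝ) : ℝ :=
  |eta1 s ν f u p w.1 t| + |eta2 𝒯 s ν u p w.1 t| + |eta3 s ΓN ν u w.1 t| + |eta4 s u w.2 t|

/-- The space discretization error estimate `E_h`. -/
def spaceEstimate {Ω : Set (Sp d)} (𝒯 : Triangulation Ω) (ΓN : Set (Sp d)) (T ν : ℝ)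
    (f u : ℝ → Sp d → Sp d) (p : ℝ → Sp d → ℝ) (w : (ℝ → Sp d → Sp d) × (ℝ → Sp d → ℝ)) : ℝ :=
  ∫ t in (0 : ℝ)..T, ∑ s ∈ 𝒯.cells, etaCell 𝒯 ΓN ν f u p w s t

end NavierStokesFEM

end

open NavierStokesFEM

/-! At almost every time the integrand of `a` minus that of `L` equals the sum over the cells of the
signed quantities η_K^1 + η_K^2 + η_K^3 + η_K^4 (`formIntegrand_sub_loadIntegrand`). The residual is
minus the time integral of this sum, so the estimate follows by taking absolute values term by term.

The identity is cellwise integration by parts. The stress σ is symmetric, so ε(v) : σ = ∇v : σ. On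
each cell Green's formula turns this into the interior term -v · (∇ · σ), which joins η_K^1, and the
boundary flux v · σn. The flux is sorted by facet. On Γ_D the trace of v vanishes. On Γ_N, σn =
(ν(∇U)ᵀn - Pn) + ν∇U n; the first part is the boundary term subtracted in `a`, and the second is
η_K^3. A facet that meets Ω in positive surface measure belongs to exactly two cells with opposite
normals, and the traces of v from both sides agree. The two fluxes therefore add up to v times the
jump of the normal stress, half of which is assigned to each cell as η_K^2.

Most of the work is to justify this for traces defined as L² limits of smooth fields, and for
surface measure defined as a Hausdorff measure. The main tool is a radial identity: slicing the
simplex parallel to the facet opposite to a vertex a shows that the integral over K of (d φ + Dφ(x -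
a)) g, with g constant along rays from a, equals the height times the integral over the facet of φ g
(`IsSimplex.integral_radial`). It yields the divergence theorem (`IsSimplex.integral_fderiv`) and
the trace inequality (`IsSimplex.exists_eLpNorm_frontier_le`). Together with smooth approximation up
to the boundary (`exists_smooth_approx`), it gives the existence of traces (`exists_isTrace`), their
additivity (`IsTrace.sub_ae_eq`) and Green's formula (`IsTrace.integral_green`). Since it expresses
a facet integral of a trace as a volume integral, it also gives the integrability in time of
boundary terms (`integrable_integral_trace`).

The geometric input from conformity is `outwardNormal_eq_neg`, `Triangulation.exists_opposite_side`
and `Triangulation.trace_ae_eq`. The discrete fields are handled through `IsSeparated`, a class that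
contains them and is closed under the algebraic operations and spatial derivatives that occur. -/

namespace NavierStokesFEM

/-! ### Geometry of a simplex: heights, barycentric coordinates and facets. -/

variable {d : ℕ}

/-- The vertex set of a nondegenerate `d`-simplex. -/
structure IsSimplex (s : Finset (Sp d)) : Prop where
  card_eq : s.card = d + 1
  indep : AffineIndependent ℝ ((↑) : s → Sp d)

lemma Triangulation.isSimplex {Ω : Set (Sp d)} (𝒯 : Triangulation Ω) {s : Finset (Sp d)}
    (hs : s ∈ 𝒯.cells) : IsSimplex s :=
  ⟨𝒯.card_vertices s hs, 𝒯.affineIndependent s hs⟩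

/-- The affine function that vanishes at the vertex `a` of `s` and equals one on the opposite
facet. -/
noncomputable def level (s : Finset (Sp d)) (a x : Sp d) : ℝ :=
  inner ℝ (outwardVector s a) (x - a) / ‖outwardVector s a‖ ^ 2

lemma mem_facet {s : Finset (Sp d)} {a p : Sp d} : p ∈ facet s a ↔ p ≠ a ∧ p ∈ s := by
  classical
  simp [facet]

lemma facet_subset (s : Finset (Sp d)) (a : Sp d) : facet s a ⊆ s := fun _ h => (mem_facet.1 h).2

lemma cell_mono {s t : Finset (Sp d)} (h : s ⊆ t) : cell s ⊆ cell t :=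
  convexHull_mono (by exact_mod_cast h)

lemma convex_cell (s : Finset (Sp d)) : Convex ℝ (cell s) := convex_convexHull _ _

lemma isCompact_cell (s : Finset (Sp d)) : IsCompact (cell s) :=
  (Finset.finite_toSet s).isCompact_convexHull ℝ

lemma isClosed_cell (s : Finset (Sp d)) : IsClosed (cell s) := (isCompact_cell s).isClosed

lemma subset_cell {s : Finset (Sp d)} {p : Sp d} (h : p ∈ s) : p ∈ cell s :=
  subset_convexHull ℝ _ (by exact_mod_cast h)

lemma level_self (s : Finset (Sp d)) (a : Sp d) : level s a a = 0 := by simp [level]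

lemma continuous_level (s : Finset (Sp d)) (a : Sp d) : Continuous (level s a) := by
  unfold level; fun_prop

lemma level_lineMap (s : Finset (Sp d)) (a x y : Sp d) (r : ℝ) :
    level s a (x + r • (y - x)) = level s a x + r * (level s a y - level s a x) := by
  simp only [level]
  rw [show x + r • (y - x) - a = (x - a) + r • ((y - a) - (x - a)) by module]
  rw [inner_add_right, inner_smul_right, inner_sub_right _ (y - a)]
  ring

lemma level_sum (s : Finset (Sp d)) (a : Sp d) {ι : Type*} (I : Finset ι) (w : ι → ℝ)
    (p : ι → Sp d) (hw : ∑ i ∈ I, w i = 1) :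
    level s a (∑ i ∈ I, w i • p i) = ∑ i ∈ I, w i * level s a (p i) := by
  simp only [level]
  have : ∑ i ∈ I, w i • p i - a = ∑ i ∈ I, w i • (p i - a) := by
    simp only [smul_sub, Finset.sum_sub_distrib, ← Finset.sum_smul, hw, one_smul]
  rw [this, inner_sum, Finset.sum_div]
  refine Finset.sum_congr rfl fun i _ => ?_
  rw [inner_smul_right]; ring

namespace IsSimplex

variable {s : Finset (Sp d)}

lemma card_facet (hs : IsSimplex s) {a : Sp d} (ha : a ∈ s) : (facet s a).card = d := by
  classical
  have := Finset.card_erase_of_mem ha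
  rw [hs.card_eq] at this
  rw [Nat.add_sub_cancel] at this
  convert this using 2
  simp only [facet]

lemma facet_nonempty (hs : IsSimplex s) (hd : 0 < d) {a : Sp d} (ha : a ∈ s) :
    (facet s a).Nonempty := by
  rw [← Finset.card_pos, hs.card_facet ha]; exact hd

lemma notMem_affineSpan_facet (hs : IsSimplex s) {a : Sp d} (ha : a ∈ s) :
    a ∉ affineSpan ℝ (facet s a : Set (Sp d)) := by
  have := hs.indep.notMem_affineSpan_sdiff ⟨a, ha⟩ Set.univ
  convert this using 3
  ext p; simp [mem_facet, and_comm, eq_comm]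

lemma centroid_mem (hs : IsSimplex s) (hd : 0 < d) {a : Sp d} (ha : a ∈ s) :
    (facet s a).centroid ℝ id ∈ affineSpan ℝ (facet s a : Set (Sp d)) := by
  exact convexHull_subset_affineSpan _
    ((facet s a).centroid_mem_convexHull (hs.facet_nonempty hd ha))

/-- If the orthogonal component vanished, the vector from `a` to the centroid would be parallel to
the facet. Then `a` would lie in the affine span of the facet, against affine independence. -/
lemma outwardVector_ne_zero (hs : IsSimplex s) (hd : 0 < d) {a : Sp d} (ha : a ∈ s) :
    outwardVector s a ≠ 0 := by
  intro h
  rw [outwardVector, Submodule.starProjection_apply_eq_zero_iff,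
    Submodule.orthogonal_orthogonal] at h
  refine hs.notMem_affineSpan_facet ha ?_
  have hc := hs.centroid_mem hd ha
  rw [← direction_affineSpan] at h
  have := AffineSubspace.vadd_mem_of_mem_direction (Submodule.neg_mem _ h) hc
  simpa using this

lemma norm_outwardVector_pos (hs : IsSimplex s) (hd : 0 < d) {a : Sp d} (ha : a ∈ s) :
    0 < ‖outwardVector s a‖ := norm_pos_iff.2 (hs.outwardVector_ne_zero hd ha)

lemma outwardVector_mem (s : Finset (Sp d)) (a : Sp d) :
    outwardVector s a ∈ (vectorSpan ℝ (facet s a : Set (Sp d)))ᗮ :=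
  Submodule.starProjection_apply_mem _ _

/-- The component of `p - a` orthogonal to the facet is the same for every point `p` of the facet
plane. For the centroid the inner product is a squared norm, because an orthogonal projection is
self-adjoint and idempotent. Hence `level` is one on the whole plane. -/
lemma inner_outwardVector (hs : IsSimplex s) (hd : 0 < d) {a : Sp d} (ha : a ∈ s) {p : Sp d}
    (hp : p ∈ affineSpan ℝ (facet s a : Set (Sp d))) :
    inner ℝ (outwardVector s a) (p - a) = ‖outwardVector s a‖ ^ 2 := by
  have hc := hs.centroid_mem hd ha
  have h1 : p - (facet s a).centroid ℝ id ∈ vectorSpan ℝ (facet s a : Set (Sp d)) := by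
    rw [← direction_affineSpan]
    exact AffineSubspace.vsub_mem_direction hp hc
  have h2 : inner ℝ (outwardVector s a) (p - (facet s a).centroid ℝ id) = 0 :=
    Submodule.inner_left_of_mem_orthogonal h1 (outwardVector_mem s a)
  have h3 : inner ℝ (outwardVector s a) ((facet s a).centroid ℝ id - a)
      = ‖outwardVector s a‖ ^ 2 := by
    rw [← real_inner_self_eq_norm_sq]
    conv_rhs => rw [outwardVector, Submodule.inner_starProjection_left_eq_right,
      Submodule.starProjection_eq_self_iff.2 (Submodule.starProjection_apply_mem _ _)]
    conv_lhs => rw [outwardVector, Submodule.inner_starProjection_left_eq_right]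
  rw [← h3, ← sub_add_sub_cancel p ((facet s a).centroid ℝ id) a, inner_add_right, h2, zero_add]

lemma level_of_mem_affineSpan (hs : IsSimplex s) (hd : 0 < d) {a : Sp d} (ha : a ∈ s) {p : Sp d}
    (hp : p ∈ affineSpan ℝ (facet s a : Set (Sp d))) : level s a p = 1 := by
  rw [level, hs.inner_outwardVector hd ha hp, div_self]
  have := hs.norm_outwardVector_pos hd ha
  positivity

lemma level_of_mem (hs : IsSimplex s) (hd : 0 < d) {a p : Sp d} (ha : a ∈ s)
    (hp : p ∈ s) (hpa : p ≠ a) : level s a p = 1 :=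
  hs.level_of_mem_affineSpan hd ha (subset_affineSpan ℝ _ (by simp [mem_facet, hp, hpa]))

lemma level_of_mem_facet (hs : IsSimplex s) (hd : 0 < d) {a p : Sp d} (ha : a ∈ s)
    (hp : p ∈ cell (facet s a)) : level s a p = 1 :=
  hs.level_of_mem_affineSpan hd ha (convexHull_subset_affineSpan _ hp)

/-- The vertices of a simplex as an affine basis. -/
noncomputable def basis (hs : IsSimplex s) : AffineBasis s ℝ (Sp d) :=
  ⟨(↑), hs.indep, by
    rw [hs.indep.affineSpan_eq_top_iff_card_eq_finrank_add_one]
    simp [hs.card_eq]⟩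

lemma range_basis (hs : IsSimplex s) : range hs.basis = s := by
  ext p; constructor
  · rintro ⟨q, rfl⟩; exact q.2
  · intro h; exact ⟨⟨p, h⟩, rfl⟩

/-- `level s a` is affine, zero at `a` and one at the other vertices, so it sums the barycentric
coordinates of all vertices except `a`. This links normals and heights to barycentric coordinates.
-/
lemma coord_eq (hs : IsSimplex s) (hd : 0 < d) (a : s) (x : Sp d) :
    hs.basis.coord a x = 1 - level s a x := by
  classical
  have h1 := hs.basis.sum_coord_apply_eq_one x
  have h2 : level s a (∑ i, hs.basis.coord i x • hs.basis i)
      = ∑ i, hs.basis.coord i x * level s a (hs.basis i) := level_sum s a _ _ _ h1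
  rw [hs.basis.linear_combination_coord_eq_self] at h2
  have h3 : ∀ i : s, level s a (hs.basis i) = if i = a then 0 else 1 := by
    intro i
    split_ifs with h
    · subst h; exact level_self s _
    · exact hs.level_of_mem hd a.2 i.2 (fun h' => h (Subtype.ext h'))
  simp only [h3, mul_ite, mul_zero, mul_one] at h2
  have h4 : level s a x + hs.basis.coord a x = 1 := by
    have h5 : hs.basis.coord a x = ∑ i, if i = a then hs.basis.coord i x else 0 := by simp
    rw [h2, ← h1, h5, ← Finset.sum_add_distrib]
    exact Finset.sum_congr rfl fun i _ => by split_ifs <;> simp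
  linarith

lemma sum_one_sub_level (hs : IsSimplex s) (hd : 0 < d) (x : Sp d) :
    ∑ a ∈ s, (1 - level s a x) = 1 := by
  rw [← Finset.sum_coe_sort]
  refine Eq.trans ?_ (hs.basis.sum_coord_apply_eq_one x)
  exact Finset.sum_congr rfl fun a _ => (hs.coord_eq hd a x).symm

lemma sum_one_sub_level_smul (hs : IsSimplex s) (hd : 0 < d) (x : Sp d) :
    ∑ a ∈ s, (1 - level s a x) • a = x := by
  rw [← Finset.sum_coe_sort]
  conv_rhs => rw [← hs.basis.linear_combination_coord_eq_self x]
  exact Finset.sum_congr rfl fun a _ => by rw [hs.coord_eq hd a x]; rfl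

lemma mem_cell_iff (hs : IsSimplex s) (hd : 0 < d) {x : Sp d} :
    x ∈ cell s ↔ ∀ a ∈ s, level s a x ≤ 1 := by
  rw [cell, ← hs.range_basis, hs.basis.convexHull_eq_nonneg_coord]
  simp only [mem_ofPred_eq, hs.coord_eq hd, sub_nonneg, Subtype.forall]

lemma mem_interior_iff (hs : IsSimplex s) (hd : 0 < d) {x : Sp d} :
    x ∈ interior (cell s) ↔ ∀ a ∈ s, level s a x < 1 := by
  rw [cell, ← hs.range_basis, hs.basis.interior_convexHull]
  simp only [mem_ofPred_eq, hs.coord_eq hd, sub_pos, Subtype.forall]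

lemma level_nonneg (hs : IsSimplex s) (hd : 0 < d) {x a : Sp d} (hx : x ∈ cell s) (ha : a ∈ s) :
    0 ≤ level s a x := by
  have h1 := hs.sum_one_sub_level hd x
  have h2 := Finset.single_le_sum (f := fun a => 1 - level s a x)
    (fun b hb => sub_nonneg.2 ((hs.mem_cell_iff hd).1 hx b hb)) ha
  simp only [h1] at h2
  linarith

lemma interior_nonempty (hs : IsSimplex s) : (interior (cell s)).Nonempty := by
  rw [cell, ← hs.range_basis]
  exact ⟨_, hs.basis.centroid_mem_interior_convexHull⟩

lemma uniqueDiffOn_cell (hs : IsSimplex s) : UniqueDiffOn ℝ (cell s) :=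
  uniqueDiffOn_convex (convex_cell s) hs.interior_nonempty

lemma closure_interior_cell (hs : IsSimplex s) : closure (interior (cell s)) = cell s := by
  rw [(convex_cell s).closure_interior_eq_closure_of_nonempty_interior hs.interior_nonempty,
    (isClosed_cell s).closure_eq]

/-- A face is cut out of the simplex by the vanishing of the barycentric coordinates of the missing
vertices; dropping the zero coordinates leaves a convex combination of `t`. -/
lemma mem_cell_subset_iff (hs : IsSimplex s) (hd : 0 < d) {t : Finset (Sp d)} (ht : t ⊆ s)
    {x : Sp d} : x ∈ cell t ↔ x ∈ cell s ∧ ∀ a ∈ s, a ∉ t → level s a x = 1 := by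
  constructor
  · intro hx
    refine ⟨cell_mono ht hx, fun a ha hat => hs.level_of_mem_facet hd ha (cell_mono ?_ hx)⟩
    intro p hp
    exact mem_facet.2 ⟨fun h => hat (h ▸ hp), ht hp⟩
  · rintro ⟨hx, h⟩
    have h0 : ∀ a ∈ s, a ∉ t → 1 - level s a x = 0 := fun a ha hat => by rw [h a ha hat, sub_self]
    have h1 : ∑ a ∈ t, (1 - level s a x) = 1 := by
      exact (Finset.sum_subset ht h0).trans (hs.sum_one_sub_level hd x)
    have h2 : ∑ a ∈ t, (1 - level s a x) • a = x := by
      conv_rhs => rw [← hs.sum_one_sub_level_smul hd x]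
      exact Finset.sum_subset ht fun a ha hat => by rw [h0 a ha hat, zero_smul]
    rw [← h2]
    exact (convex_cell t).sum_mem
      (fun a ha => sub_nonneg.2 ((hs.mem_cell_iff hd).1 hx a (ht ha))) h1
      (fun a ha => subset_cell ha)

lemma mem_facet_cell_iff (hs : IsSimplex s) (hd : 0 < d) {x a : Sp d} (ha : a ∈ s) :
    x ∈ cell (facet s a) ↔ x ∈ cell s ∧ level s a x = 1 := by
  rw [hs.mem_cell_subset_iff hd (facet_subset s a)]
  refine and_congr_right fun _ => ⟨fun h => h a ha (by simp [mem_facet]), fun h b hb hbt => ?_⟩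
  have : b = a := by
    by_contra hne
    exact hbt (mem_facet.2 ⟨hne, hb⟩)
  rw [this, h]

lemma frontier_cell (hs : IsSimplex s) (hd : 0 < d) :
    frontier (cell s) = ⋃ a ∈ s, cell (facet s a) := by
  ext x
  rw [(isClosed_cell s).frontier_eq, Set.mem_sdiff, hs.mem_interior_iff hd]
  simp only [mem_iUnion, exists_prop]
  push Not
  constructor
  · rintro ⟨hx, a, ha, h⟩
    exact ⟨a, ha, (hs.mem_facet_cell_iff hd ha).2 ⟨hx, le_antisymm ((hs.mem_cell_iff hd).1 hx a ha) h⟩⟩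
  · rintro ⟨a, ha, h⟩
    rw [hs.mem_facet_cell_iff hd ha] at h
    exact ⟨h.1, a, ha, h.2.ge⟩

lemma facet_subset_frontier (hs : IsSimplex s) (hd : 0 < d) {a : Sp d} (ha : a ∈ s) :
    cell (facet s a) ⊆ frontier (cell s) := by
  rw [hs.frontier_cell hd]; exact subset_biUnion_of_mem (u := fun a => cell (facet s a)) ha

/-- The slice of the simplex at level `r` is the facet scaled by `r` about `a`. For the converse,
the level of any other vertex `b` is one at `a`, so `level s b` is at most one at the scaled point
only if it is at most one at `y`. -/
lemma mem_facet_iff_homothety (hs : IsSimplex s) (hd : 0 < d) {a y : Sp d} (ha : a ∈ s) {r : ℝ}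
    (hr0 : 0 < r) (hr1 : r ≤ 1) :
    y ∈ cell (facet s a) ↔ a + r • (y - a) ∈ cell s ∧ level s a (a + r • (y - a)) = r := by
  rw [hs.mem_facet_cell_iff hd ha, level_lineMap, level_self]
  simp only [sub_zero, zero_add]
  constructor
  · rintro ⟨hy, h1⟩
    refine ⟨(convex_cell s).add_smul_sub_mem (subset_cell ha) hy ⟨hr0.le, hr1⟩, by rw [h1, mul_one]⟩
  · rintro ⟨hx, h1⟩
    have h2 : level s a y = 1 := by
      have : r * (level s a y - 1) = 0 := by linarith
      rcases mul_eq_zero.1 this with h | h <;> linarith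
    refine ⟨(hs.mem_cell_iff hd).2 fun b hb => ?_, h2⟩
    by_cases hba : b = a
    · rw [hba, h2]
    · have h3 := (hs.mem_cell_iff hd).1 hx b hb
      rw [level_lineMap, hs.level_of_mem hd hb ha (Ne.symm hba)] at h3
      nlinarith

/-- The barycentric coordinates sum to one, so their derivatives in the direction `e` sum to zero.
-/
lemma sum_inner_outwardVector (hs : IsSimplex s) (hd : 0 < d) (e : Sp d) :
    ∑ a ∈ s, inner ℝ (outwardVector s a) e / ‖outwardVector s a‖ ^ 2 = 0 := by
  have h1 := hs.sum_one_sub_level hd e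
  have h0 := hs.sum_one_sub_level hd 0
  rw [← sub_eq_zero.2 (h0.trans h1.symm), ← Finset.sum_sub_distrib]
  refine Finset.sum_congr rfl fun a _ => ?_
  simp only [level, inner_sub_right, inner_zero_right]; ring

/-- A constant vector as a combination of the radial fields of the vertices. -/
lemma sum_inner_outwardVector_smul (hs : IsSimplex s) (hd : 0 < d) (e x : Sp d) :
    ∑ a ∈ s, (inner ℝ (outwardVector s a) e / ‖outwardVector s a‖ ^ 2) • (x - a) = e := by
  have h1 := hs.sum_one_sub_level_smul hd e
  have h0 := hs.sum_one_sub_level_smul hd 0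
  simp only [smul_sub, Finset.sum_sub_distrib, ← Finset.sum_smul, hs.sum_inner_outwardVector hd e,
    zero_smul, zero_sub]
  have h2 : e = ∑ a ∈ s, ((1 - level s a e) • a - (1 - level s a 0) • a) := by
    rw [Finset.sum_sub_distrib, h1, h0, sub_zero]
  conv_rhs => rw [h2]
  rw [← Finset.sum_neg_distrib]
  refine Finset.sum_congr rfl fun a _ => ?_
  rw [← sub_smul, ← neg_smul]
  congr 1
  simp only [level, inner_sub_right, inner_zero_right]; ring

end IsSimplex

end NavierStokesFEM

namespace NavierStokesFEM

variable {d : ℕ}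

/-! ### Surface measure and the cone formula -/

lemma finrank_vectorSpan_coe_le {w : Finset (Sp d)} (hw : w.Nonempty) :
    Module.finrank ℝ (vectorSpan ℝ (w : Set (Sp d))) ≤ w.card - 1 := by
  have h1 := finrank_vectorSpan_range_le ℝ ((↑) : w → Sp d)
    (n := w.card - 1) (by have := Finset.card_pos.2 hw; simp; omega)
  rwa [Subtype.range_coe_subtype] at h1

/-- Fewer than `d` points span an affine space of dimension below `d - 1`, which the `(d -
1)`-dimensional Hausdorff measure does not see. Up to a translation it is the isometric image of its
direction space. -/
lemma surf_affineSpan_eq_zero {w : Finset (Sp d)} (hw : w.card < d) :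
    surf d (affineSpan ℝ (w : Set (Sp d)) : Set (Sp d)) = 0 := by
  rcases w.eq_empty_or_nonempty with rfl | ⟨p, hp⟩
  · simp
  have hdim : Module.finrank ℝ (vectorSpan ℝ (w : Set (Sp d))) < d - 1 := by
    have h1 := finrank_vectorSpan_coe_le ⟨p, hp⟩
    have h2 := Finset.card_pos.2 ⟨p, hp⟩
    omega
  set W := vectorSpan ℝ (w : Set (Sp d))
  have h0 : surf d (W : Set (Sp d)) = 0 := by
    have h1 : (W : Set (Sp d)) = ((↑) : W → Sp d) '' univ := by simp
    rw [surf, h1, isometry_subtype_coe.euclideanHausdorffMeasure_image,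
      Measure.euclideanHausdorffMeasure_def, Measure.smul_apply]
    have h2 : (μH[((d - 1 : ℕ) : ℝ)] : Measure W) = 0 :=
      Real.hausdorffMeasure_of_finrank_lt (by exact_mod_cast hdim)
    rw [show (μH[((d - 1 : ℕ) : ℝ)] : Measure W) univ = 0 by rw [h2]; rfl, smul_zero]
  have h2 : (affineSpan ℝ (w : Set (Sp d)) : Set (Sp d)) = (fun x => x + p) '' (W : Set (Sp d)) := by
    ext x
    simp only [SetLike.mem_coe, mem_image]
    constructor
    · intro hx
      refine ⟨x - p, ?_, by simp⟩
      have := AffineSubspace.vsub_mem_direction hx (subset_affineSpan ℝ _ (Finset.mem_coe.2 hp))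
      rwa [direction_affineSpan] at this
    · rintro ⟨y, hy, rfl⟩
      have hy : y ∈ vectorSpan ℝ (w : Set (Sp d)) := hy
      rw [← direction_affineSpan] at hy
      exact AffineSubspace.vadd_mem_of_mem_direction hy
        (subset_affineSpan ℝ _ (Finset.mem_coe.2 hp))
  rw [h2, surf, (isometry_add_right p).euclideanHausdorffMeasure_image]
  exact h0

lemma surf_cell_eq_zero {w : Finset (Sp d)} (hw : w.card < d) : surf d (cell w) = 0 :=
  measure_mono_null (convexHull_subset_affineSpan _) (surf_affineSpan_eq_zero hw)

lemma volume_cell_eq_zero {w : Finset (Sp d)} (hw : w.card < d + 1) :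
    (volume : Measure (Sp d)) (cell w) = 0 := by
  refine measure_mono_null (convexHull_subset_affineSpan _)
    (Measure.addHaar_affineSubspace _ _ fun h => ?_)
  rcases w.eq_empty_or_nonempty with rfl | ⟨p, hp⟩
  · rw [Finset.coe_empty, AffineSubspace.span_empty] at h
    exact AffineSubspace.bot_ne_top ℝ (Sp d) (Sp d) h
  have h1 := finrank_vectorSpan_coe_le ⟨p, hp⟩
  have h2 := Finset.card_pos.2 ⟨p, hp⟩
  rw [← direction_affineSpan] at h1
  rw [h, AffineSubspace.direction_top, finrank_top,
    finrank_euclideanSpace, Fintype.card_fin] at h1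
  omega

namespace IsSimplex

variable {s : Finset (Sp d)}

/-- The volume is sliced along the outward vector. The slice at level `r` is a homothetic copy of
the facet, which scales surface measure by `r ^ (d - 1)`, and slices outside `Ioc 0 1` are empty. -/
lemma volume_inter_cell (hs : IsSimplex s) (hd : 0 < d) {a : Sp d} (ha : a ∈ s) {t : Set (Sp d)}
    (ht : MeasurableSet t) :
    volume (t ∩ cell s) = ‖outwardVector s a‖ₑ * ∫⁻ r in Ioc (0 : ℝ) 1, ENNReal.ofReal (r ^ (d - 1)) *
      surf d ((fun y => a + r • (y - a)) ⁻¹' t ∩ cell (facet s a)) := by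
  have hv := hs.outwardVector_ne_zero hd ha
  have hvol := EuclideanGeometry.euclideanHausdorffMeasure_eq_lintegral a hv
    (ht.inter (isClosed_cell s).measurableSet)
  rw [InnerProductSpace.euclideanHausdorffMeasure_eq_volume] at hvol
  rw [hvol, ← lintegral_indicator measurableSet_Ioc]
  congr 1
  have hmem : ∀ (r : ℝ) (x : Sp d), x ∈ AffineSubspace.mk' (r • outwardVector s a +ᵥ a)
      (Submodule.span ℝ {outwardVector s a})ᗮ ↔ level s a x = r := by
    intro r x
    rw [AffineSubspace.mem_mk', Submodule.mem_orthogonal_singleton_iff_inner_right, level,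
      div_eq_iff (by have := hs.norm_outwardVector_pos hd ha; positivity), vsub_eq_sub, vadd_eq_add,
      ← sub_sub, sub_right_comm, inner_sub_right, inner_smul_right, real_inner_self_eq_norm_sq,
      sub_eq_zero]
  refine lintegral_congr_ae ?_
  -- The slice through the vertex is discarded because the homothety of ratio zero is not
  -- invertible.
  have h0 : ∀ᵐ r : ℝ, r ≠ 0 := by simp [ae_iff]
  filter_upwards [h0] with r hr
  rw [finrank_euclideanSpace, Fintype.card_fin]
  by_cases hr1 : r ∈ Ioc (0 : ℝ) 1
  · rw [indicator_of_mem hr1]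
    have himg : t ∩ cell s ∩ AffineSubspace.mk' (r • outwardVector s a +ᵥ a)
        (Submodule.span ℝ {outwardVector s a})ᗮ =
        AffineMap.homothety a r '' ((fun y => a + r • (y - a)) ⁻¹' t ∩ cell (facet s a)) := by
      ext x
      simp only [mem_inter_iff, SetLike.mem_coe, hmem, mem_image, mem_preimage]
      constructor
      · rintro ⟨⟨hxt, hxs⟩, hl⟩
        have hx : a + r • (a + r⁻¹ • (x - a) - a) = x := by
          rw [add_sub_cancel_left, smul_smul, mul_inv_cancel₀ hr, one_smul, add_sub_cancel]
        refine ⟨a + r⁻¹ • (x - a), ⟨by rwa [hx], ?_⟩, ?_⟩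
        · rw [hs.mem_facet_iff_homothety hd ha hr1.1 hr1.2, hx]; exact ⟨hxs, hl⟩
        · rw [AffineMap.homothety_apply, vsub_eq_sub, vadd_eq_add, add_comm, hx]
      · rintro ⟨y, ⟨hyt, hyF⟩, rfl⟩
        rw [hs.mem_facet_iff_homothety hd ha hr1.1 hr1.2] at hyF
        rw [AffineMap.homothety_apply, vsub_eq_sub, vadd_eq_add, add_comm]
        exact ⟨⟨hyt, hyF.1⟩, hyF.2⟩
    rw [himg, euclideanHausdorffMeasure_homothety_image _ _ hr, surf, ENNReal.smul_def,
      smul_eq_mul]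
    congr 1
    rw [ENNReal.coe_pow, ENNReal.ofReal_pow hr1.1.le, ← Real.enorm_of_nonneg hr1.1.le]
    rfl
  · rw [indicator_of_notMem hr1]
    convert measure_empty (μ := Measure.euclideanHausdorffMeasure (X := Sp d) (d - 1))
    rw [eq_empty_iff_forall_notMem]
    rintro x ⟨⟨-, hx⟩, hl⟩
    rw [SetLike.mem_coe, hmem] at hl
    refine hr1 ⟨lt_of_le_of_ne (hl ▸ hs.level_nonneg hd hx ha) hr.symm, ?_⟩
    exact hl ▸ (hs.mem_cell_iff hd).1 hx a ha

/-- With `t = univ`, the slicing formula writes the finite volume of the cell as a positive factor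
times the surface measure of the facet. -/
lemma surf_facet_lt_top (hs : IsSimplex s) (hd : 0 < d) {a : Sp d} (ha : a ∈ s) :
    surf d (cell (facet s a)) < ⊤ := by
  have h := hs.volume_inter_cell hd ha MeasurableSet.univ
  simp only [univ_inter, preimage_univ] at h
  rw [lintegral_mul_const _ (by fun_prop), ← mul_assoc] at h
  have hfin : volume (cell s) < ⊤ := (isCompact_cell s).measure_lt_top
  rw [h] at hfin
  refine (ENNReal.mul_lt_top_iff.1 hfin).elim (fun h => h.2) fun h' => ?_
  rcases h' with h' | h'
  · exfalso
    rcases mul_eq_zero.1 h' with h1 | h1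
    · exact hs.outwardVector_ne_zero hd ha (enorm_eq_zero.1 h1)
    · rw [lintegral_eq_zero_iff (by fun_prop), Filter.EventuallyEq,
        ae_restrict_iff' measurableSet_Ioc] at h1
      have h2 : volume (Ioc (0 : ℝ) 1) = 0 := by
        refine measure_mono_null (fun r hr => ?_) h1
        simp only [mem_compl_iff, mem_ofPred_eq, Pi.zero_apply, ENNReal.ofReal_eq_zero]
        intro h3
        have := h3 hr
        have := pow_pos hr.1 (d - 1)
        linarith
      simp at h2
  · rw [h']; exact ENNReal.zero_lt_top

lemma isFiniteMeasure_surf_facet (hs : IsSimplex s) (hd : 0 < d) {a : Sp d} (ha : a ∈ s) :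
    IsFiniteMeasure ((surf d).restrict (cell (facet s a))) :=
  ⟨by rw [Measure.restrict_apply_univ]; exact hs.surf_facet_lt_top hd ha⟩

lemma isFiniteMeasure_surf_frontier (hs : IsSimplex s) (hd : 0 < d) :
    IsFiniteMeasure ((surf d).restrict (frontier (cell s))) := by
  refine ⟨?_⟩
  rw [Measure.restrict_apply_univ, hs.frontier_cell hd]
  exact measure_biUnion_lt_top s.finite_toSet fun a ha => hs.surf_facet_lt_top hd ha

end IsSimplex

/-! ### Divergence theorem on a simplex. -/

/-- The radial part of Lebesgue measure on a cone of height `h`. -/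
noncomputable def radialMeasure (d : ℕ) (h : ℝ) : Measure ℝ :=
  (volume.restrict (Ioc (0 : ℝ) 1)).withDensity fun r => ENNReal.ofReal (h * r ^ (d - 1))

instance (d : ℕ) (h : ℝ) : SFinite (radialMeasure d h) := by unfold radialMeasure; infer_instance

/-- The central projection from the vertex `a` onto the hyperplane of the opposite facet. -/
noncomputable def centralProj (s : Finset (Sp d)) (a x : Sp d) : Sp d :=
  a + (level s a x)⁻¹ • (x - a)

lemma measurable_centralProj (s : Finset (Sp d)) (a : Sp d) : Measurable (centralProj s a) := by
  unfold centralProj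
  have := (continuous_level s a).measurable
  fun_prop

namespace IsSimplex

variable {s : Finset (Sp d)}

lemma centralProj_cone (hs : IsSimplex s) (hd : 0 < d) {a y : Sp d} (ha : a ∈ s)
    (hy : y ∈ cell (facet s a)) {r : ℝ} (hr : r ≠ 0) :
    centralProj s a (a + r • (y - a)) = y := by
  rw [centralProj, level_lineMap, level_self, hs.level_of_mem_facet hd ha hy]
  simp [smul_smul, hr]

/-- This is the slicing formula as a change of variables: the cone over the facet is parametrised by
the facet and the radial variable, and Fubini becomes available. -/
lemma measurePreserving_cone (hs : IsSimplex s) (hd : 0 < d) {a : Sp d} (ha : a ∈ s) :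
    MeasurePreserving (fun q : ℝ × Sp d => a + q.1 • (q.2 - a))
      ((radialMeasure d ‖outwardVector s a‖).prod ((surf d).restrict (cell (facet s a))))
      (volume.restrict (cell s)) := by
  have := hs.isFiniteMeasure_surf_facet hd ha
  have hm : Measurable (fun q : ℝ × Sp d => a + q.1 • (q.2 - a)) := by fun_prop
  refine ⟨hm, Measure.ext fun t ht => ?_⟩
  rw [Measure.map_apply hm ht, Measure.restrict_apply ht, hs.volume_inter_cell hd ha ht,
    Measure.prod_apply (hm ht), radialMeasure, lintegral_withDensity_eq_lintegral_mul _ (by fun_prop)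
      (measurable_measure_prodMk_left (hm ht)), ← lintegral_const_mul' _ _ (by simp)]
  refine setLIntegral_congr_fun measurableSet_Ioc fun r hr => ?_
  have h1 : MeasurableSet ((fun y : Sp d => a + r • (y - a)) ⁻¹' t) :=
    ht.preimage (by fun_prop)
  simp only [Pi.mul_apply]
  rw [← mul_assoc, ENNReal.ofReal_mul (norm_nonneg _), ← ofReal_norm,
    show Prod.mk r ⁻¹' ((fun q : ℝ × Sp d => a + q.1 • (q.2 - a)) ⁻¹' t)
      = (fun y : Sp d => a + r • (y - a)) ⁻¹' t from rfl, Measure.restrict_apply h1]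

/-- The divergence theorem on a simplex for radial fields, weighted by a function that is constant
along the rays through the vertex `a`. -/
lemma integral_radial (hs : IsSimplex s) (hd : 0 < d) {a : Sp d} (ha : a ∈ s) {φ : Sp d → ℝ}
    (hφ : ContDiff ℝ 1 φ) {g : Sp d → ℝ} (hg : Measurable g) {B : ℝ} (hgB : ∀ x, |g x| ≤ B) :
    ∫ x in cell s, (d * φ x + fderiv ℝ φ x (x - a)) * g (centralProj s a x) =
      ‖outwardVector s a‖ * ∫ y in cell (facet s a), φ y * g y ∂(surf d) := by
  have := hs.isFiniteMeasure_surf_facet hd ha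
  have hmp := hs.measurePreserving_cone hd ha
  have hc : Continuous fun x => d * φ x + fderiv ℝ φ x (x - a) := by
    have := hφ.continuous
    have := hφ.continuous_fderiv one_ne_zero
    fun_prop
  have hgm : Measurable fun x => g (centralProj s a x) := hg.comp (measurable_centralProj s a)
  have hint : IntegrableOn (fun x => (d * φ x + fderiv ℝ φ x (x - a)) * g (centralProj s a x))
      (cell s) := by
    exact Integrable.mul_bdd (hc.continuousOn.integrableOn_compact (isCompact_cell s))
      hgm.aestronglyMeasurable (ae_of_all _ fun x => hgB _)
  have hint' := (hmp.integrable_comp hint.aestronglyMeasurable).2 hint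
  have hmap := integral_map hmp.measurable.aemeasurable
    (hmp.map_eq.symm ▸ hint.aestronglyMeasurable)
  rw [hmp.map_eq] at hmap
  rw [hmap]
  refine (integral_prod_symm _ hint').trans ?_
  rw [← integral_const_mul]
  refine setIntegral_congr_fun (isClosed_cell _).measurableSet fun y hy => ?_
  simp only [radialMeasure]
  rw [integral_withDensity_eq_integral_toReal_smul (by fun_prop)
    (ae_of_all _ fun _ => ENNReal.ofReal_lt_top)]
  -- Along the ray through `y`, the integrand times the density `r ^ (d - 1)` is, up to a constant,
  -- the derivative of `r ^ d * φ`. Only the endpoint on the facet contributes, since `r ^ d`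
  -- vanishes at zero.
  have hderiv : ∀ r : ℝ, HasDerivAt (fun r : ℝ => r ^ d * φ (a + r • (y - a)))
      (d * r ^ (d - 1) * φ (a + r • (y - a)) +
        r ^ d * fderiv ℝ φ (a + r • (y - a)) (y - a)) r := by
    intro r
    have h1 : HasDerivAt (fun r : ℝ => a + r • (y - a)) (y - a) r := by
      simpa using ((hasDerivAt_id r).smul_const (y - a)).const_add a
    have h2 := ((hφ.differentiable one_ne_zero) (a + r • (y - a))).hasFDerivAt.comp_hasDerivAt r h1
    exact (hasDerivAt_pow d r).mul h2
  have hcont : Continuous fun r : ℝ => d * r ^ (d - 1) * φ (a + r • (y - a)) +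
        r ^ d * fderiv ℝ φ (a + r • (y - a)) (y - a) := by
    have := hφ.continuous
    have := hφ.continuous_fderiv one_ne_zero
    fun_prop
  have hftc := intervalIntegral.integral_eq_sub_of_hasDerivAt (a := 0) (b := 1)
    (fun r _ => hderiv r) (hcont.intervalIntegrable _ _)
  rw [intervalIntegral.integral_of_le zero_le_one] at hftc
  have heq : ∀ r ∈ Ioc (0 : ℝ) 1,
      (ENNReal.ofReal (‖outwardVector s a‖ * r ^ (d - 1))).toReal •
        ((d * φ (a + r • (y - a)) + fderiv ℝ φ (a + r • (y - a)) (a + r • (y - a) - a)) *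
          g (centralProj s a (a + r • (y - a)))) =
      (‖outwardVector s a‖ * g y) * (d * r ^ (d - 1) * φ (a + r • (y - a)) +
        r ^ d * fderiv ℝ φ (a + r • (y - a)) (y - a)) := by
    intro r hr
    rw [hs.centralProj_cone hd ha hy hr.1.ne', ENNReal.toReal_ofReal
      (mul_nonneg (norm_nonneg _) (pow_nonneg hr.1.le _)), add_sub_cancel_left, map_smul,
      smul_eq_mul, smul_eq_mul]
    obtain ⟨m, rfl⟩ : ∃ m, d = m + 1 := ⟨d - 1, by omega⟩
    rw [Nat.add_sub_cancel, pow_succ]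
    ring
  refine (setIntegral_congr_fun measurableSet_Ioc heq).trans ?_
  rw [integral_const_mul, hftc]
  simp [hd.ne']
  ring

lemma integral_radial_one (hs : IsSimplex s) (hd : 0 < d) {a : Sp d} (ha : a ∈ s) {φ : Sp d → ℝ}
    (hφ : ContDiff ℝ 1 φ) :
    ∫ x in cell s, (d * φ x + fderiv ℝ φ x (x - a)) =
      ‖outwardVector s a‖ * ∫ y in cell (facet s a), φ y ∂(surf d) := by
  simpa using hs.integral_radial hd ha hφ (g := fun _ => 1) measurable_const (B := 1) (by simp)

/-- The divergence theorem on a simplex. -/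
lemma integral_fderiv (hs : IsSimplex s) (hd : 0 < d) {φ : Sp d → ℝ} (hφ : ContDiff ℝ 1 φ)
    (e : Sp d) :
    ∫ x in cell s, fderiv ℝ φ x e =
      ∑ a ∈ s, inner ℝ (outwardNormal s a) e * ∫ y in cell (facet s a), φ y ∂(surf d) := by
  -- The constant direction `e` is a combination of the radial fields `x - a` whose coefficients sum
  -- to zero, so the terms `d * φ x` cancel and the radial identities add up to the divergence
  -- theorem.
  have hpt : ∀ x, fderiv ℝ φ x e = ∑ a ∈ s, (inner ℝ (outwardVector s a) e /
      ‖outwardVector s a‖ ^ 2) * (d * φ x + fderiv ℝ φ x (x - a)) := by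
    intro x
    simp only [mul_add, Finset.sum_add_distrib, ← Finset.sum_mul]
    rw [hs.sum_inner_outwardVector hd e, zero_mul, zero_add]
    conv_lhs => rw [← hs.sum_inner_outwardVector_smul hd e x]
    simp only [map_sum, map_smul, smul_eq_mul]
  simp only [hpt]
  rw [integral_finsetSum]
  · refine Finset.sum_congr rfl fun a ha => ?_
    have h0 := hs.norm_outwardVector_pos hd ha
    rw [integral_const_mul, hs.integral_radial_one hd ha hφ, outwardNormal, inner_smul_left]
    simp only [conj_trivial]
    field_simp
  · intro a _
    have hc : Continuous fun x => (inner ℝ (outwardVector s a) e /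
      ‖outwardVector s a‖ ^ 2) * (d * φ x + fderiv ℝ φ x (x - a)) := by
      have := hφ.continuous
      have := hφ.continuous_fderiv one_ne_zero
      fun_prop
    exact hc.continuousOn.integrableOn_compact (isCompact_cell s)

end IsSimplex

/-! ### Trace inequality on a simplex. -/

lemma eLpNorm_two_sq {α F : Type*} [MeasurableSpace α] {μ : Measure α} [NormedAddCommGroup F]
    (f : α → F) : eLpNorm f 2 μ ^ 2 = ∫⁻ x, ‖f x‖ₑ ^ 2 ∂μ := by
  have := eLpNorm_nnreal_pow_eq_lintegral (f := f) (μ := μ) (p := 2) two_ne_zero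
  simpa using this

lemma lintegral_enorm_sq_eq {α F : Type*} [MeasurableSpace α] {μ : Measure α}
    [NormedAddCommGroup F] {f : α → F} (hf : Integrable (fun x => ‖f x‖ ^ 2) μ) :
    ∫⁻ x, ‖f x‖ₑ ^ 2 ∂μ = ENNReal.ofReal (∫ x, ‖f x‖ ^ 2 ∂μ) := by
  rw [ofReal_integral_eq_lintegral_ofReal hf (ae_of_all _ fun _ => sq_nonneg _)]
  refine lintegral_congr fun x => ?_
  rw [ENNReal.ofReal_pow (norm_nonneg _), ofReal_norm]

namespace IsSimplex

variable {s : Finset (Sp d)}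

/-- The radial identity for `‖φ‖ ^ 2` expresses the facet integral through `d ‖φ‖² + 2 φ · Dφ(x -
a)`, which Young's inequality bounds by the `H¹` density. -/
lemma lintegral_facet_le (hs : IsSimplex s) (hd : 0 < d) {a : Sp d} (ha : a ∈ s) :
    ∃ C : NNReal, ∀ φ : Sp d → Sp d, ContDiff ℝ 1 φ →
      ∫⁻ x in cell (facet s a), ‖φ x‖ₑ ^ 2 ∂(surf d) ≤
        C * ((∫⁻ x in cell s, ‖φ x‖ₑ ^ 2) + ∫⁻ x in cell s, ‖fderiv ℝ φ x‖ₑ ^ 2) := by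
  have hfin := hs.isFiniteMeasure_surf_facet hd ha
  obtain ⟨D, hD⟩ := ((isCompact_cell s).isBounded.subset_closedBall a)
  have hD0 : ∀ x ∈ cell s, ‖x - a‖ ≤ D := fun x hx => by simpa [dist_eq_norm] using hD hx
  have hDpos : 0 ≤ D := (norm_nonneg _).trans (hD0 a (subset_cell ha))
  set h := ‖outwardVector s a‖
  have hpos : 0 < h := hs.norm_outwardVector_pos hd ha
  -- Here `D` bounds the distance to `a` on the cell and `h` is the height of the simplex over the
  -- facet.
  refine ⟨((d + D) / h).toNNReal, fun φ hφ => ?_⟩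
  have hc := hφ.continuous
  have hc' := hφ.continuous_fderiv one_ne_zero
  have hK : ∀ f : Sp d → ℝ, Continuous f → IntegrableOn f (cell s) := fun f hf =>
    hf.continuousOn.integrableOn_compact (isCompact_cell s)
  have h1 : IntegrableOn (fun x => ‖φ x‖ ^ 2) (cell (facet s a)) (surf d) := by
    obtain ⟨B, hB⟩ := (isCompact_cell (facet s a)).exists_bound_of_continuousOn
      (f := fun x => ‖φ x‖ ^ 2) (by fun_prop)
    exact Integrable.of_bound (C := B) (by fun_prop)
      ((ae_restrict_mem (isClosed_cell _).measurableSet).mono hB)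
  rw [lintegral_enorm_sq_eq h1, lintegral_enorm_sq_eq (hK _ (by fun_prop)),
    lintegral_enorm_sq_eq (hK _ (by fun_prop)), ← ENNReal.ofReal_add
      (integral_nonneg fun _ => sq_nonneg _) (integral_nonneg fun _ => sq_nonneg _),
    ← ENNReal.ofReal_coe_nnreal, ← ENNReal.ofReal_mul (by simp)]
  refine ENNReal.ofReal_le_ofReal ?_
  have hrad := hs.integral_radial_one hd ha (φ := fun x => ‖φ x‖ ^ 2) (hφ.norm_sq ℝ)
  have hle : ∫ x in cell s, (d * ‖φ x‖ ^ 2 + fderiv ℝ (fun x => ‖φ x‖ ^ 2) x (x - a)) ≤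
      ∫ x in cell s, (d + D) * (‖φ x‖ ^ 2 + ‖fderiv ℝ φ x‖ ^ 2) := by
    refine setIntegral_mono_on ?_ (hK _ (by fun_prop)) (isClosed_cell s).measurableSet fun x hx => ?_
    · have := (hφ.norm_sq ℝ).continuous_fderiv one_ne_zero
      exact hK _ (by fun_prop)
    · have hd1 : fderiv ℝ (fun x => ‖φ x‖ ^ 2) x (x - a) =
          2 * inner ℝ (φ x) (fderiv ℝ φ x (x - a)) := by
        have := ((hφ.differentiable one_ne_zero) x).hasFDerivAt.norm_sq
        rw [this.fderiv]
        simp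
      have h2 : inner ℝ (φ x) (fderiv ℝ φ x (x - a)) ≤ ‖φ x‖ * (‖fderiv ℝ φ x‖ * D) :=
        (real_inner_le_norm _ _).trans (mul_le_mul_of_nonneg_left
          (((fderiv ℝ φ x).le_opNorm _).trans
            (mul_le_mul_of_nonneg_left (hD0 x hx) (norm_nonneg _))) (norm_nonneg _))
      rw [hd1]
      have h3 : 0 ≤ D * (‖φ x‖ - ‖fderiv ℝ φ x‖) ^ 2 := by positivity
      have h4 : (0 : ℝ) ≤ d * ‖fderiv ℝ φ x‖ ^ 2 := by positivity
      nlinarith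
  rw [hrad, integral_const_mul, integral_add (hK _ (by fun_prop)) (hK _ (by fun_prop))] at hle
  rw [Real.coe_toNNReal _ (by positivity)]
  rw [div_mul_eq_mul_div, le_div_iff₀ hpos, mul_comm]
  exact hle

/-- The trace inequality on a simplex for smooth fields. -/
lemma exists_eLpNorm_frontier_le (hs : IsSimplex s) (hd : 0 < d) :
    ∃ C : NNReal, ∀ φ : Sp d → Sp d, ContDiff ℝ 1 φ →
      eLpNorm φ 2 ((surf d).restrict (frontier (cell s))) ≤
        C * (eLpNorm φ 2 (volume.restrict (interior (cell s))) +
          eLpNorm (fderiv ℝ φ) 2 (volume.restrict (interior (cell s)))) := by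
  choose! C hC using fun a (ha : a ∈ s) => hs.lintegral_facet_le hd ha
  -- Adding one makes the sum of the squared-norm constants at most the square of the new constant,
  -- which avoids square roots.
  refine ⟨1 + ∑ a ∈ s, C a, fun φ hφ => ?_⟩
  rw [Measure.restrict_congr_set (μ := volume) (interior_ae_eq_of_null_frontier
    ((convex_cell s).addHaar_frontier volume))]
  rw [← ENNReal.pow_le_pow_left_iff two_ne_zero, eLpNorm_two_sq]
  have h1 : ∫⁻ x in frontier (cell s), ‖φ x‖ₑ ^ 2 ∂(surf d) ≤
      ∑ a ∈ s, ∫⁻ x in cell (facet s a), ‖φ x‖ₑ ^ 2 ∂(surf d) := by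
    rw [hs.frontier_cell hd]
    refine (lintegral_mono' (Measure.restrict_biUnion_le s.countable_toSet) le_rfl).trans ?_
    rw [lintegral_sum_measure, tsum_fintype]
    exact (Finset.sum_coe_sort s
      (fun a => ∫⁻ x in cell (facet s a), ‖φ x‖ₑ ^ 2 ∂(surf d))).le
  refine h1.trans ((Finset.sum_le_sum fun a ha => hC a ha φ hφ).trans ?_)
  rw [← Finset.sum_mul, ← eLpNorm_two_sq, ← eLpNorm_two_sq, mul_pow]
  refine mul_le_mul' ?_ ?_
  · rw [← ENNReal.ofNNReal_finsetSum, ← ENNReal.coe_pow, ENNReal.coe_le_coe]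
    set S := ∑ a ∈ s, C a
    have hS : 0 ≤ S := zero_le
    nlinarith [mul_nonneg hS hS]
  · rw [add_sq]
    exact add_le_add le_self_add le_rfl

end IsSimplex

end NavierStokesFEM

namespace NavierStokesFEM

variable {d : ℕ}

/-! ### Smooth approximation in `H¹` of a bounded convex open set -/

open scoped Convolution
open ContinuousLinearMap (lsmul)

section Mollify

variable {F : Type*} [NormedAddCommGroup F] [NormedSpace ℝ F]

/-- Mollification followed by a contraction towards `c`. -/
noncomputable def contractMollify (c : Sp d) (l : ℝ) (ρ : ContDiffBump (0 : Sp d)) (f : Sp d → F)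
    (x : Sp d) : F :=
  (ρ.normed volume ⋆[lsmul ℝ ℝ, volume] f) (c + l • (x - c))

/-- The normalised bump is a probability density, so this is Jensen's inequality in the form that
the `L¹` norm is at most the `L²` norm. -/
lemma enorm_convolution_sq_le (ρ : ContDiffBump (0 : Sp d)) {f : Sp d → F}
    (hf : StronglyMeasurable f) (z : Sp d) :
    ‖(ρ.normed volume ⋆[lsmul ℝ ℝ, volume] f) z‖ₑ ^ 2 ≤
      ∫⁻ t, ENNReal.ofReal (ρ.normed volume t) * ‖f (z - t)‖ₑ ^ 2 := by
  set w : Sp d → ENNReal := fun t => ENNReal.ofReal (ρ.normed volume t)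
  have hw : Measurable w := by
    have := (ρ.contDiff_normed (μ := volume) (n := 0)).continuous
    fun_prop
  set m := (volume : Measure (Sp d)).withDensity w
  have hprob : IsProbabilityMeasure m := by
    refine ⟨?_⟩
    rw [withDensity_apply _ MeasurableSet.univ, Measure.restrict_univ,
      ← ofReal_integral_eq_lintegral_ofReal ρ.integrable_normed (ae_of_all _ ρ.nonneg_normed),
      ρ.integral_normed, ENNReal.ofReal_one]
  have hfz : StronglyMeasurable fun t => f (z - t) := hf.comp_measurable (by fun_prop)
  have h1 : ‖(ρ.normed volume ⋆[lsmul ℝ ℝ, volume] f) z‖ₑ ≤ eLpNorm (fun t => f (z - t)) 2 m := by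
    refine le_trans ?_ (eLpNorm_le_eLpNorm_of_exponent_le (p := 1) one_le_two
      hfz.aestronglyMeasurable)
    rw [eLpNorm_one_eq_lintegral_enorm, lintegral_withDensity_eq_lintegral_mul _ hw hfz.enorm]
    refine (enorm_integral_le_lintegral_enorm _).trans (lintegral_mono fun t => ?_)
    simp only [ContinuousLinearMap.lsmul_apply, enorm_smul, Pi.mul_apply, w]
    rw [Real.enorm_of_nonneg (ρ.nonneg_normed _)]
  calc _ ≤ eLpNorm (fun t => f (z - t)) 2 m ^ 2 := by gcongr
    _ = _ := by
      rw [eLpNorm_two_sq, lintegral_withDensity_eq_lintegral_mul _ hw (hfz.enorm.pow_const 2)]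
      rfl

lemma lintegral_comp_affine {g : Sp d → ENNReal} (hg : Measurable g) {l : ℝ} (hl : l ≠ 0)
    (b : Sp d) :
    ∫⁻ x, g (l • x + b) = ENNReal.ofReal |(l ^ d)⁻¹| * ∫⁻ x, g x := by
  have h1 := lintegral_map (μ := (volume : Measure (Sp d))) (f := fun x => g (x + b))
    (g := fun x => l • x) (by fun_prop) (by fun_prop)
  rw [← h1, Measure.map_addHaar_smul _ hl, lintegral_smul_measure, lintegral_add_right_eq_self,
    finrank_euclideanSpace, Fintype.card_fin, smul_eq_mul]

/-- Mollification is bounded on `L²` by Jensen and Tonelli, and contraction multiplies the squared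
norm by `l⁻ᵈ ≤ 2ᵈ`. The resulting bound is uniform in the mollifier, as a density argument requires.
-/
lemma eLpNorm_contractMollify_le (c : Sp d) {l : ℝ} (hl : 1 / 2 ≤ l)
    (ρ : ContDiffBump (0 : Sp d)) {f : Sp d → F} (hf : AEStronglyMeasurable f volume) :
    eLpNorm (contractMollify c l ρ f) 2 volume ≤ 2 ^ d * eLpNorm f 2 volume := by
  have hl0 : 0 < l := by linarith
  wlog hfm : StronglyMeasurable f generalizing f
  · have h1 := this hf.stronglyMeasurable_mk.aestronglyMeasurable hf.stronglyMeasurable_mk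
    rw [← eLpNorm_congr_ae hf.ae_eq_mk] at h1
    have h2 : contractMollify c l ρ f = contractMollify c l ρ (hf.mk f) := by
      funext x
      unfold contractMollify
      rw [convolution_congr _ (ae_eq_refl _) hf.ae_eq_mk]
    rwa [h2]
  have hρ := (ρ.contDiff_normed (μ := volume) (n := 0)).continuous
  have hfe : Measurable fun x => ‖f x‖ₑ ^ 2 := hfm.enorm.pow_const 2
  rw [← ENNReal.pow_le_pow_left_iff two_ne_zero, mul_pow, eLpNorm_two_sq, eLpNorm_two_sq]
  calc ∫⁻ x, ‖contractMollify c l ρ f x‖ₑ ^ 2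
      ≤ ∫⁻ x : Sp d, ∫⁻ t, ENNReal.ofReal (ρ.normed volume t) * ‖f (c + l • (x - c) - t)‖ₑ ^ 2 :=
        lintegral_mono fun x => enorm_convolution_sq_le ρ hfm _
    _ = ∫⁻ t, ∫⁻ x : Sp d, ENNReal.ofReal (ρ.normed volume t) * ‖f (c + l • (x - c) - t)‖ₑ ^ 2 := by
        refine lintegral_lintegral_swap (Measurable.aemeasurable ?_)
        refine Measurable.mul (by fun_prop) (hfe.comp ?_)
        fun_prop
    _ = ∫⁻ t, ENNReal.ofReal (ρ.normed volume t) *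
          (ENNReal.ofReal |(l ^ d)⁻¹| * ∫⁻ x, ‖f x‖ₑ ^ 2) := by
        refine lintegral_congr fun t => ?_
        rw [lintegral_const_mul' _ _ (by simp), ← lintegral_comp_affine hfe hl0.ne' (c - l • c - t)]
        congr 2
        funext x
        rw [show c + l • (x - c) - t = l • x + (c - l • c - t) by module]
    _ = ENNReal.ofReal |(l ^ d)⁻¹| * ∫⁻ x, ‖f x‖ₑ ^ 2 := by
        rw [lintegral_mul_const _ (by fun_prop), ← ofReal_integral_eq_lintegral_ofReal
          ρ.integrable_normed (ae_of_all _ ρ.nonneg_normed), ρ.integral_normed,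
          ENNReal.ofReal_one, one_mul]
    _ ≤ _ := by
        gcongr
        have h2 : |(l ^ d)⁻¹| ≤ 2 ^ d := by
          rw [abs_of_pos (by positivity), ← inv_pow]
          gcongr
          rw [inv_le_comm₀ hl0 two_pos]
          linarith
        have h3 : ENNReal.ofReal |(l ^ d)⁻¹| ≤ 2 ^ d := by
          refine (ENNReal.ofReal_le_ofReal h2).trans ?_
          rw [ENNReal.ofReal_pow zero_le_two]
          simp
        refine h3.trans (le_self_pow₀ (one_le_pow₀ one_le_two) two_ne_zero)

lemma contractMollify_sub (c : Sp d) (l : ℝ) (ρ : ContDiffBump (0 : Sp d)) {f g : Sp d → F}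
    (hf : LocallyIntegrable f volume) (hg : LocallyIntegrable g volume) :
    contractMollify c l ρ (f - g) = contractMollify c l ρ f - contractMollify c l ρ g := by
  have hρ := (ρ.contDiff_normed (μ := volume) (n := 0)).continuous
  funext x
  simp only [contractMollify, Pi.sub_apply, convolution]
  rw [← integral_sub]
  · simp [smul_sub]
  · exact ρ.hasCompactSupport_normed.convolutionExists_left _ hρ hf _
  · exact ρ.hasCompactSupport_normed.convolutionExists_left _ hρ hg _

lemma contDiff_contractMollify [CompleteSpace F] (c : Sp d) (l : ℝ) (ρ : ContDiffBump (0 : Sp d))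
    {f : Sp d → F} (hf : LocallyIntegrable f volume) : ContDiff ℝ ∞ (contractMollify c l ρ f) := by
  have h1 : ContDiff ℝ ∞ (ρ.normed volume ⋆[lsmul ℝ ℝ, volume] f) :=
    ρ.hasCompactSupport_normed.contDiff_convolution_left _ ρ.contDiff_normed hf
  exact h1.comp (by fun_prop)

/-- Continuous functions with compact support are dense in `L²` and the operators are uniformly
bounded, so it suffices to treat a uniformly continuous function on a set of finite measure. -/
lemma tendsto_contractMollify [CompleteSpace F] (c : Sp d) {l : ℕ → ℝ} (hl : ∀ k, 1 / 2 ≤ l k)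
    (hl1 : Tendsto l atTop (𝓝 1)) {ρ : ℕ → ContDiffBump (0 : Sp d)}
    (hρ : Tendsto (fun k => (ρ k).rOut) atTop (𝓝 0)) {O : Set (Sp d)} (hOm : MeasurableSet O)
    (hO : Bornology.IsBounded O)
    {f : Sp d → F} (hf : MemLp f 2 volume) :
    Tendsto (fun k => eLpNorm (contractMollify c (l k) (ρ k) f - f) 2 (volume.restrict O)) atTop
      (𝓝 0) := by
  rw [ENNReal.tendsto_nhds_zero]
  intro ε hε
  have hOfin : volume O < ⊤ := hO.measure_lt_top
  have hOne : volume O ^ (1 / (2 : ℝ)) ≠ ⊤ := by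
    exact ENNReal.rpow_ne_top_of_nonneg (by norm_num) hOfin.ne
  -- The three summands bound the operator applied to `f - g`, the error `contractMollify g - g` on
  -- `O`, and `g - f`. In the middle one, mollification and contraction each move the value of `g`
  -- by at most `δ`.
  obtain ⟨δ, hδ0, hδ⟩ : ∃ δ : NNReal, 0 < δ ∧
      2 ^ d * (δ : ENNReal) + (volume O ^ (1 / (2 : ℝ)) * (δ + δ) + δ) ≤ ε := by
    have ht : Tendsto (fun δ : NNReal => 2 ^ d * (δ : ENNReal) +
        (volume O ^ (1 / (2 : ℝ)) * (δ + δ) + δ)) (𝓝[>] 0) (𝓝 0) := by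
      have h0 : Tendsto (fun δ : NNReal => (δ : ENNReal)) (𝓝[>] 0) (𝓝 0) := by
        have := (ENNReal.continuous_coe.tendsto (0 : NNReal)).mono_left
          (nhdsWithin_le_nhds (s := Ioi 0))
        simpa using this
      have h1 := ENNReal.Tendsto.const_mul (a := (2 : ENNReal) ^ d) h0 (Or.inr (by simp))
      have h2 := ENNReal.Tendsto.const_mul (a := volume O ^ (1 / (2 : ℝ))) (h0.add h0)
        (Or.inr hOne)
      simpa using h1.add (h2.add h0)
    have h2 := (ht.eventually_lt_const hε).and (eventually_mem_nhdsWithin)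
    obtain ⟨δ, h3, h4⟩ := h2.exists
    exact ⟨δ, h4, h3.le⟩
  obtain ⟨g, hgs, hgle, hgc, hgL⟩ := hf.exists_hasCompactSupport_eLpNorm_sub_le
    ENNReal.ofNat_ne_top (ε := δ) (by exact_mod_cast hδ0.ne')
  obtain ⟨η, hη0, hη⟩ := Metric.uniformContinuous_iff.1
    (hgs.uniformContinuous_of_continuous hgc) δ hδ0
  obtain ⟨D, hD⟩ := hO.subset_closedBall c
  have hev1 : ∀ᶠ k in atTop, (ρ k).rOut < η := hρ.eventually_lt_const hη0
  have hev2 : ∀ᶠ k in atTop, |l k - 1| * (|D| + 1) < η := by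
    have : Tendsto (fun k => |l k - 1| * (|D| + 1)) atTop (𝓝 (|1 - 1| * (|D| + 1))) :=
      ((hl1.sub_const 1).abs).mul_const _
    rw [sub_self, abs_zero, zero_mul] at this
    exact this.eventually_lt_const hη0
  filter_upwards [hev1, hev2] with k hk1 hk2
  have hfl := hf.locallyIntegrable one_le_two
  have hgl := hgL.locallyIntegrable one_le_two
  have hsplit : contractMollify c (l k) (ρ k) f - f = contractMollify c (l k) (ρ k) (f - g) +
      ((contractMollify c (l k) (ρ k) g - g) + (g - f)) := by
    rw [contractMollify_sub _ _ _ hfl hgl]; abel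
  have hm1 : AEStronglyMeasurable (contractMollify c (l k) (ρ k) (f - g)) (volume.restrict O) :=
    (contDiff_contractMollify c (l k) (ρ k) (hfl.sub hgl)).continuous.aestronglyMeasurable
  have hm2 : AEStronglyMeasurable (contractMollify c (l k) (ρ k) g - g) (volume.restrict O) :=
    ((contDiff_contractMollify c (l k) (ρ k) hgl).continuous.sub hgc).aestronglyMeasurable
  have hm3 : AEStronglyMeasurable (g - f) (volume.restrict O) :=
    (hgL.sub hf).aestronglyMeasurable.restrict
  rw [hsplit]
  refine (eLpNorm_add_le hm1 (hm2.add hm3) one_le_two).trans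
    ((add_le_add le_rfl (eLpNorm_add_le hm2 hm3 one_le_two)).trans (le_trans ?_ hδ))
  refine add_le_add ?_ (add_le_add ?_ ?_)
  · refine (eLpNorm_mono_measure _ Measure.restrict_le_self).trans
      ((eLpNorm_contractMollify_le c (hl k) (ρ k) (hf.sub hgL).aestronglyMeasurable).trans ?_)
    gcongr
  · have hb : ∀ᵐ x ∂(volume.restrict O),
        ‖(contractMollify c (l k) (ρ k) g - g) x‖ ≤ ((δ + δ : NNReal) : ℝ) := by
      filter_upwards [ae_restrict_mem hOm] with x hx
      have h1 : dist (contractMollify c (l k) (ρ k) g x) (g (c + l k • (x - c))) ≤ δ :=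
        (ρ k).dist_normed_convolution_le hgc.aestronglyMeasurable fun z hz =>
          (hη (lt_trans (Metric.mem_ball.1 hz) hk1)).le
      have h2 : dist (g (c + l k • (x - c))) (g x) ≤ δ := by
        refine (hη (lt_of_le_of_lt ?_ hk2)).le
        rw [dist_eq_norm, show c + l k • (x - c) - x = (l k - 1) • (x - c) by module, norm_smul,
          Real.norm_eq_abs]
        gcongr
        have := hD hx
        rw [Metric.mem_closedBall, dist_eq_norm] at this
        linarith [le_abs_self D]
      rw [Pi.sub_apply, ← dist_eq_norm]
      push_cast
      exact (dist_triangle _ _ _).trans (add_le_add h1 h2)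
    refine (eLpNorm_le_of_ae_bound hb).trans ?_
    rw [Measure.restrict_apply_univ, ENNReal.ofReal_coe_nnreal]
    simp
  · refine (eLpNorm_mono_measure _ Measure.restrict_le_self).trans ?_
    rwa [← eLpNorm_neg, neg_sub]

lemma eLpNorm_smul_add_smul_le {μ : Measure (Sp d)} {f g : Sp d → F}
    (hf : AEStronglyMeasurable f μ) (hg : AEStronglyMeasurable g μ) {l : ℝ} (hl : |l| ≤ 1) (m : ℝ) :
    eLpNorm (l • f + m • g) 2 μ ≤ eLpNorm f 2 μ + ENNReal.ofReal |m| * eLpNorm g 2 μ := by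
  refine (eLpNorm_add_le (hf.const_smul _) (hg.const_smul _) one_le_two).trans (add_le_add ?_ ?_)
  · rw [eLpNorm_const_smul, Real.enorm_eq_ofReal_abs]
    refine mul_le_of_le_one_left' ?_
    rw [← ENNReal.ofReal_one]
    exact ENNReal.ofReal_le_ofReal hl
  · rw [eLpNorm_const_smul, Real.enorm_eq_ofReal_abs]

end Mollify

lemma memLp_indicator_of_restrict {F : Type*} [NormedAddCommGroup F] {O : Set (Sp d)} (hO : MeasurableSet O) {f : Sp d → F}
    (hf : MemLp f 2 (volume.restrict O)) : MemLp (O.indicator f) 2 volume :=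
  (memLp_indicator_iff_restrict hO).2 hf


/-- As the ball around the contracted point stays inside `O`, the translated mollifier is an
admissible test function. The derivative falls on the kernel and is moved to `v` by the weak
identity; the chain rule for the contraction gives the factor `l`. -/
lemma fderiv_contractMollify {O : Set (Sp d)} (hO : IsOpen O) {v : Sp d → Sp d}
    {G : Sp d → (Sp d →L[ℝ] Sp d)} (hvG : HasWeakDerivL2 O v G) (c : Sp d) (l : ℝ)
    (ρ : ContDiffBump (0 : Sp d)) {x : Sp d}
    (hx : Metric.closedBall (c + l • (x - c)) ρ.rOut ⊆ O) :
    fderiv ℝ (contractMollify c l ρ (O.indicator v)) x =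
      l • contractMollify c l ρ (O.indicator G) x := by
  obtain ⟨hv, hG, hw⟩ := hvG
  have hvl : LocallyIntegrable (O.indicator v) volume :=
    (memLp_indicator_of_restrict hO.measurableSet hv).locallyIntegrable one_le_two
  have hGl : LocallyIntegrable (O.indicator G) volume :=
    (memLp_indicator_of_restrict hO.measurableSet hG).locallyIntegrable one_le_two
  set z := c + l • (x - c) with hz
  have hρ : ContDiff ℝ ∞ (ρ.normed volume) := ρ.contDiff_normed
  have hρ1 : ContDiff ℝ 1 (ρ.normed volume) := ρ.contDiff_normed
  have hS : HasFDerivAt (fun x : Sp d => c + l • (x - c)) (l • ContinuousLinearMap.id ℝ (Sp d)) x := by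
    exact (((hasFDerivAt_id (𝕜 := ℝ) x).sub_const c).const_smul l).const_add c
  have hconv := ρ.hasCompactSupport_normed.hasFDerivAt_convolution_left
    (lsmul ℝ ℝ : ℝ →L[ℝ] Sp d →L[ℝ] Sp d) hρ1 hvl z
  have hcomp := HasFDerivAt.comp x hconv hS
  have h1 : fderiv ℝ (contractMollify c l ρ (O.indicator v)) x = _ := hcomp.fderiv
  rw [h1]
  ext1 e
  rw [ContinuousLinearMap.comp_apply, _root_.smul_apply, ContinuousLinearMap.id_apply,
    map_smul, _root_.smul_apply]
  congr 1
  have hex := (ρ.hasCompactSupport_normed (μ := volume)).fderiv (𝕜 := ℝ) |>.convolutionExists_left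
    ((lsmul ℝ ℝ : ℝ →L[ℝ] Sp d →L[ℝ] Sp d).precompL (Sp d)) (hρ1.continuous_fderiv one_ne_zero) hvl z
  have hex' := (ρ.hasCompactSupport_normed (μ := volume)).convolutionExists_left
    (lsmul ℝ ℝ) hρ1.continuous hGl z
  have h2 : (fderiv ℝ (ρ.normed volume) ⋆[(lsmul ℝ ℝ : ℝ →L[ℝ] Sp d →L[ℝ] Sp d).precompL (Sp d),
      volume] O.indicator v) z e = ∫ t, (fderiv ℝ (ρ.normed volume) (z - t) e) • O.indicator v t := by
    rw [convolution, ContinuousLinearMap.integral_apply hex]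
    rw [← integral_sub_left_eq_self _ volume z]
    simp
  have h3 : contractMollify c l ρ (O.indicator G) x e =
      ∫ t, ρ.normed volume (z - t) • O.indicator G t e := by
    rw [contractMollify, convolution, ContinuousLinearMap.integral_apply hex']
    rw [← integral_sub_left_eq_self _ volume z]
    simp [hz]
  rw [h2, h3]
  have hη : ContDiff ℝ ∞ fun t => ρ.normed volume (z - t) := hρ.comp (by fun_prop)
  have hfd : ∀ t, fderiv ℝ (fun t => ρ.normed volume (z - t)) t e
      = - fderiv ℝ (ρ.normed volume) (z - t) e := by
    intro t
    have h4 : HasFDerivAt (fun t : Sp d => z - t) (-ContinuousLinearMap.id ℝ (Sp d)) t :=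
      (hasFDerivAt_id t).const_sub z
    have h5 := HasFDerivAt.comp t ((hρ1.differentiable one_ne_zero) (z - t)).hasFDerivAt h4
    have h6 : fderiv ℝ (fun t => ρ.normed volume (z - t)) t = _ := h5.fderiv
    rw [h6]
    simp
  have hsupp : tsupport (fun t => ρ.normed volume (z - t)) ⊆ Metric.closedBall z ρ.rOut := by
    refine closure_minimal (fun t ht => ?_) Metric.isClosed_closedBall
    have h7 : z - t ∈ Function.support (ρ.normed volume) := ht
    rw [ρ.support_normed_eq, Metric.mem_ball, dist_zero_right] at h7
    rw [Metric.mem_closedBall, dist_comm, dist_eq_norm]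
    exact h7.le
  have hcs : HasCompactSupport fun t => ρ.normed volume (z - t) :=
    (isCompact_closedBall z ρ.rOut).of_isClosed_subset (isClosed_tsupport _) hsupp
  have h8 := hw _ hη hcs (hsupp.trans hx) e
  simp only [hfd, neg_smul, integral_neg, neg_inj] at h8
  rw [← integral_indicator hO.measurableSet, ← integral_indicator hO.measurableSet] at h8
  refine (integral_congr_ae (ae_of_all _ fun t => ?_)).trans
    (h8.trans (integral_congr_ae (ae_of_all _ fun t => ?_)))
  · by_cases ht : t ∈ O <;> simp [ht]
  · by_cases ht : t ∈ O <;> simp [ht]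

/-- Meyers–Serrin on bounded convex open sets, with approximations smooth up to the boundary. -/
lemma exists_smooth_approx {O : Set (Sp d)} (hO : IsOpen O) (hconv : Convex ℝ O)
    (hne : O.Nonempty) (hb : Bornology.IsBounded O) {v : Sp d → Sp d}
    {G : Sp d → (Sp d →L[ℝ] Sp d)} (hvG : HasWeakDerivL2 O v G) :
    ∃ φ : ℕ → Sp d → Sp d, (∀ k, ContDiff ℝ ∞ (φ k)) ∧
      Tendsto (fun k => eLpNorm (fun x => φ k x - v x) 2 (volume.restrict O)) atTop (𝓝 0) ∧
      Tendsto (fun k => eLpNorm (fun x => fderiv ℝ (φ k) x - G x) 2 (volume.restrict O))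
        atTop (𝓝 0) := by
  obtain ⟨c, hc⟩ := hne
  obtain ⟨r, hr0, hr⟩ := Metric.isOpen_iff.1 hO c hc
  have hvI : MemLp (O.indicator v) 2 volume :=
    memLp_indicator_of_restrict hO.measurableSet hvG.1
  have hGI : MemLp (O.indicator G) 2 volume :=
    memLp_indicator_of_restrict hO.measurableSet hvG.2.1
  -- The contraction ratio is `1 - 1/(k+2)`, which is at least one half. It leaves room for balls of
  -- radius below `r/(k+2)`, where `r` is the radius of a ball around `c` inside `O`.
  set l : ℕ → ℝ := fun k => 1 - 1 / (k + 2)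
  have hlpos : ∀ k : ℕ, (0 : ℝ) < 1 / (k + 2) := fun k => by positivity
  have hl : ∀ k, 1 / 2 ≤ l k := by
    intro k
    have : (1 : ℝ) / (k + 2) ≤ 1 / 2 := by gcongr; linarith [(k.cast_nonneg : (0 : ℝ) ≤ k)]
    simp only [l]; linarith
  have hl0 : Tendsto (fun k : ℕ => (1 : ℝ) / (k + 2)) atTop (𝓝 0) := by
    have := tendsto_const_div_atTop_nhds_zero_nat (1 : ℝ)
    have := this.comp (tendsto_add_atTop_nat 2)
    refine this.congr fun k => ?_
    simp
  have hl1 : Tendsto l atTop (𝓝 1) := by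
    simpa [l] using hl0.const_sub 1
  let ρ : ℕ → ContDiffBump (0 : Sp d) := fun k =>
    ⟨1 / (k + 2) * r / 4, 1 / (k + 2) * r / 2, by have := hlpos k; positivity, by
      have := mul_pos (hlpos k) hr0; linarith⟩
  have hρ : Tendsto (fun k => (ρ k).rOut) atTop (𝓝 0) := by
    have := (hl0.mul_const r).div_const 2
    simpa [ρ] using this
  -- A point of the small ball is the convex combination, with weights `l k` and `1/(k+2)`, of `x`
  -- and a point of the ball of radius `r` around `c`.
  have hball : ∀ k, ∀ x ∈ O, Metric.closedBall (c + l k • (x - c)) (ρ k).rOut ⊆ O := by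
    intro k x hx w hw
    have hp := hlpos k
    have h1 : c + (1 / ((k : ℝ) + 2))⁻¹ • (w - (c + l k • (x - c))) ∈ O := by
      refine hr ?_
      rw [Metric.mem_ball, dist_eq_norm, add_sub_cancel_left, norm_smul, norm_inv, Real.norm_eq_abs,
        abs_of_pos hp, inv_mul_lt_iff₀ hp]
      rw [Metric.mem_closedBall, dist_eq_norm] at hw
      have : (ρ k).rOut = 1 / (k + 2) * r / 2 := rfl
      have := mul_pos hp hr0
      linarith
    have h2 := hconv hx h1 (a := l k) (b := 1 / (k + 2)) (by have := hl k; linarith) hp.le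
      (by simp only [l]; ring)
    convert h2 using 1
    rw [smul_add, smul_smul, mul_inv_cancel₀ hp.ne', one_smul, show (1 / ((k : ℝ) + 2)) = 1 - l k by
      simp only [l]; ring]
    module
  refine ⟨fun k => contractMollify c (l k) (ρ k) (O.indicator v), fun k =>
    contDiff_contractMollify _ _ _ (hvI.locallyIntegrable one_le_two), ?_, ?_⟩
  · refine (tendsto_contractMollify c hl hl1 hρ hO.measurableSet hb hvI).congr fun k =>
      eLpNorm_congr_ae ?_
    filter_upwards [ae_restrict_mem hO.measurableSet] with x hx
    simp [hx]
  · have h1 := tendsto_contractMollify c hl hl1 hρ hO.measurableSet hb hGI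
    have h2 : Tendsto (fun k : ℕ => ENNReal.ofReal (1 / ((k : ℝ) + 2)) *
        eLpNorm (O.indicator G) 2 (volume.restrict O)) atTop (𝓝 0) := by
      have := ENNReal.Tendsto.mul_const (b := eLpNorm (O.indicator G) 2 (volume.restrict O))
        (ENNReal.tendsto_ofReal hl0)
        (Or.inr (hGI.restrict O).eLpNorm_ne_top)
      simpa using this
    refine tendsto_of_tendsto_of_tendsto_of_le_of_le tendsto_const_nhds
      (by simpa only [add_zero] using h1.add h2) (fun _ => zero_le) fun k => ?_
    have hm1 : AEStronglyMeasurable (contractMollify c (l k) (ρ k) (O.indicator G) - O.indicator G)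
        (volume.restrict O) :=
      (contDiff_contractMollify _ _ _ (hGI.locallyIntegrable one_le_two)).continuous.aestronglyMeasurable.sub
        hGI.aestronglyMeasurable.restrict
    have hlk : |l k| ≤ 1 := by
      have h3 := hl k
      have h4 := hlpos k
      rw [abs_of_nonneg (by linarith)]
      simp only [l]; linarith
    -- The factor `l` from the chain rule costs an additional error of `(1 - l)` times the norm of
    -- `G`.
    calc eLpNorm (fun x => fderiv ℝ (contractMollify c (l k) (ρ k) (O.indicator v)) x - G x) 2
          (volume.restrict O)
        = eLpNorm (l k • (contractMollify c (l k) (ρ k) (O.indicator G) - O.indicator G) +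
            (-(1 / ((k : ℝ) + 2))) • O.indicator G) 2 (volume.restrict O) := by
          refine eLpNorm_congr_ae ?_
          filter_upwards [ae_restrict_mem hO.measurableSet] with x hx
          rw [fderiv_contractMollify hO hvG c (l k) (ρ k) (hball k x hx)]
          simp only [Pi.add_apply, Pi.smul_apply, Pi.sub_apply, hx, indicator_of_mem,
            show (-(1 / ((k : ℝ) + 2))) = l k - 1 by simp only [l]; ring]
          module
      _ ≤ _ := by
          have h5 := eLpNorm_smul_add_smul_le hm1 hGI.aestronglyMeasurable.restrict hlk
            (-(1 / ((k : ℝ) + 2)))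
          rwa [abs_neg, abs_of_pos (hlpos k)] at h5

end NavierStokesFEM

namespace NavierStokesFEM

variable {d : ℕ}

/-! ### Weak derivatives -/

/-- This is the fundamental lemma of the calculus of variations in each coordinate direction. It is
needed because `weakDeriv` is an arbitrary choice among weak derivatives. -/
lemma HasWeakDerivL2.ae_eq {O : Set (Sp d)} (hO : IsOpen O) {v : Sp d → Sp d}
    {G G' : Sp d → (Sp d →L[ℝ] Sp d)} (h : HasWeakDerivL2 O v G) (h' : HasWeakDerivL2 O v G') :
    G =ᵐ[volume.restrict O] G' := by
  have hpt : ∀ e : Sp d, ∀ᵐ x ∂(volume.restrict O), G x e = G' x e := by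
    intro e
    have hloc : ∀ {G : Sp d → (Sp d →L[ℝ] Sp d)}, MemLp G 2 (volume.restrict O) →
        MemLp (fun x => G x e) 2 (volume.restrict O) := fun hG =>
      (ContinuousLinearMap.apply ℝ (Sp d) e).comp_memLp' hG
    have hl1 : LocallyIntegrable (fun x => G x e) (volume.restrict O) :=
      (hloc h.2.1).locallyIntegrable one_le_two
    have hl2 : LocallyIntegrable (fun x => G' x e) (volume.restrict O) :=
      (hloc h'.2.1).locallyIntegrable one_le_two
    have h1 : LocallyIntegrableOn (fun x => G x e - G' x e) O (volume.restrict O) :=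
      (hl1.sub hl2).locallyIntegrableOn O
    have h2 := hO.ae_eq_zero_of_integral_contDiff_smul_eq_zero h1 fun φ hφ hc hs => by
      have hint : ∀ {f : Sp d → Sp d}, LocallyIntegrable f (volume.restrict O) →
          Integrable (fun x => φ x • f x) (volume.restrict O) := fun hf =>
        hf.integrable_smul_left_of_hasCompactSupport hφ.continuous hc
      simp only [smul_sub]
      rw [integral_sub (hint hl1) (hint hl2), sub_eq_zero]
      exact neg_injective ((h.2.2 φ hφ hc hs e).symm.trans (h'.2.2 φ hφ hc hs e))
    filter_upwards [h2, ae_restrict_mem hO.measurableSet] with x hx hxO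
    exact sub_eq_zero.1 (hx hxO)
  have hall : ∀ᵐ x ∂(volume.restrict O), ∀ i, G x (EuclideanSpace.single i 1) =
      G' x (EuclideanSpace.single i 1) := ae_all_iff.2 fun i => hpt _
  filter_upwards [hall] with x hx
  refine ContinuousLinearMap.coe_injective
    ((EuclideanSpace.basisFun (Fin d) ℝ).toBasis.ext fun i => ?_)
  simpa using hx i

lemma hasWeakDerivL2_weakDeriv {O : Set (Sp d)} {v : Sp d → Sp d} (h : IsH1 O v) :
    HasWeakDerivL2 O v (weakDeriv O v) := by
  rw [weakDeriv, dif_pos h]; exact h.choose_spec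

lemma HasWeakDerivL2.weakDeriv_ae_eq {O : Set (Sp d)} (hO : IsOpen O) {v : Sp d → Sp d}
    {G : Sp d → (Sp d →L[ℝ] Sp d)} (h : HasWeakDerivL2 O v G) :
    weakDeriv O v =ᵐ[volume.restrict O] G :=
  (hasWeakDerivL2_weakDeriv ⟨G, h⟩).ae_eq hO h

lemma HasWeakDerivL2.mono {O O' : Set (Sp d)} (hO : MeasurableSet O)
    (hs : O' ⊆ O) {v : Sp d → Sp d}
    {G : Sp d → (Sp d →L[ℝ] Sp d)} (h : HasWeakDerivL2 O v G) : HasWeakDerivL2 O' v G := by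
  refine ⟨h.1.mono_measure (Measure.restrict_mono hs le_rfl),
    h.2.1.mono_measure (Measure.restrict_mono hs le_rfl), fun φ hφ hc hsupp e => ?_⟩
  have h1 := h.2.2 φ hφ hc (hsupp.trans hs) e
  have hz : ∀ x, x ∉ O' → φ x = 0 := fun x hx => image_eq_zero_of_notMem_tsupport fun h' =>
    hx (hsupp h')
  have hz' : ∀ x, x ∉ O' → fderiv ℝ φ x = 0 := fun x hx => by
    by_contra hne
    exact hx (hsupp (support_fderiv_subset ℝ hne))
  rw [setIntegral_eq_of_subset_of_forall_sdiff_eq_zero hO hs (fun x hx => by simp [hz' x hx.2]),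
    setIntegral_eq_of_subset_of_forall_sdiff_eq_zero hO hs (fun x hx => by simp [hz x hx.2])] at h1
  exact h1

lemma HasWeakDerivL2.sub {O : Set (Sp d)} {v v' : Sp d → Sp d}
    {G G' : Sp d → (Sp d →L[ℝ] Sp d)} (h : HasWeakDerivL2 O v G) (h' : HasWeakDerivL2 O v' G') :
    HasWeakDerivL2 O (v - v') (G - G') := by
  refine ⟨h.1.sub h'.1, h.2.1.sub h'.2.1, fun φ hφ hc hsupp e => ?_⟩
  have hint : ∀ {f : Sp d → Sp d} {ψ : Sp d → ℝ}, Continuous ψ → HasCompactSupport ψ →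
      MemLp f 2 (volume.restrict O) → Integrable (fun x => ψ x • f x) (volume.restrict O) :=
    fun hψ hψc hf => (hf.locallyIntegrable one_le_two).integrable_smul_left_of_hasCompactSupport hψ hψc
  have hGe : ∀ {G : Sp d → (Sp d →L[ℝ] Sp d)}, MemLp G 2 (volume.restrict O) →
        MemLp (fun x => G x e) 2 (volume.restrict O) := fun hG =>
      (ContinuousLinearMap.apply ℝ (Sp d) e).comp_memLp' hG
  have hφ' : Continuous fun x => fderiv ℝ φ x e := by
    have := hφ.continuous_fderiv (by simp)
    fun_prop
  have hc' : HasCompactSupport fun x => fderiv ℝ φ x e := hc.fderiv_apply (𝕜 := ℝ) e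
  simp only [Pi.sub_apply, smul_sub, _root_.sub_apply]
  rw [integral_sub (hint hφ' hc' h.1) (hint hφ' hc' h'.1),
    integral_sub (hint hφ.continuous hc (hGe h.2.1)) (hint hφ.continuous hc (hGe h'.2.1)),
    h.2.2 φ hφ hc hsupp e, h'.2.2 φ hφ hc hsupp e]
  abel

/-! ### Traces -/

lemma restrict_interior_cell (s : Finset (Sp d)) :
    (volume : Measure (Sp d)).restrict (interior (cell s)) = volume.restrict (cell s) :=
  Measure.restrict_congr_set (interior_ae_eq_of_null_frontier
    ((convex_cell s).addHaar_frontier volume))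

instance (s : Finset (Sp d)) : IsFiniteMeasure ((volume : Measure (Sp d)).restrict (cell s)) :=
  ⟨by rw [Measure.restrict_apply_univ]; exact (isCompact_cell s).measure_lt_top⟩

/-- On a finite measure space `L²` convergence implies `L¹` convergence. Identities for smooth
fields pass to the limit in this form. -/
lemma tendsto_integral_of_le_L2 {α F : Type*} [MeasurableSpace α] {μ : Measure α}
    [IsFiniteMeasure μ] [NormedAddCommGroup F] {f : ℕ → α → F} {H : ℕ → α → ℝ} {H₀ : α → ℝ}
    (hH : ∀ k, Integrable (H k) μ) (h₀ : Integrable H₀ μ)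
    (hf : ∀ k, AEStronglyMeasurable (f k) μ) (B : ℝ)
    (hB : ∀ k, ∀ᵐ x ∂μ, ‖H k x - H₀ x‖ ≤ B * ‖f k x‖)
    (hlim : Tendsto (fun k => eLpNorm (f k) 2 μ) atTop (𝓝 0)) :
    Tendsto (fun k => ∫ x, H k x ∂μ) atTop (𝓝 (∫ x, H₀ x ∂μ)) := by
  refine tendsto_integral_of_L1' _ h₀.aestronglyMeasurable (Eventually.of_forall hH) ?_
  have h1 : Tendsto (fun k => ENNReal.ofReal B * (eLpNorm (f k) 2 μ * μ univ ^ (1 / (2 : ℝ))))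
      atTop (𝓝 0) := by
    have := ENNReal.Tendsto.const_mul (a := ENNReal.ofReal B)
      (ENNReal.Tendsto.mul_const (b := μ univ ^ (1 / (2 : ℝ))) hlim
        (Or.inr (ENNReal.rpow_ne_top_of_nonneg (by norm_num) (measure_ne_top _ _))))
      (Or.inr ENNReal.ofReal_ne_top)
    simpa using this
  refine tendsto_of_tendsto_of_tendsto_of_le_of_le tendsto_const_nhds h1 (fun _ => zero_le)
    fun k => ?_
  refine (eLpNorm_le_mul_eLpNorm_of_ae_le_mul (hB k) 1).trans ?_
  gcongr
  have := eLpNorm_le_eLpNorm_mul_rpow_measure_univ (p := 1) (q := 2) one_le_two (hf k)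
  refine this.trans (le_of_eq ?_)
  norm_num

/-- Uniqueness replaces the chosen `weakDeriv` by any given `G`, and the two volume errors are
merged into one sequence that can dominate integrands involving both field and gradient. -/
lemma IsTrace.exists_approx {s : Finset (Sp d)} (hs : IsSimplex s) (hd : 0 < d) {v γ : Sp d → Sp d}
    {G : Sp d → (Sp d →L[ℝ] Sp d)} (h : IsTrace s v γ)
    (hG : HasWeakDerivL2 (interior (cell s)) v G) :
    ∃ φ : ℕ → Sp d → Sp d, (∀ k, ContDiff ℝ ∞ (φ k)) ∧
      Tendsto (fun k => eLpNorm (fun x => ‖φ k x - v x‖ + ‖fderiv ℝ (φ k) x - G x‖) 2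
        (volume.restrict (cell s))) atTop (𝓝 0) ∧
      ∀ a ∈ s, Tendsto (fun k => eLpNorm (fun x => φ k x - γ x) 2
        ((surf d).restrict (cell (facet s a)))) atTop (𝓝 0) := by
  obtain ⟨hH1, hγ, φ, hφ, h1, h2, h3⟩ := h
  refine ⟨φ, hφ, ?_, fun a ha => ?_⟩
  · have hw := hG.weakDeriv_ae_eq isOpen_interior
    rw [restrict_interior_cell] at h1 h2 hw
    have hsum := h1.add h2
    rw [add_zero] at hsum
    refine tendsto_of_tendsto_of_tendsto_of_le_of_le tendsto_const_nhds hsum (fun _ => zero_le)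
      fun k => ?_
    have hv := hG.1.aestronglyMeasurable
    have hg := hG.2.1.aestronglyMeasurable
    rw [restrict_interior_cell] at hv hg
    have hm1 : AEStronglyMeasurable (fun x => φ k x - v x) (volume.restrict (cell s)) :=
      (hφ k).continuous.aestronglyMeasurable.sub hv
    have hm2 : AEStronglyMeasurable (fun x => fderiv ℝ (φ k) x - G x) (volume.restrict (cell s)) :=
      ((hφ k).continuous_fderiv (by simp)).aestronglyMeasurable.sub hg
    refine (eLpNorm_add_le hm1.norm hm2.norm one_le_two).trans ?_
    rw [eLpNorm_norm, eLpNorm_norm]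
    refine add_le_add le_rfl (le_of_eq (eLpNorm_congr_ae ?_))
    filter_upwards [hw] with x hx
    rw [hx]
  · refine tendsto_of_tendsto_of_tendsto_of_le_of_le tendsto_const_nhds h3 (fun _ => zero_le)
      fun k => eLpNorm_mono_measure _ (Measure.restrict_mono (hs.facet_subset_frontier hd ha) le_rfl)

/-- The trace inequality applied to differences shows that the restrictions of an `H¹` approximating
sequence are Cauchy in `L²(∂K)`; the trace is their limit. -/
lemma exists_isTrace {s : Finset (Sp d)} (hs : IsSimplex s) (hd : 0 < d) {v : Sp d → Sp d}
    (hv : IsH1 (interior (cell s)) v) : ∃ γ, IsTrace s v γ := by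
  have hvG := hasWeakDerivL2_weakDeriv hv
  set G := weakDeriv (interior (cell s)) v
  obtain ⟨φ, hφ, h1, h2⟩ := exists_smooth_approx isOpen_interior (convex_cell s).interior
    hs.interior_nonempty ((isCompact_cell s).isBounded.subset interior_subset) hvG
  obtain ⟨C, hC⟩ := hs.exists_eLpNorm_frontier_le hd
  have hfin := hs.isFiniteMeasure_surf_frontier hd
  set μ := (surf d).restrict (frontier (cell s)) with hμ
  set κ := (volume : Measure (Sp d)).restrict (interior (cell s)) with hκ
  have hfr : IsCompact (frontier (cell s)) :=
    (isCompact_cell s).of_isClosed_subset isClosed_frontier (isClosed_cell s).frontier_subset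
  have hmem : ∀ k, MemLp (φ k) 2 μ := by
    intro k
    obtain ⟨B, hB⟩ := hfr.exists_bound_of_continuousOn (hφ k).continuous.continuousOn
    exact MemLp.of_bound (hφ k).continuous.aestronglyMeasurable B
      ((ae_restrict_mem isClosed_frontier.measurableSet).mono hB)
  set b : ℕ → ENNReal := fun k => eLpNorm (fun x => φ k x - v x) 2 κ +
    eLpNorm (fun x => fderiv ℝ (φ k) x - G x) 2 κ with hb
  have hbt : Tendsto b atTop (𝓝 0) := by simpa using h1.add h2
  have hbound : ∀ k l, eLpNorm (φ k - φ l) 2 μ ≤ C * (b k + b l) := by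
    intro k l
    refine (hC (φ k - φ l) (((hφ k).sub (hφ l)).of_le (by simp))).trans (mul_le_mul' le_rfl ?_)
    have hf : fderiv ℝ (φ k - φ l) = fderiv ℝ (φ k) - fderiv ℝ (φ l) := by
      funext x
      exact fderiv_sub ((hφ k).differentiable (by simp) x) ((hφ l).differentiable (by simp) x)
    have e1 : φ k - φ l = (fun x => φ k x - v x) - fun x => φ l x - v x := by
      funext x; simp
    have e2 : fderiv ℝ (φ k - φ l) =
        (fun x => fderiv ℝ (φ k) x - G x) - fun x => fderiv ℝ (φ l) x - G x := by
      rw [hf]; funext x; simp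
    have hm1 : ∀ k, AEStronglyMeasurable (fun x => φ k x - v x) κ := fun k =>
      (hφ k).continuous.aestronglyMeasurable.sub hvG.1.aestronglyMeasurable
    have hm2 : ∀ k, AEStronglyMeasurable (fun x => fderiv ℝ (φ k) x - G x) κ := fun k =>
      ((hφ k).continuous_fderiv (by simp)).aestronglyMeasurable.sub hvG.2.1.aestronglyMeasurable
    rw [e2]
    conv_lhs => rw [e1]
    refine (add_le_add (eLpNorm_sub_le (hm1 k) (hm1 l) one_le_two)
      (eLpNorm_sub_le (hm2 k) (hm2 l) one_le_two)).trans (le_of_eq ?_)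
    simp only [hb]; abel
  have hCb : Tendsto (fun q : ℕ × ℕ => C * (b q.1 + b q.2)) atTop (𝓝 0) := by
    rw [← prod_atTop_atTop_eq]
    have := ENNReal.Tendsto.const_mul (a := (C : ENNReal))
      ((hbt.comp tendsto_fst).add (hbt.comp tendsto_snd)) (Or.inr ENNReal.coe_ne_top)
    simpa using this
  have hcau : CauchySeq fun k => (hmem k).toLp (φ k) := by
    rw [Metric.cauchySeq_iff]
    intro ε hε
    have h3 := (hCb.eventually_lt_const (ENNReal.ofReal_pos.2 hε))
    rw [← prod_atTop_atTop_eq, eventually_prod_iff] at h3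
    obtain ⟨pa, ha, pb, hb', hab⟩ := h3
    obtain ⟨N, hN⟩ := eventually_atTop.1 (ha.and hb')
    refine ⟨N, fun m hm n hn => ?_⟩
    have h4 := (hbound m n).trans_lt (hab (hN m hm).1 (hN n hn).2)
    rw [Lp.dist_def, eLpNorm_congr_ae ((hmem m).coeFn_toLp.sub (hmem n).coeFn_toLp)]
    exact (ENNReal.toReal_lt_of_lt_ofReal h4)
  obtain ⟨γ, hγ⟩ := cauchySeq_tendsto_of_complete hcau
  refine ⟨γ, hv, Lp.memLp γ, φ, hφ, h1, h2, ?_⟩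
  rw [Lp.tendsto_Lp_iff_tendsto_eLpNorm'] at hγ
  refine hγ.congr fun k => eLpNorm_congr_ae ?_
  filter_upwards [(hmem k).coeFn_toLp] with x hx
  simp [hx]

lemma isTrace_trace {s : Finset (Sp d)} (hs : IsSimplex s) (hd : 0 < d) {v : Sp d → Sp d}
    (hv : IsH1 (interior (cell s)) v) : IsTrace s v (trace s v) := by
  have h := exists_isTrace hs hd hv
  rw [trace, dif_pos h]
  exact h.choose_spec

lemma MemLp.coord {α : Type*} [MeasurableSpace α] {μ : Measure α} {f : α → Sp d}
    (hf : MemLp f 2 μ) (i : Fin d) : MemLp (fun x => f x i) 2 μ :=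
  (EuclideanSpace.proj (𝕜 := ℝ) i : Sp d →L[ℝ] ℝ).comp_memLp' hf

lemma norm_coord_le (x : Sp d) (i : Fin d) : ‖x i‖ ≤ ‖x‖ := PiLp.norm_apply_le x i

lemma memLp_clm_apply {α : Type*} [MeasurableSpace α] {μ : Measure α}
    {G : α → (Sp d →L[ℝ] Sp d)} (hG : MemLp G 2 μ) {w : α → Sp d}
    (hw : AEStronglyMeasurable w μ) {B : ℝ} (hB : ∀ᵐ x ∂μ, ‖w x‖ ≤ B) :
    MemLp (fun x => G x (w x)) 2 μ := by
  refine MemLp.of_le_mul (g := G) (c := B) hG ?_ ?_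
  · exact isBoundedBilinearMap_apply.continuous.comp_aestronglyMeasurable
      (hG.aestronglyMeasurable.prodMk hw)
  · filter_upwards [hB] with x hx
    rw [mul_comm]
    exact ((G x).le_opNorm _).trans (by gcongr)

lemma exists_cell_bound (s : Finset (Sp d)) (a : Sp d) :
    ∃ D, 0 ≤ D ∧ ∀ x ∈ cell s, ‖x - a‖ ≤ D := by
  obtain ⟨D, hD⟩ := (isCompact_cell s).exists_bound_of_continuousOn (f := fun x => x - a)
    (by fun_prop)
  exact ⟨|D|, abs_nonneg _, fun x hx => (hD x hx).trans (le_abs_self D)⟩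

lemma ae_cell {s : Finset (Sp d)} {p : Sp d → Prop} (h : ∀ x ∈ cell s, p x) :
    ∀ᵐ x ∂((volume : Measure (Sp d)).restrict (cell s)), p x :=
  (ae_restrict_mem (isClosed_cell s).measurableSet).mono h

lemma memLp_radial {s : Finset (Sp d)} {v : Sp d → Sp d} {G : Sp d → (Sp d →L[ℝ] Sp d)}
    (hv : MemLp v 2 (volume.restrict (cell s))) (hG : MemLp G 2 (volume.restrict (cell s)))
    (a : Sp d) (i : Fin d) :
    MemLp (fun x => d * v x i + G x (x - a) i) 2 (volume.restrict (cell s)) := by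
  obtain ⟨D, -, hD⟩ := exists_cell_bound s a
  exact ((MemLp.coord hv i).const_mul (d : ℝ)).add
    (MemLp.coord (memLp_clm_apply hG (by fun_prop) (ae_cell hD)) i)

lemma HasWeakDerivL2.memLp_cell {s : Finset (Sp d)} {v : Sp d → Sp d}
    {G : Sp d → (Sp d →L[ℝ] Sp d)} (h : HasWeakDerivL2 (interior (cell s)) v G) :
    MemLp v 2 (volume.restrict (cell s)) ∧ MemLp G 2 (volume.restrict (cell s)) := by
  rw [← restrict_interior_cell]; exact ⟨h.1, h.2.1⟩

lemma IsTrace.memLp_facet {s : Finset (Sp d)} (hs : IsSimplex s) (hd : 0 < d) {v γ : Sp d → Sp d}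
    (h : IsTrace s v γ) {a : Sp d} (ha : a ∈ s) :
    MemLp γ 2 ((surf d).restrict (cell (facet s a))) :=
  h.2.1.mono_measure (Measure.restrict_mono (hs.facet_subset_frontier hd ha) le_rfl)

lemma memLp_continuous_compact {F : Type*} [NormedAddCommGroup F] {μ : Measure (Sp d)}
    {K : Set (Sp d)} (hK : IsCompact K)
    [IsFiniteMeasure (μ.restrict K)] {f : Sp d → F} (hf : Continuous f)
    (p : ENNReal) : MemLp f p (μ.restrict K) := by
  obtain ⟨B, hB⟩ := hK.exists_bound_of_continuousOn hf.continuousOn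
  exact MemLp.of_bound hf.aestronglyMeasurable B
    ((ae_restrict_mem hK.measurableSet).mono hB)

/-- The trace on a facet is determined by a volume integral that involves the weak derivative. -/
lemma IsTrace.integral_radial {s : Finset (Sp d)} (hs : IsSimplex s) (hd : 0 < d)
    {v γ : Sp d → Sp d} {G : Sp d → (Sp d →L[ℝ] Sp d)} (h : IsTrace s v γ)
    (hG : HasWeakDerivL2 (interior (cell s)) v G) {a : Sp d} (ha : a ∈ s) {g : Sp d → ℝ}
    (hg : Measurable g) {B : ℝ} (hgB : ∀ x, |g x| ≤ B) (i : Fin d) :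
    ∫ x in cell s, (d * v x i + G x (x - a) i) * g (centralProj s a x) =
      ‖outwardVector s a‖ * ∫ y in cell (facet s a), γ y i * g y ∂(surf d) := by
  have hfin := hs.isFiniteMeasure_surf_facet hd ha
  obtain ⟨φ, hφ, h1, h2⟩ := h.exists_approx hs hd hG
  obtain ⟨hvm, hGm⟩ := hG.memLp_cell
  obtain ⟨D, hD0, hD⟩ := exists_cell_bound s a
  have hB0 : 0 ≤ B := (abs_nonneg _).trans (hgB 0)
  have hgρ : AEStronglyMeasurable (fun x => g (centralProj s a x)) (volume.restrict (cell s)) :=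
    (hg.comp (measurable_centralProj s a)).aestronglyMeasurable
  have hφ1 : ∀ k, ContDiff ℝ 1 (φ k) := fun k => (hφ k).of_le (by simp)
  have hφi : ∀ k, ContDiff ℝ 1 fun x => φ k x i := fun k =>
    (EuclideanSpace.proj (𝕜 := ℝ) i : Sp d →L[ℝ] ℝ).contDiff.comp (hφ1 k)
  have hφd : ∀ k x w, fderiv ℝ (fun x => φ k x i) x w = fderiv ℝ (φ k) x w i := by
    intro k x w
    have := ((EuclideanSpace.proj (𝕜 := ℝ) i : Sp d →L[ℝ] ℝ).hasFDerivAt.comp x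
      ((hφ1 k).differentiable one_ne_zero x).hasFDerivAt)
    rw [show (fun x => φ k x i) = (EuclideanSpace.proj (𝕜 := ℝ) i : Sp d →L[ℝ] ℝ) ∘ φ k from rfl,
      this.fderiv]
    rfl
  have hlhs : Tendsto (fun k => ∫ x in cell s,
      (d * φ k x i + fderiv ℝ (φ k) x (x - a) i) * g (centralProj s a x)) atTop
      (𝓝 (∫ x in cell s, (d * v x i + G x (x - a) i) * g (centralProj s a x))) := by
    refine tendsto_integral_of_le_L2 (f := fun k x => ‖φ k x - v x‖ + ‖fderiv ℝ (φ k) x - G x‖)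
      (fun k => ?_) ?_ (fun k => ?_) ((d + D) * B) (fun k => ?_) h1
    · exact ((memLp_radial (memLp_continuous_compact (isCompact_cell s) (hφ k).continuous 2)
        (memLp_continuous_compact (isCompact_cell s) ((hφ k).continuous_fderiv (by simp)) 2)
        a i).integrable one_le_two).mul_bdd hgρ (ae_of_all _ fun x => hgB _)
    · exact ((memLp_radial hvm hGm a i).integrable one_le_two).mul_bdd hgρ
        (ae_of_all _ fun x => hgB _)
    · exact ((hφ k).continuous.aestronglyMeasurable.sub hvm.aestronglyMeasurable).norm.add
        (((hφ k).continuous_fderiv (by simp)).aestronglyMeasurable.sub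
          hGm.aestronglyMeasurable).norm
    · refine ae_cell fun x hx => ?_
      rw [← sub_mul, norm_mul, Real.norm_of_nonneg (r := ‖φ k x - v x‖ + _) (by positivity)]
      have e1 : d * φ k x i + fderiv ℝ (φ k) x (x - a) i - (d * v x i + G x (x - a) i) =
          d * (φ k x - v x) i + ((fderiv ℝ (φ k) x - G x) (x - a)) i := by
        simp; ring
      rw [e1]
      have e2 : ‖((fderiv ℝ (φ k) x - G x) (x - a)) i‖ ≤ ‖fderiv ℝ (φ k) x - G x‖ * D :=
        (norm_coord_le _ i).trans ((ContinuousLinearMap.le_opNorm _ _).trans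
          (by gcongr; exact hD x hx))
      have e3 : ‖d * (φ k x - v x) i‖ ≤ d * ‖φ k x - v x‖ := by
        rw [norm_mul, Real.norm_natCast]
        gcongr
        exact norm_coord_le _ i
      have e4 : ‖d * (φ k x - v x) i + ((fderiv ℝ (φ k) x - G x) (x - a)) i‖ ≤
          (d + D) * (‖φ k x - v x‖ + ‖fderiv ℝ (φ k) x - G x‖) := by
        refine (norm_add_le _ _).trans ((add_le_add e3 e2).trans ?_)
        have n1 := norm_nonneg (φ k x - v x)
        have n2 := norm_nonneg (fderiv ℝ (φ k) x - G x)
        have n3 : (0 : ℝ) ≤ d := d.cast_nonneg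
        nlinarith [mul_nonneg n3 n2, mul_nonneg hD0 n1]
      calc _ ≤ (d + D) * (‖φ k x - v x‖ + ‖fderiv ℝ (φ k) x - G x‖) * B := by
            gcongr
            exact hgB _
        _ = _ := by ring
  have hrhs : Tendsto (fun k => ∫ y in cell (facet s a), φ k y i * g y ∂(surf d)) atTop
      (𝓝 (∫ y in cell (facet s a), γ y i * g y ∂(surf d))) := by
    have hγ := h.memLp_facet hs hd ha
    refine tendsto_integral_of_le_L2 (f := fun k x => φ k x - γ x)
      (fun k => ?_) ?_ (fun k => ?_) B (fun k => ?_) (h2 a ha)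
    · exact ((MemLp.coord (memLp_continuous_compact (isCompact_cell _) (hφ k).continuous 2)
        i).integrable one_le_two).mul_bdd hg.aestronglyMeasurable (ae_of_all _ fun x => hgB _)
    · exact ((MemLp.coord hγ i).integrable one_le_two).mul_bdd hg.aestronglyMeasurable
        (ae_of_all _ fun x => hgB _)
    · exact (hφ k).continuous.aestronglyMeasurable.sub hγ.aestronglyMeasurable
    · refine ae_of_all _ fun x => ?_
      rw [← sub_mul, norm_mul, mul_comm]
      gcongr
      · exact hgB _
      · exact norm_coord_le (φ k x - γ x) i
  refine tendsto_nhds_unique hlhs ((hrhs.const_mul ‖outwardVector s a‖).congr fun k => ?_)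
  -- For the smooth approximations the identity is the scalar radial formula in coordinate `i`.
  rw [← hs.integral_radial hd ha (hφi k) hg hgB]
  simp only [hφd]

/-- The three traces may come from unrelated approximating sequences. However, the radial identity
determines their integrals over every measurable part of the facet by volume integrals that are
linear in the field and its gradient. -/
lemma IsTrace.sub_ae_eq {s : Finset (Sp d)} (hs : IsSimplex s) (hd : 0 < d)
    {v v' γ γ' γ'' : Sp d → Sp d} {G G' : Sp d → (Sp d →L[ℝ] Sp d)}
    (hG : HasWeakDerivL2 (interior (cell s)) v G) (hG' : HasWeakDerivL2 (interior (cell s)) v' G')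
    (h : IsTrace s v γ) (h' : IsTrace s v' γ') (h'' : IsTrace s (v - v') γ'') {a : Sp d}
    (ha : a ∈ s) :
    ∀ᵐ x ∂((surf d).restrict (cell (facet s a))), γ'' x = γ x - γ' x := by
  have hfin := hs.isFiniteMeasure_surf_facet hd ha
  have hint : ∀ {v γ : Sp d → Sp d}, IsTrace s v γ → ∀ i, Integrable (fun x => γ x i)
      ((surf d).restrict (cell (facet s a))) := fun h i =>
    (MemLp.coord (h.memLp_facet hs hd ha) i).integrable one_le_two
  have hi : ∀ i, ∀ᵐ x ∂((surf d).restrict (cell (facet s a))), γ'' x i = γ x i - γ' x i := by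
    intro i
    refine Integrable.ae_eq_of_forall_setIntegral_eq _ _ (hint h'' i) ((hint h i).sub (hint h' i))
      fun A hA _ => ?_
    -- An indicator is admissible as weight because the radial identity only asks for bounded
    -- measurable weights.
    set g : Sp d → ℝ := A.indicator fun _ => 1
    have hg : Measurable g := measurable_const.indicator hA
    have hgB : ∀ x, |g x| ≤ 1 := fun x => by
      by_cases hx : x ∈ A <;> simp [g, hx]
    have hset : ∀ f : Sp d → ℝ, ∫ x in A, f x ∂((surf d).restrict (cell (facet s a))) =
        ∫ x in cell (facet s a), f x * g x ∂(surf d) := fun f => by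
      rw [← integral_indicator hA]
      refine integral_congr_ae (ae_of_all _ fun x => ?_)
      by_cases hx : x ∈ A <;> simp [g, hx]
    have hpos := (hs.norm_outwardVector_pos hd ha).ne'
    have hbd : ∀ {γ : Sp d → Sp d}, Integrable (fun x => γ x i)
        ((surf d).restrict (cell (facet s a))) → Integrable (fun x => γ x i * g x)
        ((surf d).restrict (cell (facet s a))) := fun h =>
      h.mul_bdd hg.aestronglyMeasurable (ae_of_all _ hgB)
    rw [hset, hset]
    simp only [sub_mul]
    rw [integral_sub (hbd (hint h i)) (hbd (hint h' i))]
    refine mul_left_cancel₀ hpos ?_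
    rw [mul_sub, ← h.integral_radial hs hd hG ha hg hgB i, ← h'.integral_radial hs hd hG' ha hg hgB i,
      ← h''.integral_radial hs hd (hG.sub hG') ha hg hgB i, ← integral_sub]
    · refine integral_congr_ae (ae_of_all _ fun x => ?_)
      simp; ring
    all_goals
      refine Integrable.mul_bdd ((memLp_radial ?_ ?_ a i).integrable one_le_two)
        (hg.comp (measurable_centralProj s a)).aestronglyMeasurable (ae_of_all _ fun x => hgB _)
    · exact hG.memLp_cell.1
    · exact hG.memLp_cell.2
    · exact hG'.memLp_cell.1
    · exact hG'.memLp_cell.2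
  filter_upwards [ae_all_iff.2 hi] with x hx
  ext i
  exact hx i

/-- Green's formula for the trace of a Sobolev field. -/
lemma IsTrace.integral_green {s : Finset (Sp d)} (hs : IsSimplex s) (hd : 0 < d)
    {v γ : Sp d → Sp d} {G : Sp d → (Sp d →L[ℝ] Sp d)} (h : IsTrace s v γ)
    (hG : HasWeakDerivL2 (interior (cell s)) v G) {ψ : Sp d → ℝ} (hψ : ContDiff ℝ 1 ψ) (e : Sp d)
    (i : Fin d) :
    ∫ x in cell s, (G x e i * ψ x + v x i * fderiv ℝ ψ x e) =
      ∑ a ∈ s, inner ℝ (outwardNormal s a) e *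
        ∫ y in cell (facet s a), γ y i * ψ y ∂(surf d) := by
  obtain ⟨φ, hφ, h1, h2⟩ := h.exists_approx hs hd hG
  obtain ⟨hvm, hGm⟩ := hG.memLp_cell
  have hφ1 : ∀ k, ContDiff ℝ 1 (φ k) := fun k => (hφ k).of_le (by simp)
  have hφi : ∀ k, ContDiff ℝ 1 fun x => φ k x i := fun k =>
    (EuclideanSpace.proj (𝕜 := ℝ) i : Sp d →L[ℝ] ℝ).contDiff.comp (hφ1 k)
  have hφd : ∀ k x w, fderiv ℝ (fun x => φ k x i) x w = fderiv ℝ (φ k) x w i := by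
    intro k x w
    have := ((EuclideanSpace.proj (𝕜 := ℝ) i : Sp d →L[ℝ] ℝ).hasFDerivAt.comp x
      ((hφ1 k).differentiable one_ne_zero x).hasFDerivAt)
    rw [show (fun x => φ k x i) = (EuclideanSpace.proj (𝕜 := ℝ) i : Sp d →L[ℝ] ℝ) ∘ φ k from rfl,
      this.fderiv]
    rfl
  have hψc := hψ.continuous
  have hψ'c : Continuous fun x => fderiv ℝ ψ x e := by
    have := hψ.continuous_fderiv one_ne_zero
    fun_prop
  obtain ⟨B, hB⟩ := (isCompact_cell s).exists_bound_of_continuousOn hψc.continuousOn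
  obtain ⟨B', hB'⟩ := (isCompact_cell s).exists_bound_of_continuousOn hψ'c.continuousOn
  have hint : ∀ {v : Sp d → Sp d} {G : Sp d → (Sp d →L[ℝ] Sp d)},
      MemLp v 2 (volume.restrict (cell s)) → MemLp G 2 (volume.restrict (cell s)) →
      IntegrableOn (fun x => G x e i * ψ x + v x i * fderiv ℝ ψ x e) (cell s) := by
    intro v G hv hG
    exact (((MemLp.coord (memLp_clm_apply hG aestronglyMeasurable_const
      (ae_of_all _ fun _ => le_rfl)) i).integrable one_le_two).mul_bdd hψc.aestronglyMeasurable
      (ae_cell hB)).add (((MemLp.coord hv i).integrable one_le_two).mul_bdd hψ'c.aestronglyMeasurable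
      (ae_cell hB'))
  have hlhs : Tendsto (fun k => ∫ x in cell s,
      (fderiv ℝ (φ k) x e i * ψ x + φ k x i * fderiv ℝ ψ x e)) atTop
      (𝓝 (∫ x in cell s, (G x e i * ψ x + v x i * fderiv ℝ ψ x e))) := by
    refine tendsto_integral_of_le_L2 (f := fun k x => ‖φ k x - v x‖ + ‖fderiv ℝ (φ k) x - G x‖)
      (fun k => ?_) (hint hvm hGm) (fun k => ?_) (‖e‖ * |B| + |B'|) (fun k => ?_) h1
    · exact hint (memLp_continuous_compact (isCompact_cell s) (hφ k).continuous 2)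
        (memLp_continuous_compact (isCompact_cell s) ((hφ k).continuous_fderiv (by simp)) 2)
    · exact ((hφ k).continuous.aestronglyMeasurable.sub hvm.aestronglyMeasurable).norm.add
        (((hφ k).continuous_fderiv (by simp)).aestronglyMeasurable.sub
          hGm.aestronglyMeasurable).norm
    · refine ae_cell fun x hx => ?_
      rw [Real.norm_of_nonneg (r := ‖φ k x - v x‖ + _) (by positivity)]
      have e1 : fderiv ℝ (φ k) x e i * ψ x + φ k x i * fderiv ℝ ψ x e -
          (G x e i * ψ x + v x i * fderiv ℝ ψ x e) =
          ((fderiv ℝ (φ k) x - G x) e) i * ψ x + (φ k x - v x) i * fderiv ℝ ψ x e := by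
        simp; ring
      rw [e1]
      have e2 : ‖((fderiv ℝ (φ k) x - G x) e) i * ψ x‖ ≤
          ‖fderiv ℝ (φ k) x - G x‖ * ‖e‖ * |B| := by
        rw [norm_mul]
        exact mul_le_mul ((norm_coord_le _ i).trans (ContinuousLinearMap.le_opNorm _ _))
          ((hB x hx).trans (le_abs_self B)) (norm_nonneg _) (by positivity)
      have e3 : ‖(φ k x - v x) i * fderiv ℝ ψ x e‖ ≤ ‖φ k x - v x‖ * |B'| := by
        rw [norm_mul]
        exact mul_le_mul (norm_coord_le _ i)
          ((hB' x hx).trans (le_abs_self B')) (norm_nonneg _) (by positivity)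
      refine (norm_add_le _ _).trans ((add_le_add e2 e3).trans ?_)
      have n1 : 0 ≤ ‖φ k x - v x‖ * (‖e‖ * |B|) := by positivity
      have n2 : 0 ≤ ‖fderiv ℝ (φ k) x - G x‖ * |B'| := by positivity
      linarith
  have hrhs : ∀ a ∈ s, Tendsto (fun k => ∫ y in cell (facet s a), φ k y i * ψ y ∂(surf d)) atTop
      (𝓝 (∫ y in cell (facet s a), γ y i * ψ y ∂(surf d))) := by
    intro a ha
    have hfin := hs.isFiniteMeasure_surf_facet hd ha
    have hγ := h.memLp_facet hs hd ha
    have hBF : ∀ᵐ x ∂((surf d).restrict (cell (facet s a))), ‖ψ x‖ ≤ B :=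
      (ae_restrict_mem (isClosed_cell _).measurableSet).mono fun x hx =>
        hB x (cell_mono (facet_subset s a) hx)
    refine tendsto_integral_of_le_L2 (f := fun k x => φ k x - γ x)
      (fun k => ?_) ?_ (fun k => ?_) B (fun k => ?_) (h2 a ha)
    · exact ((MemLp.coord (memLp_continuous_compact (isCompact_cell _) (hφ k).continuous 2)
        i).integrable one_le_two).mul_bdd hψc.aestronglyMeasurable hBF
    · exact ((MemLp.coord hγ i).integrable one_le_two).mul_bdd hψc.aestronglyMeasurable hBF
    · exact (hφ k).continuous.aestronglyMeasurable.sub hγ.aestronglyMeasurable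
    · filter_upwards [hBF] with x hx
      rw [← sub_mul, norm_mul, mul_comm]
      exact mul_le_mul hx (norm_coord_le (φ k x - γ x) i) (norm_nonneg _)
        ((norm_nonneg _).trans hx)
  refine tendsto_nhds_unique hlhs ((tendsto_finsetSum s fun a ha =>
    (hrhs a ha).const_mul (inner ℝ (outwardNormal s a) e)).congr fun k => ?_)
  -- For the smooth approximations Green's formula is the divergence theorem for the product with
  -- `ψ`.
  rw [← hs.integral_fderiv hd (φ := fun x => φ k x i * ψ x) ((hφi k).mul hψ) e]
  refine integral_congr_ae (ae_of_all _ fun x => ?_)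
  have h5 := ((hφi k).differentiable one_ne_zero x).hasFDerivAt.mul
    (hψ.differentiable one_ne_zero x).hasFDerivAt
  have h6 : fderiv ℝ (fun x => φ k x i * ψ x) x = _ := h5.fderiv
  simp only [h6, _root_.add_apply, _root_.smul_apply, smul_eq_mul, hφd]
  ring

end NavierStokesFEM

namespace NavierStokesFEM

variable {d : ℕ}

/-! ### Simplices that share a facet -/

lemma IsSimplex.facet_injOn {s : Finset (Sp d)} {a b : Sp d} (ha : a ∈ s)
    (h : facet s a = facet s b) : a = b := by
  by_contra hne
  have : a ∈ facet s b := mem_facet.2 ⟨hne, ha⟩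
  rw [← h, mem_facet] at this
  exact this.1 rfl

lemma insert_facet [DecidableEq (Sp d)] {s : Finset (Sp d)} {a : Sp d} (ha : a ∈ s) :
    insert a (facet s a) = s := by
  ext p
  simp only [Finset.mem_insert, mem_facet]
  constructor
  · rintro (rfl | h)
    · exact ha
    · exact h.2
  · intro h
    by_cases hp : p = a
    · exact Or.inl hp
    · exact Or.inr ⟨hp, h⟩

lemma norm_outwardNormal {s : Finset (Sp d)} (hs : IsSimplex s) (hd : 0 < d) {a : Sp d}
    (ha : a ∈ s) : ‖outwardNormal s a‖ = 1 := by
  have := hs.norm_outwardVector_pos hd ha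
  rw [outwardNormal, norm_smul, norm_inv, norm_norm, inv_mul_cancel₀ this.ne']

/-- Both vectors lie in the orthogonal complement of the direction of the common facet, which is a
line. -/
lemma exists_outwardVector_eq_smul {s t : Finset (Sp d)} (hs : IsSimplex s) (hd : 0 < d)
    {a b : Sp d} (ha : a ∈ s) (hF : facet s a = facet t b) :
    ∃ κ : ℝ, κ • outwardVector s a = outwardVector t b := by
  have hdim : Module.finrank ℝ (vectorSpan ℝ (facet s a : Set (Sp d)))ᗮ = 1 := by
    have h1 := (vectorSpan ℝ (facet s a : Set (Sp d))).finrank_add_finrank_orthogonal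
    have h2 : Module.finrank ℝ (vectorSpan ℝ (facet s a : Set (Sp d))) = d - 1 := by
      have hind : AffineIndependent ℝ ((↑) : facet s a → Sp d) :=
        hs.indep.mono (s := (facet s a : Set (Sp d))) (t := (s : Set (Sp d)))
          (by exact_mod_cast facet_subset s a)
      have := hind.finrank_vectorSpan (n := d - 1)
        (by rw [Fintype.card_coe, hs.card_facet ha]; omega)
      rwa [Subtype.range_coe_subtype] at this
    rw [finrank_euclideanSpace, Fintype.card_fin] at h1
    omega
  have hm1 := IsSimplex.outwardVector_mem s a
  have hm2 := IsSimplex.outwardVector_mem t b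
  rw [← hF] at hm2
  obtain ⟨κ, hκ⟩ := exists_smul_eq_of_finrank_eq_one hdim
    (x := ⟨outwardVector s a, hm1⟩) (by
      intro h
      exact hs.outwardVector_ne_zero hd ha (congrArg Subtype.val h)) ⟨outwardVector t b, hm2⟩
  exact ⟨κ, congrArg Subtype.val hκ⟩

/-- Otherwise both simplices would lie on the same side of the facet. Moving from the centroid of
the facet slightly towards `b` would then stay in both cells but leave the facet, contradicting
conformity. -/
lemma outwardNormal_eq_neg {s t : Finset (Sp d)} (hs : IsSimplex s) (ht : IsSimplex t) (hd : 0 < d)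
    (hst : s ≠ t) (hconf : cell s ∩ cell t ⊆ convexHull ℝ ((s : Set (Sp d)) ∩ t)) {a b : Sp d} (ha : a ∈ s) (hb : b ∈ t)
    (hF : facet s a = facet t b) : outwardNormal t b = -outwardNormal s a := by
  classical
  have hab : a ≠ b := by
    intro h
    apply hst
    rw [← insert_facet ha, ← insert_facet hb, hF, h]
  have hbF : b ∉ facet s a := by rw [hF, mem_facet]; simp
  have haF : a ∉ facet s a := by rw [mem_facet]; simp
  -- The vertex `a` is not shared: if it were in `t`, then, being different from `b`, it would
  -- belong to the common facet.
  have hinter : cell s ∩ cell t ⊆ cell (facet s a) := by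
    refine hconf.trans (convexHull_mono fun p hp => ?_)
    refine Finset.mem_coe.2 (mem_facet.2 ⟨?_, hp.1⟩)
    rintro rfl
    refine haF ?_
    rw [hF]
    exact mem_facet.2 ⟨hab, hp.2⟩
  obtain ⟨κ, hκ⟩ := exists_outwardVector_eq_smul hs hd ha hF
  set c := (facet s a).centroid ℝ id with hc
  have hcF : c ∈ cell (facet s a) :=
    (facet s a).centroid_mem_convexHull (hs.facet_nonempty hd ha)
  have hsa := hs.norm_outwardVector_pos hd ha
  have htb := ht.norm_outwardVector_pos hd hb
  have hκ0 : κ ≠ 0 := by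
    rintro rfl
    rw [zero_smul] at hκ
    rw [← hκ, norm_zero] at htb
    exact lt_irrefl _ htb
  -- The sign of `κ` decides on which side of the facet `b` lies: `κ` positive means the side of
  -- `a`.
  have hlb : level s a b = 1 - κ := by
    have h1 := hs.inner_outwardVector hd ha (convexHull_subset_affineSpan _ hcF)
    have h2 := ht.inner_outwardVector hd hb (p := c)
      (by rw [← hF]; exact convexHull_subset_affineSpan _ hcF)
    rw [← hκ, inner_smul_left, norm_smul, mul_pow, Real.norm_eq_abs, sq_abs] at h2
    simp only [conj_trivial] at h2
    have h3 : inner ℝ (outwardVector s a) (c - b) = κ * ‖outwardVector s a‖ ^ 2 := by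
      have : κ * (inner ℝ (outwardVector s a) (c - b) - κ * ‖outwardVector s a‖ ^ 2) = 0 := by
        linarith
      rcases mul_eq_zero.1 this with h | h
      · exact absurd h hκ0
      · linarith
    rw [level, ← sub_sub_sub_cancel_left a b c, inner_sub_right, h1, h3, sub_div,
      mul_div_assoc, div_self (by positivity), mul_one]
  -- The centroid is in the relative interior of the facet, so the inequalities for the other facets
  -- are strict and survive a small displacement.
  have hcs : ∀ p ∈ s, p ≠ a → level s p c < 1 := by
    intro p hp hpa
    refine lt_of_le_of_ne ((hs.mem_cell_iff hd).1 (cell_mono (facet_subset s a) hcF) p hp) ?_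
    have hw : ∑ i ∈ facet s a, (facet s a).centroidWeights ℝ i = 1 :=
      (facet s a).sum_centroidWeights_eq_one_of_nonempty ℝ (hs.facet_nonempty hd ha)
    have hcsum : c = ∑ i ∈ facet s a, (facet s a).centroidWeights ℝ i • i := by
      rw [hc, Finset.centroid_def,
        (facet s a).affineCombination_eq_linear_combination _ _ hw]
      rfl
    rw [hcsum, level_sum _ _ _ _ _ hw]
    have hpF : p ∈ facet s a := mem_facet.2 ⟨hpa, hp⟩
    rw [← Finset.add_sum_erase _ _ hpF, level_self, mul_zero, zero_add]
    rw [← Finset.add_sum_erase _ _ hpF] at hw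
    have h4 : ∑ i ∈ (facet s a).erase p, (facet s a).centroidWeights ℝ i * level s p i =
        ∑ i ∈ (facet s a).erase p, (facet s a).centroidWeights ℝ i := by
      refine Finset.sum_congr rfl fun i hi => ?_
      rw [Finset.mem_erase] at hi
      rw [hs.level_of_mem hd hp (facet_subset s a hi.2) hi.1, mul_one]
    rw [h4]
    have h5 : 0 < (facet s a).centroidWeights ℝ p := by
      rw [Finset.centroidWeights_apply, hs.card_facet ha]
      positivity
    linarith
  have hκneg : κ < 0 := by
    by_contra hge
    have hκpos : 0 < κ := lt_of_le_of_ne (not_lt.1 hge) hκ0.symm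
    have hev : ∀ p ∈ s, ∀ᶠ δ in 𝓝[>] (0 : ℝ), level s p (c + δ • (b - c)) ≤ 1 := by
      intro p hp
      by_cases hpa : p = a
      · subst hpa
        filter_upwards [self_mem_nhdsWithin] with δ hδ
        rw [level_lineMap, hlb, hs.level_of_mem_facet hd hp hcF]
        have := mul_pos (show (0 : ℝ) < δ from hδ) hκpos
        linarith
      · have hcont : Tendsto (fun δ : ℝ => level s p (c + δ • (b - c))) (𝓝[>] 0)
            (𝓝 (level s p (c + (0 : ℝ) • (b - c)))) := by
          have : Continuous fun δ : ℝ => level s p (c + δ • (b - c)) :=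
            (continuous_level s p).comp (by fun_prop)
          exact (this.tendsto 0).mono_left nhdsWithin_le_nhds
        rw [zero_smul, add_zero] at hcont
        exact (hcont.eventually_lt_const (hcs p hp hpa)).mono fun _ h => h.le
    have hall := (Filter.eventually_all_finset s).2 hev
    have hle1 : ∀ᶠ δ in 𝓝[>] (0 : ℝ), δ < 1 :=
      (eventually_lt_nhds one_pos).filter_mono nhdsWithin_le_nhds
    obtain ⟨δ, ⟨h1, h2⟩, h3⟩ := ((hall.and hle1).and self_mem_nhdsWithin).exists
    have hδ : (0 : ℝ) < δ := h3
    have hys : c + δ • (b - c) ∈ cell s := (hs.mem_cell_iff hd).2 h1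
    have hyt : c + δ • (b - c) ∈ cell t :=
      (convex_cell t).add_smul_sub_mem (cell_mono (facet_subset t b) (hF ▸ hcF)) (subset_cell hb)
        ⟨hδ.le, h2.le⟩
    have h6 := hs.level_of_mem_facet hd ha (hinter ⟨hys, hyt⟩)
    rw [level_lineMap, hlb, hs.level_of_mem_facet hd ha hcF] at h6
    have := mul_pos hδ hκpos
    linarith
  rw [outwardNormal, outwardNormal, ← hκ, norm_smul, Real.norm_eq_abs, abs_of_neg hκneg, smul_smul,
    ← neg_smul]
  congr 1
  field_simp

/-! ### Triangulations -/

namespace Triangulation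

variable {Ω : Set (Sp d)} (𝒯 : Triangulation Ω)

lemma cell_inter {s t : Finset (Sp d)} (hs : s ∈ 𝒯.cells) (ht : t ∈ 𝒯.cells) :
    cell s ∩ cell t = convexHull ℝ ((s : Set (Sp d)) ∩ t) := by
  classical
  rw [𝒯.conforming s hs t ht, cell, Finset.coe_inter]

lemma isOpen (𝒯 : Triangulation Ω) : IsOpen Ω := by rw [← 𝒯.interior_iUnion]; exact isOpen_interior

lemma interior_cell_subset {s : Finset (Sp d)} (hs : s ∈ 𝒯.cells) : interior (cell s) ⊆ Ω := by
  rw [← 𝒯.interior_iUnion]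
  exact interior_mono (subset_biUnion_of_mem (u := fun s => cell s) hs)

lemma subset_iUnion : Ω ⊆ ⋃ s ∈ 𝒯.cells, cell s := by
  conv_lhs => rw [← 𝒯.interior_iUnion]
  exact interior_subset

lemma cell_subset_closure {s : Finset (Sp d)} (hs : s ∈ 𝒯.cells) : cell s ⊆ closure Ω := by
  rw [← (𝒯.isSimplex hs).closure_interior_cell]
  exact closure_mono (𝒯.interior_cell_subset hs)

lemma cell_sdiff_frontier {s t : Finset (Sp d)} (hs : s ∈ 𝒯.cells) (hts : t ⊆ s) :
    cell t \ frontier Ω = cell t ∩ Ω := by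
  ext x
  constructor
  · rintro ⟨hx, hf⟩
    refine ⟨hx, ?_⟩
    by_contra hΩ
    exact hf (by
      rw [𝒯.isOpen.frontier_eq]
      exact ⟨𝒯.cell_subset_closure hs (cell_mono hts hx), hΩ⟩)
  · rintro ⟨hx, hΩ⟩
    refine ⟨hx, fun hf => ?_⟩
    rw [𝒯.isOpen.frontier_eq] at hf
    exact hf.2 hΩ

/-- By conformity the intersection lies in the hull of the common vertices. Distinct cells share at
most `d` of them, so this open set is null and hence empty. -/
lemma disjoint_interior {s t : Finset (Sp d)} (hs : s ∈ 𝒯.cells) (ht : t ∈ 𝒯.cells) (hst : s ≠ t) :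
    Disjoint (interior (cell s)) (interior (cell t)) := by
  classical
  rw [Set.disjoint_iff_inter_eq_empty]
  have hsub : interior (cell s) ∩ interior (cell t) ⊆ cell (s ∩ t) := by
    rw [show cell (s ∩ t) = cell s ∩ cell t by rw [𝒯.cell_inter hs ht, cell, Finset.coe_inter]]
    exact inter_subset_inter interior_subset interior_subset
  have hcard : (s ∩ t).card < d + 1 := by
    rw [← 𝒯.card_vertices s hs]
    refine Finset.card_lt_card ((Finset.ssubset_iff_subset_ne).2 ⟨Finset.inter_subset_left, ?_⟩)
    intro h
    apply hst
    refine Finset.eq_of_subset_of_card_le (Finset.inter_eq_left.1 h) ?_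
    rw [𝒯.card_vertices s hs, 𝒯.card_vertices t ht]
  exact (isOpen_interior.inter isOpen_interior).eq_empty_of_measure_zero
    (measure_mono_null hsub (volume_cell_eq_zero hcard))

/-- The open cells are disjoint and fill `Ω` up to the cell boundaries, which are null by convexity.
Integrals over `Ω` thereby split into integrals over closed cells. -/
lemma restrict_eq_sum :
    (volume : Measure (Sp d)).restrict Ω = ∑ s ∈ 𝒯.cells, volume.restrict (cell s) := by
  have h1 : Ω =ᵐ[volume] ⋃ s ∈ 𝒯.cells, interior (cell s) := by
    refine Filter.EventuallyLE.antisymm ?_ (LE.le.eventuallyLE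
      (iUnion₂_subset fun s hs => 𝒯.interior_cell_subset hs))
    have hnull : volume (⋃ s ∈ 𝒯.cells, frontier (cell s)) = 0 :=
      (measure_biUnion_null_iff 𝒯.cells.countable_toSet).2 fun s _ =>
        (convex_cell s).addHaar_frontier volume
    rw [ae_le_set]
    refine measure_mono_null (fun x hx => ?_) hnull
    obtain ⟨s, hs, hxs⟩ := mem_iUnion₂.1 (𝒯.subset_iUnion hx.1)
    refine mem_iUnion₂.2 ⟨s, hs, ?_⟩
    rw [(isClosed_cell s).frontier_eq]
    exact ⟨hxs, fun hi => hx.2 (mem_iUnion₂.2 ⟨s, hs, hi⟩)⟩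
  rw [Measure.restrict_congr_set h1, Measure.restrict_biUnion_finset
    (fun s hs t ht hst => 𝒯.disjoint_interior hs ht hst) (fun s => isOpen_interior.measurableSet),
    Measure.sum_fintype]
  simp only [restrict_interior_cell]
  exact Finset.sum_coe_sort 𝒯.cells fun s => (volume : Measure (Sp d)).restrict (cell s)

lemma ae_iff {p : Sp d → Prop} : (∀ᵐ x ∂(volume.restrict Ω), p x) ↔
    ∀ s ∈ 𝒯.cells, ∀ᵐ x ∂((volume : Measure (Sp d)).restrict (cell s)), p x := by
  rw [𝒯.restrict_eq_sum]
  simp only [MeasureTheory.ae_iff, Measure.finsetSum_apply, Finset.sum_eq_zero_iff]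

lemma restrict_cell_le {s : Finset (Sp d)} (hs : s ∈ 𝒯.cells) :
    (volume : Measure (Sp d)).restrict (cell s) ≤ volume.restrict Ω := by
  rw [← restrict_interior_cell]
  exact Measure.restrict_mono (𝒯.interior_cell_subset hs) le_rfl

lemma integral_eq_sum {f : Sp d → ℝ} (hf : ∀ s ∈ 𝒯.cells, IntegrableOn f (cell s)) :
    ∫ x in Ω, f x = ∑ s ∈ 𝒯.cells, ∫ x in cell s, f x := by
  rw [𝒯.restrict_eq_sum, integral_finsetSum_measure hf]

/-- The pairs of a cell and the vertex opposite to one of its facets. -/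
noncomputable def sides : Finset (Σ _ : Finset (Sp d), Sp d) := 𝒯.cells.sigma fun s => s

lemma mem_sides {q : Σ _ : Finset (Sp d), Sp d} : q ∈ 𝒯.sides ↔ q.1 ∈ 𝒯.cells ∧ q.2 ∈ q.1 := by
  simp [sides]

lemma sum_sides {M : Type*} [AddCommMonoid M] (f : Finset (Sp d) → Sp d → M) :
    ∑ q ∈ 𝒯.sides, f q.1 q.2 = ∑ s ∈ 𝒯.cells, ∑ a ∈ s, f s a := by
  rw [sides, Finset.sum_sigma]

lemma outwardNormal_eq_neg (hd : 0 < d) {q q' : Σ _ : Finset (Sp d), Sp d} (hq : q ∈ 𝒯.sides)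
    (hq' : q' ∈ 𝒯.sides) (hne : q' ≠ q) (hF : facet q'.1 q'.2 = facet q.1 q.2) :
    outwardNormal q'.1 q'.2 = -outwardNormal q.1 q.2 := by
  rw [mem_sides] at hq hq'
  obtain ⟨s, a⟩ := q
  obtain ⟨t, b⟩ := q'
  have hst : s ≠ t := by
    rintro rfl
    have hba : b = a := IsSimplex.facet_injOn hq'.2 hF
    exact hne (by rw [hba])
  exact NavierStokesFEM.outwardNormal_eq_neg (𝒯.isSimplex hq.1) (𝒯.isSimplex hq'.1) hd hst
    (𝒯.cell_inter hq.1 hq'.1).subset hq.2 hq'.2 hF.symm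

/-- Three sides on one facet would have pairwise opposite unit normals, which is impossible. -/
lemma side_eq_of_facet_eq (hd : 0 < d) {q q' q'' : Σ _ : Finset (Sp d), Sp d} (hq : q ∈ 𝒯.sides)
    (hq' : q' ∈ 𝒯.sides) (hq'' : q'' ∈ 𝒯.sides) (hne : q' ≠ q) (hne' : q'' ≠ q)
    (hF : facet q'.1 q'.2 = facet q.1 q.2) (hF' : facet q''.1 q''.2 = facet q.1 q.2) :
    q'' = q' := by
  by_contra h
  have h1 := 𝒯.outwardNormal_eq_neg hd hq hq' hne hF
  have h2 := 𝒯.outwardNormal_eq_neg hd hq hq'' hne' hF'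
  have h3 := 𝒯.outwardNormal_eq_neg hd hq' hq'' h (hF'.trans hF.symm)
  rw [h2, h1, neg_neg] at h3
  have h4 : outwardNormal q.1 q.2 = 0 := by
    have h5 : (2 : ℝ) • outwardNormal q.1 q.2 = 0 := by
      rw [two_smul]; nth_rewrite 1 [← h3]; simp
    simpa using h5
  have h5 := norm_outwardNormal (𝒯.isSimplex (𝒯.mem_sides.1 hq).1) hd (𝒯.mem_sides.1 hq).2
  rw [h4, norm_zero] at h5
  exact zero_ne_one h5

/-- The intersection is the hull of the common vertices. If some vertex of the facet is missing,
fewer than `d` remain, so the hull has surface measure zero. -/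
lemma surf_facet_inter_cell {s t : Finset (Sp d)} {a : Sp d} (hs : s ∈ 𝒯.cells)
    (ht : t ∈ 𝒯.cells) (ha : a ∈ s) (hFt : ¬ facet s a ⊆ t) :
    surf d (cell (facet s a) ∩ cell t) = 0 := by
  classical
  have hsub : cell (facet s a) ∩ cell t ⊆ cell (facet s a ∩ t) := by
    intro x hx
    have h1 : x ∈ cell s ∩ cell t := ⟨cell_mono (facet_subset s a) hx.1, hx.2⟩
    rw [𝒯.cell_inter hs ht] at h1
    have h2 := (𝒯.affineIndependent s hs).convexHull_inter (facet_subset s a)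
      (Finset.inter_subset_left (s₁ := s) (s₂ := t))
    have h3 : x ∈ convexHull ℝ ((facet s a : Set (Sp d)) ∩ (s ∩ t : Finset (Sp d))) := by
      rw [h2]
      exact ⟨hx.1, by rwa [Finset.coe_inter]⟩
    refine convexHull_mono ?_ h3
    rw [Finset.coe_inter, Finset.coe_inter]
    exact inter_subset_inter_right _ inter_subset_right
  refine measure_mono_null hsub (surf_cell_eq_zero ?_)
  refine lt_of_lt_of_eq ?_ ((𝒯.isSimplex hs).card_facet ha)
  refine Finset.card_lt_card ((Finset.ssubset_iff_subset_ne).2 ⟨Finset.inter_subset_left, ?_⟩)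
  intro h
  exact hFt (Finset.inter_eq_left.1 h)

lemma exists_facet_eq {s t : Finset (Sp d)} {a : Sp d} (hs : s ∈ 𝒯.cells)
    (ht : t ∈ 𝒯.cells) (ha : a ∈ s) (hFt : facet s a ⊆ t) : ∃ b ∈ t, facet t b = facet s a := by
  classical
  have h1 : (facet s a).card < t.card := by
    rw [(𝒯.isSimplex hs).card_facet ha, 𝒯.card_vertices t ht]; omega
  obtain ⟨b, hb, hbF⟩ := Finset.exists_mem_notMem_of_card_lt_card h1
  refine ⟨b, hb, (Finset.eq_of_subset_of_card_le (fun p hp => mem_facet.2 ⟨?_, hFt hp⟩) ?_).symm⟩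
  · rintro rfl; exact hbF hp
  · rw [(𝒯.isSimplex hs).card_facet ha, (𝒯.isSimplex ht).card_facet hb]

/-- A facet that meets `Ω` in a set of positive measure belongs to exactly two cells, which lie on
opposite sides of it. -/
lemma exists_opposite_side (hd : 0 < d) {q : Σ _ : Finset (Sp d), Sp d} (hq : q ∈ 𝒯.sides)
    (hpos : surf d (cell (facet q.1 q.2) ∩ Ω) ≠ 0) :
    ∃ q' ∈ 𝒯.sides, q' ≠ q ∧ facet q'.1 q'.2 = facet q.1 q.2 := by
  by_contra! hcon
  obtain ⟨s, a⟩ := q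
  obtain ⟨hs, ha⟩ := 𝒯.mem_sides.1 hq
  simp only at hs ha hpos hcon
  have hnot : ∀ t ∈ 𝒯.cells, t ≠ s → ¬ facet s a ⊆ t := by
    intro t ht hts hsub
    obtain ⟨b, hb, hbF⟩ := 𝒯.exists_facet_eq hs ht ha hsub
    exact hcon ⟨t, b⟩ (𝒯.mem_sides.2 ⟨ht, hb⟩) (fun h => hts (congrArg Sigma.fst h)) hbF
  classical
  have hnull : surf d (⋃ t ∈ 𝒯.cells.erase s, (cell (facet s a) ∩ cell t)) = 0 := by
    refine (measure_biUnion_null_iff (Finset.countable_toSet _)).2 fun t ht => ?_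
    rw [Finset.mem_coe, Finset.mem_erase] at ht
    exact 𝒯.surf_facet_inter_cell hs ht.2 ha (hnot t ht.2 ht.1)
  refine hpos (measure_mono_null (fun x hx => ?_) hnull)
  by_contra hx'
  simp only [mem_iUnion, Finset.mem_erase, not_exists] at hx'
  -- Were `s` the only cell at this facet, a point `x` of the facet in `Ω` away from the other cells
  -- would have a neighbourhood covered by `s` alone, hence be interior to `cell s`, although it is
  -- on the frontier.
  set O := Ω \ ⋃ t ∈ 𝒯.cells.erase s, cell t with hO
  have hOo : IsOpen O := 𝒯.isOpen.sdiff
    ((Finset.finite_toSet _).isClosed_biUnion fun t _ => isClosed_cell t)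
  have hxO : x ∈ O := by
    refine ⟨hx.2, fun h => ?_⟩
    obtain ⟨t, ht, hxt⟩ := mem_iUnion₂.1 h
    exact hx' t (Finset.mem_erase.1 ht) ⟨hx.1, hxt⟩
  have hOs : O ⊆ cell s := by
    intro z hz
    obtain ⟨t, ht, hzt⟩ := mem_iUnion₂.1 (𝒯.subset_iUnion hz.1)
    by_cases hts : t = s
    · rwa [← hts]
    · exact absurd (mem_iUnion₂.2 ⟨t, Finset.mem_erase.2 ⟨hts, ht⟩, hzt⟩) hz.2
  have h1 : x ∈ interior (cell s) := interior_maximal hOs hOo hxO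
  have h2 := (𝒯.isSimplex hs).facet_subset_frontier hd ha hx.1
  exact h2.2 h1

open scoped Classical in
lemma filter_sides_eq (hd : 0 < d) {q : Σ _ : Finset (Sp d), Sp d} (hq : q ∈ 𝒯.sides)
    (hpos : surf d (cell (facet q.1 q.2) ∩ Ω) ≠ 0) :
    ∃ q' ∈ 𝒯.sides, q' ≠ q ∧ outwardNormal q'.1 q'.2 = -outwardNormal q.1 q.2 ∧
      𝒯.sides.filter (fun r => facet r.1 r.2 = facet q.1 q.2) = {q, q'} := by
  obtain ⟨q', hq', hne, hF⟩ := 𝒯.exists_opposite_side hd hq hpos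
  refine ⟨q', hq', hne, 𝒯.outwardNormal_eq_neg hd hq hq' hne hF, ?_⟩
  ext r
  simp only [Finset.mem_filter, Finset.mem_insert, Finset.mem_singleton]
  constructor
  · rintro ⟨hr, hrF⟩
    by_cases hrq : r = q
    · exact Or.inl hrq
    · exact Or.inr (𝒯.side_eq_of_facet_eq hd hq hq' hr hne hrq hF hrF)
  · rintro (rfl | rfl)
    · exact ⟨hq, rfl⟩
    · exact ⟨hq', hF⟩

end Triangulation

end NavierStokesFEM

namespace NavierStokesFEM

variable {d : ℕ}

/-! ### Traces on interior facets -/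

lemma integral_coord {α : Type*} [MeasurableSpace α] {μ : Measure α} {f : α → Sp d}
    (hf : Integrable f μ) (i : Fin d) : (∫ x, f x ∂μ) i = ∫ x, f x i ∂μ :=
  ((EuclideanSpace.proj (𝕜 := ℝ) i : Sp d →L[ℝ] ℝ).integral_comp_comm hf).symm

lemma integrable_test {O : Set (Sp d)} {v : Sp d → Sp d} {G : Sp d → (Sp d →L[ℝ] Sp d)}
    (hv : MemLp v 2 (volume.restrict O)) (hG : MemLp G 2 (volume.restrict O))
    {φ : Sp d → ℝ} (hφ : ContDiff ℝ ∞ φ) (hc : HasCompactSupport φ) (e : Sp d) :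
    Integrable (fun x => (fderiv ℝ φ x e) • v x) (volume.restrict O) ∧
      Integrable (fun x => φ x • G x e) (volume.restrict O) := by
  have hφ' : Continuous fun x => fderiv ℝ φ x e := by
    have := hφ.continuous_fderiv (by simp)
    fun_prop
  exact ⟨(hv.locallyIntegrable one_le_two).integrable_smul_left_of_hasCompactSupport hφ'
    (hc.fderiv_apply (𝕜 := ℝ) e),
    ((memLp_clm_apply hG aestronglyMeasurable_const (ae_of_all _ fun _ => le_rfl)).locallyIntegrable
      one_le_two).integrable_smul_left_of_hasCompactSupport hφ.continuous hc⟩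

lemma isWeakDeriv_iff {O : Set (Sp d)} {v : Sp d → Sp d} {G : Sp d → (Sp d →L[ℝ] Sp d)}
    (hv : MemLp v 2 (volume.restrict O)) (hG : MemLp G 2 (volume.restrict O)) :
    IsWeakDeriv O v G ↔ ∀ φ : Sp d → ℝ, ContDiff ℝ ∞ φ → HasCompactSupport φ → tsupport φ ⊆ O →
      ∀ (e : Sp d) (i : Fin d), ∫ x in O, (G x e i * φ x + v x i * fderiv ℝ φ x e) = 0 := by
  refine forall_congr' fun φ => forall_congr' fun hφ => forall_congr' fun hc => forall_congr'
    fun _ => forall_congr' fun e => ?_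
  obtain ⟨h1, h2⟩ := integrable_test hv hG hφ hc e
  have h3 : ∀ i, ∫ x in O, (G x e i * φ x + v x i * fderiv ℝ φ x e) =
      (∫ x in O, φ x • G x e) i + (∫ x in O, (fderiv ℝ φ x e) • v x) i := by
    intro i
    rw [integral_coord h1, integral_coord h2, ← integral_add]
    · refine integral_congr_ae (ae_of_all _ fun x => ?_)
      simp; ring
    · exact (EuclideanSpace.proj (𝕜 := ℝ) i : Sp d →L[ℝ] ℝ).integrable_comp h2
    · exact (EuclideanSpace.proj (𝕜 := ℝ) i : Sp d →L[ℝ] ℝ).integrable_comp h1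
  simp only [h3]
  constructor
  · intro h i
    rw [h]; simp
  · intro h
    ext i
    have := h i
    simp only [PiLp.neg_apply]
    linarith

lemma eq_zero_of_notMem {O : Set (Sp d)} {φ : Sp d → ℝ} (hs : tsupport φ ⊆ O) {x : Sp d}
    (hx : x ∉ O) : φ x = 0 ∧ fderiv ℝ φ x = 0 := by
  refine ⟨image_eq_zero_of_notMem_tsupport fun h => hx (hs h), ?_⟩
  by_contra hne
  exact hx (hs (support_fderiv_subset ℝ hne))

namespace Triangulation

variable {Ω : Set (Sp d)} (𝒯 : Triangulation Ω)

lemma hasWeakDerivL2_cell {v : Sp d → Sp d} {G : Sp d → (Sp d →L[ℝ] Sp d)}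
    (hG : HasWeakDerivL2 Ω v G) {s : Finset (Sp d)} (hs : s ∈ 𝒯.cells) :
    HasWeakDerivL2 (interior (cell s)) v G :=
  hG.mono 𝒯.isOpen.measurableSet (𝒯.interior_cell_subset hs)

lemma isTrace (hd : 0 < d) {v : Sp d → Sp d} {G : Sp d → (Sp d →L[ℝ] Sp d)}
    (hG : HasWeakDerivL2 Ω v G) {s : Finset (Sp d)} (hs : s ∈ 𝒯.cells) :
    IsTrace s v (trace s v) :=
  isTrace_trace (𝒯.isSimplex hs) hd ⟨G, 𝒯.hasWeakDerivL2_cell hG hs⟩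

lemma surf_facet_inter_facet {s : Finset (Sp d)} {a p : Sp d} (hs : s ∈ 𝒯.cells) (ha : a ∈ s)
    (hp : p ∈ s) (hpa : p ≠ a) : surf d (cell (facet s a) ∩ cell (facet s p)) = 0 := by
  classical
  have h2 := (𝒯.affineIndependent s hs).convexHull_inter (facet_subset s a) (facet_subset s p)
  rw [cell, cell, ← h2, ← Finset.coe_inter]
  refine surf_cell_eq_zero (lt_of_lt_of_eq ?_ ((𝒯.isSimplex hs).card_facet ha))
  refine Finset.card_lt_card ((Finset.ssubset_iff_subset_ne).2 ⟨Finset.inter_subset_left, ?_⟩)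
  intro h
  have h3 : p ∈ facet s p := Finset.inter_eq_left.1 h (mem_facet.2 ⟨hpa, hp⟩)
  exact (mem_facet.1 h3).1 rfl

/-- The traces of a Sobolev field from the two sides of an interior facet agree. -/
lemma trace_ae_eq (hd : 0 < d) {v : Sp d → Sp d} {G : Sp d → (Sp d →L[ℝ] Sp d)}
    (hG : HasWeakDerivL2 Ω v G) {q q' : Σ _ : Finset (Sp d), Sp d} (hq : q ∈ 𝒯.sides)
    (hq' : q' ∈ 𝒯.sides) (hF : facet q'.1 q'.2 = facet q.1 q.2) :
    ∀ᵐ x ∂((surf d).restrict (cell (facet q.1 q.2) ∩ Ω)), trace q.1 v x = trace q'.1 v x := by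
  classical
  by_cases hqq : q' = q
  · rw [hqq]; exact ae_of_all _ fun _ => rfl
  have hn := 𝒯.outwardNormal_eq_neg hd hq hq' hqq hF
  have huniq : ∀ r ∈ 𝒯.sides, r ≠ q → facet r.1 r.2 = facet q.1 q.2 → r = q' := fun r hr hne hrF =>
    𝒯.side_eq_of_facet_eq hd hq hq' hr hqq hne hF hrF
  obtain ⟨s, a⟩ := q
  obtain ⟨t, b⟩ := q'
  obtain ⟨hs, ha⟩ := 𝒯.mem_sides.1 hq
  obtain ⟨ht, hb⟩ := 𝒯.mem_sides.1 hq'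
  simp only at hs ha ht hb hF hn huniq ⊢
  have hst : t ≠ s := by
    rintro rfl
    have hba : b = a := IsSimplex.facet_injOn hb hF
    exact hqq (by rw [hba])
  have hsS := 𝒯.isSimplex hs
  have htS := 𝒯.isSimplex ht
  set γ := trace s v
  set γ' := trace t v
  have hγ : IsTrace s v γ := 𝒯.isTrace hd hG hs
  have hγ' : IsTrace t v γ' := 𝒯.isTrace hd hG ht
  set F := cell (facet s a) with hFdef
  have hfin := hsS.isFiniteMeasure_surf_facet hd ha
  -- `Z` collects the other cells and the other facets of the two cells. It meets the common facet
  -- in a null set, and a test function supported in `Ω \ Z` sees only these two cells and this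
  -- facet.
  set Z : Set (Sp d) := (⋃ r ∈ (𝒯.cells.erase s).erase t, cell r) ∪
    ((⋃ p ∈ s.erase a, cell (facet s p)) ∪ ⋃ p ∈ t.erase b, cell (facet t p)) with hZ
  have hZc : IsClosed Z :=
    ((Finset.finite_toSet _).isClosed_biUnion fun t _ => isClosed_cell t).union
      (((Finset.finite_toSet _).isClosed_biUnion fun t _ => isClosed_cell _).union
        ((Finset.finite_toSet _).isClosed_biUnion fun t _ => isClosed_cell _))
  have hO : IsOpen (Ω \ Z) := 𝒯.isOpen.sdiff hZc
  have hnull : surf d (F ∩ Z) = 0 := by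
    rw [hZ, inter_union_distrib_left, inter_union_distrib_left, inter_iUnion₂, inter_iUnion₂,
      inter_iUnion₂]
    refine measure_union_null ?_ (measure_union_null ?_ ?_)
    · refine (measure_biUnion_null_iff (Finset.countable_toSet _)).2 fun r hr => ?_
      rw [Finset.mem_coe, Finset.mem_erase, Finset.mem_erase] at hr
      refine 𝒯.surf_facet_inter_cell hs hr.2.2 ha fun hsub => ?_
      obtain ⟨p, hp, hpF⟩ := 𝒯.exists_facet_eq hs hr.2.2 ha hsub
      have := huniq ⟨r, p⟩ (𝒯.mem_sides.2 ⟨hr.2.2, hp⟩)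
        (fun h => hr.2.1 (congrArg Sigma.fst h)) hpF
      exact hr.1 (congrArg Sigma.fst this)
    · refine (measure_biUnion_null_iff (Finset.countable_toSet _)).2 fun p hp => ?_
      rw [Finset.mem_coe, Finset.mem_erase] at hp
      exact 𝒯.surf_facet_inter_facet hs ha hp.2 hp.1
    · refine (measure_biUnion_null_iff (Finset.countable_toSet _)).2 fun p hp => ?_
      rw [Finset.mem_coe, Finset.mem_erase] at hp
      rw [hFdef, ← hF]
      exact 𝒯.surf_facet_inter_facet ht hb hp.2 hp.1
  have hi : ∀ i : Fin d, ∀ᵐ x ∂((surf d).restrict F), x ∈ Ω \ Z → γ x i - γ' x i = 0 := by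
    intro i
    have hI : Integrable (fun x => γ x i) ((surf d).restrict F) :=
      (MemLp.coord (hγ.memLp_facet hsS hd ha) i).integrable one_le_two
    have hI' : Integrable (fun x => γ' x i) ((surf d).restrict F) := by
      have := htS.isFiniteMeasure_surf_facet hd hb
      have := (MemLp.coord (hγ'.memLp_facet htS hd hb) i).integrable one_le_two
      rwa [hF] at this
    refine hO.ae_eq_zero_of_integral_contDiff_smul_eq_zero
      ((hI.sub hI').locallyIntegrable.locallyIntegrableOn _) fun φ hφ hc hsupp => ?_
    -- In this direction the two Green formulas have facet coefficients `1` and `-1`. The weak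
    -- derivative identity on `Ω` then says that the difference of the traces integrates to zero
    -- against `φ`.
    set e := outwardNormal s a
    have hz : ∀ x ∈ Z, φ x = 0 ∧ fderiv ℝ φ x = 0 := fun x hx =>
      eq_zero_of_notMem hsupp fun h => h.2 hx
    have h0 := (isWeakDeriv_iff hG.1 hG.2.1).1 hG.2.2 φ hφ hc (hsupp.trans sdiff_subset) e i
    have hGr : ∀ r (hr : r ∈ 𝒯.cells), IntegrableOn
        (fun x => G x e i * φ x + v x i * fderiv ℝ φ x e) (cell r) := by
      intro r hr
      obtain ⟨k1, k2⟩ := integrable_test hG.1 hG.2.1 hφ hc e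
      have k3 := ((EuclideanSpace.proj (𝕜 := ℝ) i : Sp d →L[ℝ] ℝ).integrable_comp k2).add
        ((EuclideanSpace.proj (𝕜 := ℝ) i : Sp d →L[ℝ] ℝ).integrable_comp k1)
      refine (k3.mono_measure (𝒯.restrict_cell_le hr)).congr (ae_of_all _ fun x => ?_)
      simp; ring
    rw [𝒯.integral_eq_sum hGr, ← Finset.add_sum_erase _ _ hs,
      ← Finset.add_sum_erase _ _ (Finset.mem_erase.2 ⟨hst, ht⟩), Finset.sum_eq_zero, add_zero,
      hγ.integral_green hsS hd (𝒯.hasWeakDerivL2_cell hG hs) (hφ.of_le (by simp)) e i,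
      hγ'.integral_green htS hd (𝒯.hasWeakDerivL2_cell hG ht) (hφ.of_le (by simp)) e i,
      ← Finset.add_sum_erase _ _ ha, ← Finset.add_sum_erase _ _ hb, Finset.sum_eq_zero,
      Finset.sum_eq_zero, add_zero, add_zero, hn, hF] at h0
    · have hn1 : inner ℝ (outwardNormal s a) e = 1 := by
        rw [real_inner_self_eq_norm_sq, norm_outwardNormal hsS hd ha, one_pow]
      rw [inner_neg_left, hn1, one_mul, neg_one_mul, ← sub_eq_add_neg, ← integral_sub] at h0
      · rw [← h0]
        refine integral_congr_ae (ae_of_all _ fun x => ?_)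
        simp only [smul_eq_mul]; ring
      · obtain ⟨B, hB⟩ := hφ.continuous.bounded_above_of_compact_support hc
        exact hI.mul_bdd hφ.continuous.aestronglyMeasurable (ae_of_all _ hB)
      · obtain ⟨B, hB⟩ := hφ.continuous.bounded_above_of_compact_support hc
        exact hI'.mul_bdd hφ.continuous.aestronglyMeasurable (ae_of_all _ hB)
    · intro p hp
      rw [setIntegral_congr_fun (g := fun _ => (0 : ℝ)) (isClosed_cell _).measurableSet, integral_zero,
        mul_zero]
      intro x hx
      simp only
      rw [(hz x (Or.inr (Or.inr (mem_iUnion₂.2 ⟨p, hp, hx⟩)))).1, mul_zero]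
    · intro p hp
      rw [setIntegral_congr_fun (g := fun _ => (0 : ℝ)) (isClosed_cell _).measurableSet, integral_zero,
        mul_zero]
      intro x hx
      simp only
      rw [(hz x (Or.inr (Or.inl (mem_iUnion₂.2 ⟨p, hp, hx⟩)))).1, mul_zero]
    · intro r hr
      rw [setIntegral_congr_fun (g := fun _ => (0 : ℝ)) (isClosed_cell _).measurableSet, integral_zero]
      intro x hx
      obtain ⟨k1, k2⟩ := hz x (Or.inl (mem_iUnion₂.2 ⟨r, hr, hx⟩))
      simp [k1, k2]
  have hmF : MeasurableSet (F ∩ Ω) := (isClosed_cell _).measurableSet.inter 𝒯.isOpen.measurableSet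
  have hOae : ∀ᵐ x ∂((surf d).restrict (F ∩ Ω)), x ∉ Z := by
    rw [MeasureTheory.ae_iff]
    simp only [not_not]
    change (surf d).restrict (F ∩ Ω) Z = 0
    rw [Measure.restrict_apply hZc.measurableSet]
    exact measure_mono_null (show Z ∩ (F ∩ Ω) ⊆ F ∩ Z from fun x hx => ⟨hx.2.1, hx.1⟩) hnull
  filter_upwards [ae_restrict_of_ae_restrict_of_subset inter_subset_left (ae_all_iff.2 hi), hOae,
    ae_restrict_mem hmF] with x h1 h2 h3
  ext i
  exact sub_eq_zero.1 (h1 i ⟨h3.2, h2⟩)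

-- In the application the first index selects the trace and the second the stress and its normal.
-- Once the traces agree, each term depends on its second index only. Exchanging the sums then
-- counts each diagonal term once for each side of its facet, that is twice, unless the facet is
-- negligible in `Ω`.
open scoped Classical in
lemma sum_sides_pair (hd : 0 < d) (I : (Σ _ : Finset (Sp d), Sp d) → (Σ _ : Finset (Sp d), Sp d) → ℝ)
    (h0 : ∀ q ∈ 𝒯.sides, surf d (cell (facet q.1 q.2) ∩ Ω) = 0 → I q q = 0)
    (hsym : ∀ q ∈ 𝒯.sides, ∀ q' ∈ 𝒯.sides, facet q'.1 q'.2 = facet q.1 q.2 → I q q' = I q' q') :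
    ∑ q ∈ 𝒯.sides, ∑ q' ∈ 𝒯.sides, (if facet q'.1 q'.2 = facet q.1 q.2 then I q q' else 0) =
      2 * ∑ q ∈ 𝒯.sides, I q q := by
  have h1 : ∀ q ∈ 𝒯.sides, ∀ q' ∈ 𝒯.sides,
      (if facet q'.1 q'.2 = facet q.1 q.2 then I q q' else 0) =
      (if facet q.1 q.2 = facet q'.1 q'.2 then I q' q' else 0) := by
    intro q hq q' hq'
    by_cases h : facet q'.1 q'.2 = facet q.1 q.2
    · rw [if_pos h, if_pos h.symm, hsym q hq q' hq' h]
    · rw [if_neg h, if_neg (Ne.symm h)]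
  rw [Finset.sum_congr rfl fun q hq => Finset.sum_congr rfl fun q' hq' => h1 q hq q' hq',
    Finset.sum_comm, Finset.mul_sum]
  refine Finset.sum_congr rfl fun q hq => ?_
  rw [← Finset.sum_filter]
  by_cases hpos : surf d (cell (facet q.1 q.2) ∩ Ω) = 0
  · rw [h0 q hq hpos]; simp
  · obtain ⟨q', -, hne, -, hfil⟩ := 𝒯.filter_sides_eq hd hq hpos
    rw [hfil, Finset.sum_pair hne.symm]
    ring

/-- Contributions of the two sides of interior facets to a sum of fluxes cancel. -/
lemma sum_sides_inner_normal (hd : 0 < d) (X : Finset (Sp d) → ℝ)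
    (hX : ∀ F, surf d (cell F ∩ Ω) = 0 → X F = 0) (e : Sp d) :
    ∑ q ∈ 𝒯.sides, inner ℝ (outwardNormal q.1 q.2) e * X (facet q.1 q.2) = 0 := by
  classical
  have h := 𝒯.sum_sides_pair hd
    (fun q q' => inner ℝ (outwardNormal q'.1 q'.2) e * X (facet q.1 q.2))
    (fun q hq h => by rw [hX _ h, mul_zero]) (fun q hq q' hq' h => by rw [h])
  rw [Finset.sum_eq_zero] at h
  · linarith
  · intro q hq
    by_cases hpos : surf d (cell (facet q.1 q.2) ∩ Ω) = 0
    · simp [hX _ hpos]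
    · obtain ⟨q', -, hne, hn, hfil⟩ := 𝒯.filter_sides_eq hd hq hpos
      rw [← Finset.sum_filter, hfil, Finset.sum_pair hne.symm, hn, inner_neg_left]
      ring

lemma memLp_of_cells {F : Type*} [NormedAddCommGroup F] {f : Sp d → F}
    (hf : ∀ s ∈ 𝒯.cells, MemLp f 2 (volume.restrict (cell s))) : MemLp f 2 (volume.restrict Ω) := by
  have h1 : MemLp (fun x => ∑ s ∈ 𝒯.cells, (interior (cell s)).indicator f x) 2
      (volume.restrict Ω) := by
    refine memLp_finsetSum _ fun s hs => ?_
    have := hf s hs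
    rw [← restrict_interior_cell] at this
    exact (memLp_indicator_of_restrict isOpen_interior.measurableSet this).restrict _
  refine h1.ae_eq (𝒯.ae_iff.2 fun s hs => ?_)
  rw [← restrict_interior_cell]
  filter_upwards [ae_restrict_mem isOpen_interior.measurableSet] with x hx
  rw [Finset.sum_eq_single_of_mem s hs, indicator_of_mem hx]
  intro t ht hts
  exact indicator_of_notMem (fun h => (𝒯.disjoint_interior ht hs hts).le_bot ⟨h, hx⟩) _

end Triangulation

/-! ### Piecewise smooth fields -/

lemma IsSimplex.fderivWithin_eq {F : Type*} [NormedAddCommGroup F] [NormedSpace ℝ F]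
    {s : Finset (Sp d)} (hs : IsSimplex s) {u P : Sp d → F} (hP : Differentiable ℝ P)
    (h : ∀ x ∈ cell s, u x = P x) {x : Sp d} (hx : x ∈ cell s) :
    fderivWithin ℝ u (cell s) x = fderiv ℝ P x := by
  rw [fderivWithin_congr h (h x hx), (hP x).fderivWithin (hs.uniqueDiffOn_cell x hx)]

/-- A function is piecewise smooth if it agrees on each closed cell with a smooth function. -/
def IsPiecewiseSmooth {Ω : Set (Sp d)} (𝒯 : Triangulation Ω) {F : Type*} [NormedAddCommGroup F]
    [NormedSpace ℝ F] (u : Sp d → F) : Prop :=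
  ∀ s ∈ 𝒯.cells, ∃ P : Sp d → F, ContDiff ℝ ∞ P ∧ ∀ x ∈ cell s, u x = P x

lemma contDiff_mvPolynomial_eval (P : MvPolynomial (Fin d) ℝ) :
    ContDiff ℝ ∞ fun x : Sp d => MvPolynomial.eval (fun i => x i) P := by
  have h : ∀ i : Fin d, ContDiff ℝ ∞ fun x : Sp d => x i := fun i =>
    (EuclideanSpace.proj (𝕜 := ℝ) i : Sp d →L[ℝ] ℝ).contDiff
  induction P using MvPolynomial.induction_on with
  | C a => simpa using contDiff_const
  | add p q hp hq => simpa using hp.add hq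
  | mul_X p i hp => simpa using hp.mul (h i)

lemma IsQh.isPiecewiseSmooth {Ω : Set (Sp d)} {𝒯 : Triangulation Ω} {q : Sp d → ℝ}
    (hq : IsQh 𝒯 q) : IsPiecewiseSmooth 𝒯 q := fun s hs => by
  obtain ⟨P, -, hP⟩ := hq.2 s hs
  exact ⟨_, contDiff_mvPolynomial_eval P, hP⟩

lemma IsVh.isPiecewiseSmooth {Ω : Set (Sp d)} {𝒯 : Triangulation Ω} {v : Sp d → Sp d}
    (hv : IsVh 𝒯 v) : IsPiecewiseSmooth 𝒯 v := fun s hs => by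
  choose P _ hP using fun i => (hv i).2 s hs
  refine ⟨fun x => WithLp.toLp 2 fun i => MvPolynomial.eval (fun j => x j) (P i), ?_, fun x hx => ?_⟩
  · rw [contDiff_euclidean]
    exact fun i => contDiff_mvPolynomial_eval (P i)
  · ext i
    exact hP i x hx

/-- Continuous piecewise smooth fields belong to `H¹`, with the cellwise derivative. -/
lemma IsPiecewiseSmooth.exists_hasWeakDerivL2 {Ω : Set (Sp d)} {𝒯 : Triangulation Ω} (hd : 0 < d)
    {u : Sp d → Sp d} (hu : IsPiecewiseSmooth 𝒯 u) :
    ∃ G, HasWeakDerivL2 Ω u G ∧ ∀ s ∈ 𝒯.cells,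
      ∀ᵐ x ∂((volume : Measure (Sp d)).restrict (cell s)), G x = fderivWithin ℝ u (cell s) x := by
  choose! P hP huP using hu
  set G : Sp d → (Sp d →L[ℝ] Sp d) := fun x =>
    ∑ s ∈ 𝒯.cells, (interior (cell s)).indicator (fderiv ℝ (P s)) x with hGdef
  have hGP : ∀ s ∈ 𝒯.cells, ∀ᵐ x ∂((volume : Measure (Sp d)).restrict (cell s)),
      G x = fderiv ℝ (P s) x := by
    intro s hs
    rw [← restrict_interior_cell]
    filter_upwards [ae_restrict_mem isOpen_interior.measurableSet] with x hx
    simp only [hGdef]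
    rw [Finset.sum_eq_single_of_mem s hs, indicator_of_mem hx]
    intro t ht hts
    exact indicator_of_notMem (fun h => (𝒯.disjoint_interior ht hs hts).le_bot ⟨h, hx⟩) _
  have hmu : ∀ s ∈ 𝒯.cells, MemLp u 2 (volume.restrict (cell s)) := fun s hs =>
    (memLp_continuous_compact (isCompact_cell s) (hP s hs).continuous 2).ae_eq
      (ae_cell fun x hx => (huP s hs x hx).symm)
  have hmG : ∀ s ∈ 𝒯.cells, MemLp G 2 (volume.restrict (cell s)) := fun s hs =>
    (memLp_continuous_compact (isCompact_cell s) ((hP s hs).continuous_fderiv (by simp)) 2).ae_eq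
      ((hGP s hs).mono fun x hx => hx.symm)
  have hmu' := 𝒯.memLp_of_cells hmu
  have hmG' := 𝒯.memLp_of_cells hmG
  refine ⟨G, ⟨hmu', hmG', (isWeakDeriv_iff hmu' hmG').2 fun φ hφ hc hsupp e i => ?_⟩,
    fun s hs => ?_⟩
  · have hcell : ∀ s ∈ 𝒯.cells, (fun x => G x e i * φ x + u x i * fderiv ℝ φ x e) =ᵐ[volume.restrict
        (cell s)] fun x => fderiv ℝ (fun x => P s x i * φ x) x e := by
      intro s hs
      filter_upwards [hGP s hs, ae_cell (huP s hs)] with x h1 h2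
      have h3 : HasFDerivAt (fun x => P s x i) ((EuclideanSpace.proj (𝕜 := ℝ) i : Sp d →L[ℝ] ℝ) ∘L
          fderiv ℝ (P s) x) x :=
        (EuclideanSpace.proj (𝕜 := ℝ) i : Sp d →L[ℝ] ℝ).hasFDerivAt.comp x
          ((hP s hs).differentiable (by simp) x).hasFDerivAt
      have h4 : fderiv ℝ (fun x => P s x i * φ x) x = _ :=
        (h3.mul (hφ.differentiable (by simp) x).hasFDerivAt).fderiv
      rw [h4, h1, h2]
      simp; ring
    have hPs : ∀ s ∈ 𝒯.cells, ContDiff ℝ ∞ fun x => P s x i * φ x := fun s hs =>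
      ((EuclideanSpace.proj (𝕜 := ℝ) i : Sp d →L[ℝ] ℝ).contDiff.comp (hP s hs)).mul hφ
    rw [𝒯.integral_eq_sum]
    · have hgreen : ∀ s ∈ 𝒯.cells, ∫ x in cell s, (G x e i * φ x + u x i * fderiv ℝ φ x e) =
          ∑ a ∈ s, inner ℝ (outwardNormal s a) e *
            ∫ x in cell (facet s a), u x i * φ x ∂(surf d) := by
        intro s hs
        rw [integral_congr_ae (hcell s hs),
          (𝒯.isSimplex hs).integral_fderiv hd ((hPs s hs).of_le (by simp))]
        refine Finset.sum_congr rfl fun a ha => ?_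
        congr 1
        refine setIntegral_congr_fun (isClosed_cell _).measurableSet fun x hx => ?_
        simp only
        rw [huP s hs x (cell_mono (facet_subset s a) hx)]
      rw [Finset.sum_congr rfl hgreen, ← 𝒯.sum_sides]
      -- The factor multiplying the normal depends on the facet only, because `u` has one value at
      -- each point; so the fluxes from the two sides cancel. On facets negligible in `Ω` it
      -- vanishes, since the support of `φ` lies in `Ω`.
      refine 𝒯.sum_sides_inner_normal hd (fun F => ∫ x in cell F, u x i * φ x ∂(surf d))
        (fun F hF => ?_) e
      have hae : ∀ᵐ x ∂((surf d).restrict (cell F)), u x i * φ x = 0 := by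
        rw [ae_restrict_iff' (isClosed_cell F).measurableSet]
        refine measure_mono_null (fun x hx => ?_) hF
        simp only [mem_compl_iff, mem_ofPred_eq, Classical.not_imp] at hx
        refine ⟨hx.1, ?_⟩
        by_contra hΩ
        exact hx.2 (by rw [(eq_zero_of_notMem hsupp hΩ).1, mul_zero])
      rw [integral_congr_ae hae, integral_zero]
    · intro s hs
      refine Integrable.congr ?_ (hcell s hs).symm
      have : Continuous fun x => fderiv ℝ (fun x => P s x i * φ x) x e := by
        have := (hPs s hs).continuous_fderiv (by simp)
        fun_prop
      exact this.continuousOn.integrableOn_compact (isCompact_cell s)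
  · filter_upwards [hGP s hs, ae_cell fun x hx => (𝒯.isSimplex hs).fderivWithin_eq
      ((hP s hs).differentiable (by simp)) (huP s hs) hx] with x h1 h2
    rw [h1, h2]

end NavierStokesFEM

namespace NavierStokesFEM

variable {d : ℕ}

/-! ### Separated fields -/

section Separated

variable {F F' : Type*} [NormedAddCommGroup F] [NormedSpace ℝ F] [NormedAddCommGroup F']
  [NormedSpace ℝ F']

/-- On `K`, the function `g` agrees with a smooth function on the whole space. -/
def ExtendsSmoothly (K : Set (Sp d)) (g : Sp d → F) : Prop :=
  ∃ P : Sp d → F, ContDiff ℝ ∞ P ∧ ∀ x ∈ K, g x = P x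

/-- On `(0, T) × K`, the field `g` is a finite sum of products of bounded measurable functions of
time and smooth functions of space. -/
def IsSeparated (T : ℝ) (K : Set (Sp d)) (g : ℝ → Sp d → F) : Prop :=
  ∃ (ι : Type) (_ : Fintype ι) (c : ι → ℝ → ℝ) (G : ι → Sp d → F),
    (∀ i, Measurable (c i)) ∧ (∀ i, ∃ B, ∀ t, |c i t| ≤ B) ∧ (∀ i, ContDiff ℝ ∞ (G i)) ∧
    ∀ᵐ t ∂(volume.restrict (Ioc 0 T)), ∀ x ∈ K, g t x = ∑ i, c i t • G i x

variable {T : ℝ} {K : Set (Sp d)}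

lemma ExtendsSmoothly.isSeparated {g : Sp d → F} (h : ExtendsSmoothly K g) :
    IsSeparated T K fun _ => g := by
  obtain ⟨P, hP, h⟩ := h
  refine ⟨Unit, inferInstance, fun _ _ => 1, fun _ => P, fun _ => measurable_const,
    fun _ => ⟨1, by simp⟩, fun _ => hP, ae_of_all _ fun t x hx => ?_⟩
  simp [h x hx]

lemma IsSeparated.extendsSmoothly {g : ℝ → Sp d → F} (h : IsSeparated T K g) :
    ∀ᵐ t ∂(volume.restrict (Ioc 0 T)), ExtendsSmoothly K (g t) := by
  obtain ⟨ι, _, c, G, -, -, hG, h⟩ := h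
  filter_upwards [h] with t ht
  exact ⟨fun x => ∑ i, c i t • G i x, ContDiff.sum fun i _ => (hG i).const_smul _, ht⟩

/-- A time-independent separated field extends smoothly at almost every time, and a single such time
suffices. The closure properties of `ExtendsSmoothly` are thus inherited from those of
`IsSeparated`. -/
lemma ExtendsSmoothly.of_isSeparated {g : Sp d → F} (h : IsSeparated 1 K fun _ => g) :
    ExtendsSmoothly K g := by
  have : NeBot (ae ((volume : Measure ℝ).restrict (Ioc 0 1))) := by
    rw [ae_neBot, Ne, Measure.restrict_eq_zero]
    simp
  exact h.extendsSmoothly.exists.choose_spec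

lemma IsSeparated.mono {K' : Set (Sp d)} {g : ℝ → Sp d → F} (h : IsSeparated T K g) (hK : K' ⊆ K) :
    IsSeparated T K' g := by
  obtain ⟨ι, _, c, G, hc, hB, hG, h⟩ := h
  exact ⟨ι, inferInstance, c, G, hc, hB, hG, h.mono fun t ht x hx => ht x (hK hx)⟩

lemma IsSeparated.zero : IsSeparated T K fun _ _ => (0 : F) :=
  ⟨Empty, inferInstance, fun _ _ => 0, fun _ _ => 0, fun _ => measurable_const,
    fun _ => ⟨0, by simp⟩, fun _ => contDiff_const, ae_of_all _ fun t x _ => by simp⟩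

lemma IsSeparated.add {g g' : ℝ → Sp d → F} (h : IsSeparated T K g) (h' : IsSeparated T K g') :
    IsSeparated T K fun t x => g t x + g' t x := by
  obtain ⟨ι, _, c, G, hc, hB, hG, h⟩ := h
  obtain ⟨ι', _, c', G', hc', hB', hG', h'⟩ := h'
  refine ⟨ι ⊕ ι', inferInstance, Sum.elim c c', Sum.elim G G', ?_, ?_, ?_, ?_⟩
  · rintro (i | i); exacts [hc i, hc' i]
  · rintro (i | i); exacts [hB i, hB' i]
  · rintro (i | i); exacts [hG i, hG' i]
  · filter_upwards [h, h'] with t h1 h2 x hx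
    rw [h1 x hx, h2 x hx, Fintype.sum_sum_type]; rfl

lemma IsSeparated.sum {κ : Type*} (S : Finset κ) {g : κ → ℝ → Sp d → F}
    (h : ∀ k ∈ S, IsSeparated T K (g k)) : IsSeparated T K fun t x => ∑ k ∈ S, g k t x := by
  classical
  induction S using Finset.induction_on with
  | empty => simpa using IsSeparated.zero
  | insert k S hk ih =>
    simp only [Finset.sum_insert hk]
    exact (h k (Finset.mem_insert_self _ _)).add (ih fun j hj => h j (Finset.mem_insert_of_mem hj))

lemma IsSeparated.clm {g : ℝ → Sp d → F} (h : IsSeparated T K g) (L : F →L[ℝ] F') :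
    IsSeparated T K fun t x => L (g t x) := by
  obtain ⟨ι, _, c, G, hc, hB, hG, h⟩ := h
  refine ⟨ι, inferInstance, c, fun i x => L (G i x), hc, hB, fun i => L.contDiff.comp (hG i), ?_⟩
  filter_upwards [h] with t h1 x hx
  rw [h1 x hx]; simp

lemma IsSeparated.const_mul {g : ℝ → Sp d → ℝ} (h : IsSeparated T K g) (r : ℝ) :
    IsSeparated T K fun t x => r * g t x :=
  h.clm (r • ContinuousLinearMap.id ℝ ℝ)

lemma IsSeparated.sub {g g' : ℝ → Sp d → ℝ} (h : IsSeparated T K g) (h' : IsSeparated T K g') :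
    IsSeparated T K fun t x => g t x - g' t x := by
  simpa [sub_eq_add_neg] using h.add (h'.const_mul (-1))

lemma IsSeparated.mul {g g' : ℝ → Sp d → ℝ} (h : IsSeparated T K g) (h' : IsSeparated T K g') :
    IsSeparated T K fun t x => g t x * g' t x := by
  obtain ⟨ι, _, c, G, hc, hB, hG, h⟩ := h
  obtain ⟨ι', _, c', G', hc', hB', hG', h'⟩ := h'
  refine ⟨ι × ι', inferInstance, fun i t => c i.1 t * c' i.2 t, fun i x => G i.1 x * G' i.2 x,
    fun i => (hc i.1).mul (hc' i.2), fun i => ?_, fun i => (hG i.1).mul (hG' i.2), ?_⟩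
  · obtain ⟨B, hB⟩ := hB i.1
    obtain ⟨B', hB'⟩ := hB' i.2
    refine ⟨B * B', fun t => ?_⟩
    rw [abs_mul]
    exact mul_le_mul (hB t) (hB' t) (abs_nonneg _) ((abs_nonneg _).trans (hB t))
  · filter_upwards [h, h'] with t h1 h2 x hx
    rw [h1 x hx, h2 x hx, Fintype.sum_mul_sum, Fintype.sum_prod_type]
    refine Finset.sum_congr rfl fun i _ => Finset.sum_congr rfl fun j _ => ?_
    simp only [smul_eq_mul]; ring

lemma IsSeparated.fderivWithin {s : Finset (Sp d)} (hs : IsSimplex s) {g : ℝ → Sp d → F}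
    (h : IsSeparated T (cell s) g) :
    IsSeparated T (cell s) fun t x => fderivWithin ℝ (g t) (cell s) x := by
  obtain ⟨ι, _, c, G, hc, hB, hG, h⟩ := h
  refine ⟨ι, inferInstance, c, fun i => fderiv ℝ (G i), hc, hB, fun i => (hG i).fderiv_right (by simp), ?_⟩
  filter_upwards [h] with t h1 x hx
  have hd : ∀ i, Differentiable ℝ (G i) := fun i => (hG i).differentiable (by simp)
  rw [hs.fderivWithin_eq (P := fun x => ∑ i, c i t • G i x) (by fun_prop) h1 hx,
    fderiv_fun_sum (A := fun i x => c i t • G i x) fun i _ => ((hd i) x).const_smul _]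
  exact Finset.sum_congr rfl fun i _ => fderiv_fun_const_smul ((hd i) x) _

/-- Separated fields agree with bounded measurable functions on space-time. -/
lemma IsSeparated.exists_bounded {g : ℝ → Sp d → ℝ} (h : IsSeparated T K g) (hK : IsCompact K) :
    ∃ g' : ℝ × Sp d → ℝ, Measurable g' ∧ (∃ B, ∀ a, |g' a| ≤ B) ∧
      ∀ᵐ t ∂(volume.restrict (Ioc 0 T)), ∀ x ∈ K, g t x = g' (t, x) := by
  obtain ⟨ι, _, c, G, hc, hB, hG, h⟩ := h
  choose B hB using hB
  choose D hD using fun i => hK.exists_bound_of_continuousOn (hG i).continuous.continuousOn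
  have hD' : ∀ i x, |K.indicator (G i) x| ≤ |D i| := by
    intro i x
    by_cases hx : x ∈ K
    · rw [indicator_of_mem hx]; exact (hD i x hx).trans (le_abs_self _)
    · rw [indicator_of_notMem hx]; simp
  refine ⟨fun a => ∑ i, c i a.1 * K.indicator (G i) a.2, ?_, ⟨∑ i, B i * |D i|, fun a => ?_⟩, ?_⟩
  · refine Finset.measurable_fun_sum _ fun i _ => ((hc i).comp measurable_fst).mul ?_
    exact ((hG i).continuous.measurable.indicator hK.measurableSet).comp measurable_snd
  · refine (Finset.abs_sum_le_sum_abs _ _).trans (Finset.sum_le_sum fun i _ => ?_)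
    rw [abs_mul]
    exact mul_le_mul (hB i _) (hD' i _) (abs_nonneg _) ((abs_nonneg _).trans (hB i 0))
  · filter_upwards [h] with t ht x hx
    rw [ht x hx]
    simp [indicator_of_mem hx]

lemma ExtendsSmoothly.memLp {g : Sp d → F} (h : ExtendsSmoothly K g) (hK : IsCompact K)
    (μ : Measure (Sp d)) [IsFiniteMeasure (μ.restrict K)] : MemLp g 2 (μ.restrict K) := by
  obtain ⟨P, hP, h⟩ := h
  exact (memLp_continuous_compact hK hP.continuous 2).ae_eq
    ((ae_restrict_mem hK.measurableSet).mono fun x hx => (h x hx).symm)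

lemma ExtendsSmoothly.mono {K' : Set (Sp d)} {g : Sp d → F} (h : ExtendsSmoothly K g) (hK : K' ⊆ K) :
    ExtendsSmoothly K' g := by
  obtain ⟨P, hP, h⟩ := h
  exact ⟨P, hP, fun x hx => h x (hK hx)⟩

end Separated

/-! ### Discrete gradients and stresses as separated fields. -/

section CellFields

variable {T : ℝ} {s : Finset (Sp d)} {u : ℝ → Sp d → Sp d} {p : ℝ → Sp d → ℝ}

lemma IsSeparated.coord {K : Set (Sp d)} (h : IsSeparated T K u) (i : Fin d) :
    IsSeparated T K fun t x => u t x i :=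
  h.clm (EuclideanSpace.proj (𝕜 := ℝ) i : Sp d →L[ℝ] ℝ)

lemma IsSeparated.cellGrad (hs : IsSimplex s) (h : IsSeparated T (cell s) u) (i j : Fin d) :
    IsSeparated T (cell s) fun t x => cellGrad s (u t) x i j :=
  ((h.fderivWithin hs).clm (ContinuousLinearMap.apply ℝ (Sp d) (EuclideanSpace.single j 1))).coord i

lemma cellStress_apply (s : Finset (Sp d)) (ν : ℝ) (u : Sp d → Sp d) (p : Sp d → ℝ) (x : Sp d)
    (i j : Fin d) : cellStress s ν u p x i j =
      ν * (cellGrad s u x i j + cellGrad s u x j i) - (1 : Matrix (Fin d) (Fin d) ℝ) i j * p x := by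
  simp only [cellStress, stress, symGrad, Matrix.sub_apply, Matrix.smul_apply, Matrix.add_apply,
    Matrix.transpose_apply, smul_eq_mul]
  ring

lemma IsSeparated.cellStress (hs : IsSimplex s) (h : IsSeparated T (cell s) u)
    (hp : IsSeparated T (cell s) p) (ν : ℝ) (i j : Fin d) :
    IsSeparated T (cell s) fun t x => cellStress s ν (u t) (p t) x i j := by
  simp only [cellStress_apply]
  exact (((h.cellGrad hs i j).add (h.cellGrad hs j i)).const_mul ν).sub (hp.const_mul _)

lemma IsSeparated.cellDivStress (hs : IsSimplex s) (h : IsSeparated T (cell s) u)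
    (hp : IsSeparated T (cell s) p) (ν : ℝ) (i : Fin d) :
    IsSeparated T (cell s) fun t x => cellDivStress s ν (u t) (p t) x i :=
  IsSeparated.sum _ fun j _ => ((h.cellStress hs hp ν i j).fderivWithin hs).clm
    (ContinuousLinearMap.apply ℝ ℝ (EuclideanSpace.single j 1))

lemma IsSeparated.mulVec {K : Set (Sp d)} {A : ℝ → Sp d → Matrix (Fin d) (Fin d) ℝ}
    {b : ℝ → Sp d → Fin d → ℝ} (hA : ∀ i j, IsSeparated T K fun t x => A t x i j)
    (hb : ∀ i, IsSeparated T K fun t x => b t x i) (i : Fin d) :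
    IsSeparated T K fun t x => (A t x *ᵥ b t x) i :=
  IsSeparated.sum Finset.univ fun j _ => (hA i j).mul (hb j)

lemma isSeparated_const (K : Set (Sp d)) (r : ℝ) : IsSeparated T K fun _ _ => r :=
  ExtendsSmoothly.isSeparated (g := fun _ => r) ⟨_, contDiff_const, fun _ _ => rfl⟩

end CellFields

/-! ### Time interpolation -/

section Time

variable {T : ℝ} (τ : TimeGrid T)

lemma TimeGrid.exists_mem_Ioo {t : ℝ} (ht : t ∈ Ioc 0 T) (hn : t ∉ range τ.node) :
    ∃ n : Fin τ.M, t ∈ Ioo (τ.node n.castSucc) (τ.node n.succ) := by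
  by_contra! h
  have h1 : ∀ k, τ.node k < t := by
    intro k
    induction k using Fin.induction with
    | zero => rw [τ.node_zero]; exact ht.1
    | succ n ih =>
      have := h n
      simp only [mem_Ioo, not_and, not_lt] at this
      exact lt_of_le_of_ne (this ih) fun he => hn ⟨_, he⟩
  have := h1 (Fin.last τ.M)
  rw [τ.node_last] at this
  exact absurd ht.2 (not_le.2 this)

lemma TimeGrid.eq_of_mem_Ioo {t : ℝ} {n m : Fin τ.M}
    (hn : t ∈ Ioo (τ.node n.castSucc) (τ.node n.succ))
    (hm : t ∈ Ioo (τ.node m.castSucc) (τ.node m.succ)) : n = m := by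
  have key : ∀ {n m : Fin τ.M}, t ∈ Ioo (τ.node n.castSucc) (τ.node n.succ) →
      t ∈ Ioo (τ.node m.castSucc) (τ.node m.succ) → ¬ n < m := by
    intro n m hn hm hlt
    have : τ.node n.succ ≤ τ.node m.castSucc := τ.strictMono.monotone (by
      rw [Fin.le_def]; simp only [Fin.val_succ, Fin.val_castSucc]; exact hlt)
    linarith [hn.2, hm.1]
  exact le_antisymm (not_lt.1 (key hm hn)) (not_lt.1 (key hn hm))

/-- Fields that are affine in time on each time interval are separated. -/
lemma isSeparated_of_intervals {F : Type*} [NormedAddCommGroup F] [NormedSpace ℝ F] {K : Set (Sp d)}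
    {Wn : Fin (τ.M + 1) → Sp d → F} (hWn : ∀ n, ExtendsSmoothly K (Wn n)) {W : ℝ → Sp d → F}
    (α β : Fin τ.M → ℝ → ℝ) (hα : ∀ n, Continuous (α n)) (hβ : ∀ n, Continuous (β n))
    (hW : ∀ n : Fin τ.M, ∀ t ∈ Ioo (τ.node n.castSucc) (τ.node n.succ), ∀ x,
      W t x = α n t • Wn n.castSucc x + β n t • Wn n.succ x) : IsSeparated T K W := by
  choose P hP hWP using hWn
  have hb : ∀ (n : Fin τ.M) (α : ℝ → ℝ), Continuous α → ∃ B, ∀ t,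
      |(Ioo (τ.node n.castSucc) (τ.node n.succ)).indicator α t| ≤ B := by
    intro n α hα
    obtain ⟨B, hB⟩ := (isCompact_Icc (a := τ.node n.castSucc)
      (b := τ.node n.succ)).exists_bound_of_continuousOn hα.continuousOn
    refine ⟨|B|, fun t => ?_⟩
    by_cases ht : t ∈ Ioo (τ.node n.castSucc) (τ.node n.succ)
    · rw [indicator_of_mem ht]
      exact (hB t (Ioo_subset_Icc_self ht)).trans (le_abs_self _)
    · rw [indicator_of_notMem ht]; simp
  refine ⟨Fin τ.M ⊕ Fin τ.M, inferInstance,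
    Sum.elim (fun n => (Ioo (τ.node n.castSucc) (τ.node n.succ)).indicator (α n))
      (fun n => (Ioo (τ.node n.castSucc) (τ.node n.succ)).indicator (β n)),
    Sum.elim (fun n => P n.castSucc) (fun n => P n.succ), ?_, ?_, ?_, ?_⟩
  · rintro (n | n)
    exacts [(hα n).measurable.indicator measurableSet_Ioo,
      (hβ n).measurable.indicator measurableSet_Ioo]
  · rintro (n | n)
    exacts [hb n _ (hα n), hb n _ (hβ n)]
  · rintro (n | n)
    exacts [hP _, hP _]
  · have h0 : ∀ᵐ t ∂((volume : Measure ℝ).restrict (Ioc 0 T)), t ∉ range τ.node :=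
      ae_restrict_of_ae (measure_eq_zero_iff_ae_notMem.1 ((finite_range τ.node).measure_zero _))
    filter_upwards [h0, ae_restrict_mem measurableSet_Ioc] with t h1 h2 x hx
    obtain ⟨n, hn⟩ := τ.exists_mem_Ioo h2 h1
    rw [hW n t hn, hWP _ x hx, hWP _ x hx, Fintype.sum_sum_type]
    congr 1
    · rw [Finset.sum_eq_single n]
      · simp [indicator_of_mem hn]
      · intro m _ hm
        simp [indicator_of_notMem fun h => hm (τ.eq_of_mem_Ioo h hn)]
      · simp
    · rw [Finset.sum_eq_single n]
      · simp [indicator_of_mem hn]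
      · intro m _ hm
        simp [indicator_of_notMem fun h => hm (τ.eq_of_mem_Ioo h hn)]
      · simp

variable {τ}

lemma IsTimeInterpolant.isSeparated {F : Type*} [NormedAddCommGroup F] [NormedSpace ℝ F]
    {K : Set (Sp d)} {Wn : Fin (τ.M + 1) → Sp d → F} (hWn : ∀ n, ExtendsSmoothly K (Wn n))
    {W : ℝ → Sp d → F} (hW : IsTimeInterpolant τ Wn W) : IsSeparated T K W :=
  isSeparated_of_intervals τ hWn _ _ (fun n => by fun_prop) (fun n => by fun_prop)
    fun n t ht x => hW n t (Ioo_subset_Icc_self ht) x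

/-- Inside a time interval the derivative is the difference quotient of the two nodal fields. -/
lemma IsTimeInterpolant.isSeparated_timeDeriv {K : Set (Sp d)} {Wn : Fin (τ.M + 1) → Sp d → Sp d}
    (hWn : ∀ n, ExtendsSmoothly K (Wn n)) {W : ℝ → Sp d → Sp d} (hW : IsTimeInterpolant τ Wn W) :
    IsSeparated T K (timeDeriv W) := by
  refine isSeparated_of_intervals τ hWn
    (fun n _ => -1 / (τ.node n.succ - τ.node n.castSucc))
    (fun n _ => 1 / (τ.node n.succ - τ.node n.castSucc)) (fun n => continuous_const)
    (fun n => continuous_const) fun n t ht x => ?_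
  have h1 : (fun r => W r x) =ᶠ[𝓝 t] fun r =>
      ((τ.node n.succ - r) / (τ.node n.succ - τ.node n.castSucc)) • Wn n.castSucc x +
      ((r - τ.node n.castSucc) / (τ.node n.succ - τ.node n.castSucc)) • Wn n.succ x := by
    filter_upwards [Ioo_mem_nhds ht.1 ht.2] with r hr
    exact hW n r (Ioo_subset_Icc_self hr) x
  rw [timeDeriv, h1.deriv_eq]
  exact (((((hasDerivAt_id t).const_sub _).div_const _).smul_const _).add
    ((((hasDerivAt_id t).sub_const _).div_const _).smul_const _)).deriv

end Time

end NavierStokesFEM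

namespace NavierStokesFEM

variable {d : ℕ}

/-! ### Cellwise integration by parts -/

lemma integrable_dotProduct {α : Type*} [MeasurableSpace α] {μ : Measure α} {γ : α → Sp d}
    {g : α → Fin d → ℝ} (hγ : MemLp γ 2 μ) (hg : ∀ i, MemLp (fun x => g x i) 2 μ) :
    Integrable (fun x => (γ x).ofLp ⬝ᵥ g x) μ :=
  integrable_finsetSum _ fun i _ => (MemLp.coord hγ i).integrable_mul (hg i)

/-- A symmetric matrix is orthogonal to the antisymmetric part of `A`, so the symmetrisation can be
dropped. -/
lemma frob_symGrad {A S : Matrix (Fin d) (Fin d) ℝ} (hS : ∀ i j, S i j = S j i) :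
    frob (symGrad A) S = ∑ i, ∑ j, A i j * S i j := by
  have h1 : ∑ i, ∑ j, A j i * S i j = ∑ i, ∑ j, A i j * S i j := by
    rw [Finset.sum_comm]
    exact Finset.sum_congr rfl fun i _ => Finset.sum_congr rfl fun j _ => by rw [hS j i]
  have h2 : ∀ i j, symGrad A i j * S i j = 1 / 2 * (A i j * S i j) + 1 / 2 * (A j i * S i j) := by
    intro i j
    simp only [symGrad, Matrix.smul_apply, Matrix.add_apply, Matrix.transpose_apply, smul_eq_mul]
    ring
  simp only [frob, h2, Finset.sum_add_distrib, ← Finset.mul_sum]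
  rw [h1]; ring

lemma cellStress_symm (s : Finset (Sp d)) (ν : ℝ) (u : Sp d → Sp d) (p : Sp d → ℝ) (x : Sp d)
    (i j : Fin d) : cellStress s ν u p x i j = cellStress s ν u p x j i := by
  rw [cellStress_apply, cellStress_apply, Matrix.one_apply, Matrix.one_apply, add_comm]
  simp only [eq_comm]

section ExtendsSmoothly

variable {s : Finset (Sp d)} {u : Sp d → Sp d} {p : Sp d → ℝ}

lemma ExtendsSmoothly.coord {K : Set (Sp d)} (hu : ExtendsSmoothly K u) (i : Fin d) :
    ExtendsSmoothly K fun x => u x i :=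
  .of_isSeparated (hu.isSeparated.coord i)

lemma ExtendsSmoothly.cellGrad (hs : IsSimplex s) (hu : ExtendsSmoothly (cell s) u) (i j : Fin d) :
    ExtendsSmoothly (cell s) fun x => cellGrad s u x i j :=
  .of_isSeparated (hu.isSeparated.cellGrad hs i j)

lemma ExtendsSmoothly.cellStress (hs : IsSimplex s) (hu : ExtendsSmoothly (cell s) u)
    (hp : ExtendsSmoothly (cell s) p) (ν : ℝ) (i j : Fin d) :
    ExtendsSmoothly (cell s) fun x => cellStress s ν u p x i j :=
  .of_isSeparated (hu.isSeparated.cellStress hs hp.isSeparated ν i j)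

lemma ExtendsSmoothly.cellDivStress (hs : IsSimplex s) (hu : ExtendsSmoothly (cell s) u)
    (hp : ExtendsSmoothly (cell s) p) (ν : ℝ) (i : Fin d) :
    ExtendsSmoothly (cell s) fun x => cellDivStress s ν u p x i :=
  .of_isSeparated (hu.isSeparated.cellDivStress hs hp.isSeparated ν i)

lemma ExtendsSmoothly.mulVec {K : Set (Sp d)} {A : Sp d → Matrix (Fin d) (Fin d) ℝ}
    {b : Sp d → Fin d → ℝ} (hA : ∀ i j, ExtendsSmoothly K fun x => A x i j)
    (hb : ∀ i, ExtendsSmoothly K fun x => b x i) (i : Fin d) :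
    ExtendsSmoothly K fun x => (A x *ᵥ b x) i :=
  .of_isSeparated (IsSeparated.mulVec (fun i j => (hA i j).isSeparated)
    (fun i => (hb i).isSeparated) i)

lemma extendsSmoothly_const {F : Type*} [NormedAddCommGroup F] [NormedSpace ℝ F] (K : Set (Sp d))
    (r : F) : ExtendsSmoothly K fun _ => r := ⟨_, contDiff_const, fun _ _ => rfl⟩

end ExtendsSmoothly

/-- Integration by parts of the viscous and pressure terms on a cell. -/
lemma IsTrace.integral_frob {s : Finset (Sp d)} (hs : IsSimplex s) (hd : 0 < d)
    {v γ : Sp d → Sp d} {G : Sp d → (Sp d →L[ℝ] Sp d)} (h : IsTrace s v γ)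
    (hG : HasWeakDerivL2 (interior (cell s)) v G) {u : Sp d → Sp d} {p : Sp d → ℝ}
    (hu : ExtendsSmoothly (cell s) u) (hp : ExtendsSmoothly (cell s) p) (ν : ℝ) :
    ∫ x in cell s, frob (symGrad (jac (G x))) (cellStress s ν u p x) =
      -(∫ x in cell s, (v x).ofLp ⬝ᵥ cellDivStress s ν u p x) +
        ∑ a ∈ s, ∫ x in cell (facet s a), (γ x).ofLp ⬝ᵥ
          (cellStress s ν u p x *ᵥ (outwardNormal s a).ofLp) ∂(surf d) := by
  choose S hS hSe using fun i j => hu.cellStress hs hp ν i j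
  obtain ⟨hvm, hGm⟩ := hG.memLp_cell
  have hdS : ∀ i j, MemLp (fun x => fderiv ℝ (S i j) x (EuclideanSpace.single j 1)) 2
      ((volume : Measure (Sp d)).restrict (cell s)) := fun i j =>
    memLp_continuous_compact (isCompact_cell s)
      (((hS i j).continuous_fderiv (by simp)).clm_apply continuous_const) 2
  have hSm : ∀ i j, MemLp (S i j) 2 ((volume : Measure (Sp d)).restrict (cell s)) := fun i j =>
    memLp_continuous_compact (isCompact_cell s) (hS i j).continuous 2
  have hGi : ∀ i j, MemLp (fun x => G x (EuclideanSpace.single j 1) i) 2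
      ((volume : Measure (Sp d)).restrict (cell s)) := fun i j =>
    MemLp.coord (memLp_clm_apply hGm aestronglyMeasurable_const (ae_of_all _ fun _ => le_rfl)) i
  have hI : ∀ i j, Integrable (fun x => G x (EuclideanSpace.single j 1) i * S i j x +
      v x i * fderiv ℝ (S i j) x (EuclideanSpace.single j 1))
      ((volume : Measure (Sp d)).restrict (cell s)) := fun i j =>
    ((hGi i j).integrable_mul (hSm i j)).add ((MemLp.coord hvm i).integrable_mul (hdS i j))
  have hdiv : ∀ x ∈ cell s, ∀ i, cellDivStress s ν u p x i =
      ∑ j, fderiv ℝ (S i j) x (EuclideanSpace.single j 1) := by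
    intro x hx i
    refine Finset.sum_congr rfl fun j _ => ?_
    rw [hs.fderivWithin_eq ((hS i j).differentiable (by simp)) (hSe i j) hx]
  have h1 : (∫ x in cell s, frob (symGrad (jac (G x))) (cellStress s ν u p x)) +
      ∫ x in cell s, (v x).ofLp ⬝ᵥ cellDivStress s ν u p x =
      ∑ i, ∑ j, ∫ x in cell s, (G x (EuclideanSpace.single j 1) i * S i j x +
        v x i * fderiv ℝ (S i j) x (EuclideanSpace.single j 1)) := by
    have e1 : (fun x => frob (symGrad (jac (G x))) (cellStress s ν u p x))
        =ᵐ[volume.restrict (cell s)] fun x => ∑ i, ∑ j, G x (EuclideanSpace.single j 1) i * S i j x :=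
      ae_cell fun x hx => by
        beta_reduce
        rw [frob_symGrad (cellStress_symm s ν u p x)]
        simp only [hSe _ _ x hx]; rfl
    have e2 : (fun x => (v x).ofLp ⬝ᵥ cellDivStress s ν u p x) =ᵐ[volume.restrict (cell s)]
        fun x => ∑ i, ∑ j, v x i * fderiv ℝ (S i j) x (EuclideanSpace.single j 1) :=
      ae_cell fun x hx => by
        simp only [dotProduct, hdiv x hx, Finset.mul_sum]
    rw [integral_congr_ae e1, integral_congr_ae e2, ← integral_add]
    · rw [← Finset.sum_congr rfl fun i _ => integral_finsetSum _ fun j _ => hI i j,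
        ← integral_finsetSum _ fun i _ => integrable_finsetSum _ fun j _ => hI i j]
      simp only [Finset.sum_add_distrib]
    · exact integrable_finsetSum _ fun i _ => integrable_finsetSum _ fun j _ =>
        (hGi i j).integrable_mul (hSm i j)
    · exact integrable_finsetSum _ fun i _ => integrable_finsetSum _ fun j _ =>
        (MemLp.coord hvm i).integrable_mul (hdS i j)
  have h2 : ∑ i, ∑ j, ∫ x in cell s, (G x (EuclideanSpace.single j 1) i * S i j x +
        v x i * fderiv ℝ (S i j) x (EuclideanSpace.single j 1)) =
      ∑ a ∈ s, ∫ x in cell (facet s a), (γ x).ofLp ⬝ᵥ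
          (cellStress s ν u p x *ᵥ (outwardNormal s a).ofLp) ∂(surf d) := by
    -- Green's formula is applied to each entry of the stress, with the direction of the column
    -- index.
    simp only [fun i j => h.integral_green hs hd hG ((hS i j).of_le (by simp) : ContDiff ℝ 1 (S i j))
      (EuclideanSpace.single j 1) i]
    rw [Finset.sum_congr rfl fun i _ => Finset.sum_comm, Finset.sum_comm]
    refine Finset.sum_congr rfl fun a ha => ?_
    have hfin := hs.isFiniteMeasure_surf_facet hd ha
    have hJ : ∀ i j, Integrable (fun x => outwardNormal s a j * (γ x i * S i j x))
        ((surf d).restrict (cell (facet s a))) := fun i j =>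
      ((MemLp.coord (h.memLp_facet hs hd ha) i).integrable_mul (memLp_continuous_compact
        (isCompact_cell _) (hS i j).continuous 2)).const_mul _
    have hin : ∀ j : Fin d, inner ℝ (outwardNormal s a) (EuclideanSpace.single j 1) =
        outwardNormal s a j := fun j => by
      rw [EuclideanSpace.inner_single_right]; simp
    simp only [hin, ← integral_const_mul]
    rw [← Finset.sum_congr rfl fun i _ => integral_finsetSum _ fun j _ => hJ i j,
      ← integral_finsetSum _ fun i _ => integrable_finsetSum _ fun j _ => hJ i j]
    refine setIntegral_congr_fun (isClosed_cell _).measurableSet fun x hx => ?_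
    have hx' := cell_mono (facet_subset s a) hx
    simp only [dotProduct, Matrix.mulVec, Finset.mul_sum, hSe _ _ x hx']
    exact Finset.sum_congr rfl fun i _ => Finset.sum_congr rfl fun j _ => by ring
  linarith

end NavierStokesFEM

namespace NavierStokesFEM

variable {d : ℕ}

/-! ### The residual as a sum of cell contributions -/

namespace Triangulation

variable {Ω : Set (Sp d)} (𝒯 : Triangulation Ω)

lemma integral_eq_sum_of_ae {g : Sp d → ℝ} {g' : Finset (Sp d) → Sp d → ℝ}
    (h : ∀ s ∈ 𝒯.cells, g =ᵐ[volume.restrict (cell s)] g' s)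
    (hg' : ∀ s ∈ 𝒯.cells, IntegrableOn (g' s) (cell s)) :
    ∫ x in Ω, g x = ∑ s ∈ 𝒯.cells, ∫ x in cell s, g' s x := by
  rw [𝒯.integral_eq_sum fun s hs => (hg' s hs).congr (h s hs).symm]
  exact Finset.sum_congr rfl fun s hs => integral_congr_ae (h s hs)

variable {u : Sp d → Sp d} {p : Sp d → ℝ} {v : Sp d → Sp d} {G : Sp d → (Sp d →L[ℝ] Sp d)}

/-- The discrete velocity belongs to `H¹` with its cellwise derivative, and weak derivatives are
unique almost everywhere. The integrals in the form can thus be computed with one-sided cell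
derivatives. -/
lemma weakDeriv_eq_cellGrad (hd : 0 < d) (hu : ∀ s ∈ 𝒯.cells, ExtendsSmoothly (cell s) u)
    {s : Finset (Sp d)} (hs : s ∈ 𝒯.cells) :
    ∀ᵐ x ∂(volume.restrict (cell s)), jac (weakDeriv Ω u x) = cellGrad s u x := by
  obtain ⟨Gu, hGu, hGe⟩ := IsPiecewiseSmooth.exists_hasWeakDerivL2 (𝒯 := 𝒯) hd hu
  filter_upwards [hGe s hs, ae_mono (𝒯.restrict_cell_le hs)
    (hGu.weakDeriv_ae_eq 𝒯.isOpen)] with x h1 h2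
  rw [h2, h1, cellGrad]

lemma memLp_trace_facet (hd : 0 < d) (hG : HasWeakDerivL2 Ω v G) {s : Finset (Sp d)}
    (hs : s ∈ 𝒯.cells) {a : Sp d} (ha : a ∈ s) :
    MemLp (trace s v) 2 ((surf d).restrict (cell (facet s a))) :=
  (𝒯.isTrace hd hG hs).memLp_facet (𝒯.isSimplex hs) hd ha

lemma integrable_trace_dotProduct (hd : 0 < d) (hG : HasWeakDerivL2 Ω v G) {s : Finset (Sp d)}
    (hs : s ∈ 𝒯.cells) {a : Sp d} (ha : a ∈ s) {g : Sp d → Fin d → ℝ}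
    (hg : ∀ i, ExtendsSmoothly (cell (facet s a)) fun x => g x i) :
    IntegrableOn (fun x => (trace s v x).ofLp ⬝ᵥ g x) (cell (facet s a)) (surf d) := by
  have := (𝒯.isSimplex hs).isFiniteMeasure_surf_facet hd ha
  exact integrable_dotProduct (𝒯.memLp_trace_facet hd hG hs ha)
    fun i => (hg i).memLp (isCompact_cell _) _

/-- The normal stress on a facet extends smoothly. -/
lemma extendsSmoothly_normalStress (hu : ∀ s ∈ 𝒯.cells, ExtendsSmoothly (cell s) u)
    (hp : ∀ s ∈ 𝒯.cells, ExtendsSmoothly (cell s) p) (ν : ℝ) {s : Finset (Sp d)}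
    (hs : s ∈ 𝒯.cells) (a : Sp d) (i : Fin d) :
    ExtendsSmoothly (cell (facet s a)) fun x =>
      (cellStress s ν u p x *ᵥ (outwardNormal s a).ofLp) i :=
  (ExtendsSmoothly.mulVec (b := fun _ => (outwardNormal s a).ofLp)
    (fun i j => (hu s hs).cellStress (𝒯.isSimplex hs) (hp s hs) ν i j)
    (fun _ => extendsSmoothly_const _ _) i).mono (cell_mono (facet_subset s a))

open scoped Classical in
lemma jump_eq_sum_sides (ν : ℝ) (F : Finset (Sp d)) (x : Sp d) :
    jump 𝒯 ν u p F x = ∑ q ∈ 𝒯.sides, if facet q.1 q.2 = F then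
      cellStress q.1 ν u p x *ᵥ (outwardNormal q.1 q.2).ofLp else 0 := by
  rw [jump, 𝒯.sum_sides fun s a => if facet s a = F then
      cellStress s ν u p x *ᵥ (outwardNormal s a).ofLp else 0]

/-- The normal stresses on the interior facets sum up to half of the jumps. -/
lemma sum_integral_normalStress_interior (hd : 0 < d) (hG : HasWeakDerivL2 Ω v G)
    (hu : ∀ s ∈ 𝒯.cells, ExtendsSmoothly (cell s) u)
    (hp : ∀ s ∈ 𝒯.cells, ExtendsSmoothly (cell s) p) (ν : ℝ) :
    ∑ s ∈ 𝒯.cells, ∑ a ∈ s, ∫ x in cell (facet s a) \ frontier Ω, (trace s v x).ofLp ⬝ᵥ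
        (cellStress s ν u p x *ᵥ (outwardNormal s a).ofLp) ∂(surf d) =
      ∑ s ∈ 𝒯.cells, ∑ a ∈ s, ∫ x in cell (facet s a) \ frontier Ω, (trace s v x).ofLp ⬝ᵥ
        ((1 / 2 : ℝ) • jump 𝒯 ν u p (facet s a) x) ∂(surf d) := by
  classical
  -- The side `q` provides the facet and the trace, the side `q'` the stress and the normal. The
  -- diagonal gives the one-sided fluxes, and summing over all `q'` with the same facet gives the
  -- jump.
  set I : (Σ _ : Finset (Sp d), Sp d) → (Σ _ : Finset (Sp d), Sp d) → ℝ := fun q q' =>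
    ∫ x in cell (facet q.1 q.2) \ frontier Ω, (trace q.1 v x).ofLp ⬝ᵥ
      (cellStress q'.1 ν u p x *ᵥ (outwardNormal q'.1 q'.2).ofLp) ∂(surf d) with hI
  have hset : ∀ q ∈ 𝒯.sides, cell (facet q.1 q.2) \ frontier Ω = cell (facet q.1 q.2) ∩ Ω :=
    fun q hq => 𝒯.cell_sdiff_frontier (𝒯.mem_sides.1 hq).1 (facet_subset _ _)
  have h := 𝒯.sum_sides_pair hd I (fun q hq h0 => by
      simp only [hI]
      rw [hset q hq, Measure.restrict_eq_zero.2 h0, integral_zero_measure])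
    (fun q hq q' hq' hF => by
      simp only [hI]
      rw [hF, hset q hq]
      refine integral_congr_ae ?_
      filter_upwards [𝒯.trace_ae_eq hd hG hq hq' hF] with x hx
      rw [hx])
  rw [← 𝒯.sum_sides fun s a => ∫ x in cell (facet s a) \ frontier Ω, (trace s v x).ofLp ⬝ᵥ
        (cellStress s ν u p x *ᵥ (outwardNormal s a).ofLp) ∂(surf d),
    ← 𝒯.sum_sides fun s a => ∫ x in cell (facet s a) \ frontier Ω, (trace s v x).ofLp ⬝ᵥ
        ((1 / 2 : ℝ) • jump 𝒯 ν u p (facet s a) x) ∂(surf d)]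
  have h2 : ∑ q ∈ 𝒯.sides, I q q = 1 / 2 * ∑ q ∈ 𝒯.sides, ∑ q' ∈ 𝒯.sides,
      if facet q'.1 q'.2 = facet q.1 q.2 then I q q' else 0 := by rw [h]; ring
  rw [show ∑ q ∈ 𝒯.sides, ∫ x in cell (facet q.1 q.2) \ frontier Ω, (trace q.1 v x).ofLp ⬝ᵥ
        (cellStress q.1 ν u p x *ᵥ (outwardNormal q.1 q.2).ofLp) ∂(surf d) =
        ∑ q ∈ 𝒯.sides, I q q from rfl, h2, Finset.mul_sum]
  refine Finset.sum_congr rfl fun q hq => ?_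
  obtain ⟨hq1, hq2⟩ := 𝒯.mem_sides.1 hq
  simp only [jump_eq_sum_sides, dotProduct_smul, dotProduct_sum, smul_eq_mul]
  rw [integral_const_mul, integral_finsetSum]
  · congr 1
    refine Finset.sum_congr rfl fun q' hq' => ?_
    by_cases hF : facet q'.1 q'.2 = facet q.1 q.2
    · simp only [if_pos hF]; rfl
    · simp [if_neg hF]
  · intro q' hq'
    by_cases hF : facet q'.1 q'.2 = facet q.1 q.2
    · simp only [if_pos hF]
      refine IntegrableOn.mono_set (t := cell (facet q.1 q.2))
        (𝒯.integrable_trace_dotProduct hd hG hq1 hq2 fun i => ?_) sdiff_subset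
      rw [← hF]
      exact 𝒯.extendsSmoothly_normalStress hu hp ν (𝒯.mem_sides.1 hq').1 _ i
    · simp [if_neg hF]

lemma integral_facet_split {ΓD ΓN : Set (Sp d)} (hΓ : ΓD ∪ ΓN = frontier Ω) (hdisj : Disjoint ΓD ΓN)
    (hΓD : MeasurableSet ΓD) {K : Set (Sp d)} {μ : Measure (Sp d)}
    (hK : MeasurableSet K) {g : Sp d → ℝ} (hg : IntegrableOn g K μ) :
    ∫ x in K, g x ∂μ = ∫ x in K \ frontier Ω, g x ∂μ + ∫ x in K ∩ ΓN, g x ∂μ +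
      ∫ x in K ∩ ΓD, g x ∂μ := by
  have h1 := integral_inter_add_sdiff (μ := μ) (f := g) (s := K) (t := frontier Ω)
    isClosed_frontier.measurableSet hg
  have h2 : K ∩ frontier Ω = (K ∩ ΓN) ∪ (K ∩ ΓD) := by
    rw [← inter_union_distrib_left, union_comm, hΓ]
  rw [h2, setIntegral_union ((hdisj.symm.mono inter_subset_right inter_subset_right))
    (hK.inter hΓD) (hg.mono_set inter_subset_left) (hg.mono_set inter_subset_left)] at h1
  linarith

end Triangulation

/-- The first summand is the flux in the boundary term of the form `a`; the second is what remains
on `Γ_N` and gives `eta3`. -/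
lemma cellStress_mulVec (s : Finset (Sp d)) (ν : ℝ) (u : Sp d → Sp d) (p : Sp d → ℝ) (x : Sp d)
    (n : Fin d → ℝ) : cellStress s ν u p x *ᵥ n =
      (ν • ((cellGrad s u x)ᵀ *ᵥ n) - p x • n) + ν • (cellGrad s u x *ᵥ n) := by
  rw [cellStress, stress, symGrad, smul_smul, Matrix.sub_mulVec, Matrix.smul_mulVec,
    Matrix.smul_mulVec, Matrix.one_mulVec, Matrix.add_mulVec, smul_add]
  rw [show 2 * ν * (1 / 2) = ν by ring]
  abel

/-- Integration by parts on the whole domain. -/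
lemma sum_integral_frob {Ω : Set (Sp d)} (𝒯 : Triangulation Ω) (hd : 0 < d)
    {ΓD ΓN : Set (Sp d)} (hΓ : ΓD ∪ ΓN = frontier Ω) (hdisj : Disjoint ΓD ΓN)
    (hΓD : MeasurableSet ΓD) (ν : ℝ)
    {u : ℝ → Sp d → Sp d} {p : ℝ → Sp d → ℝ} {v : ℝ → Sp d → Sp d} {t : ℝ}
    {G : Sp d → (Sp d →L[ℝ] Sp d)} (hG : HasWeakDerivL2 Ω (v t) G)
    (hu : ∀ s ∈ 𝒯.cells, ExtendsSmoothly (cell s) (u t))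
    (hp : ∀ s ∈ 𝒯.cells, ExtendsSmoothly (cell s) (p t))
    (hD : ∀ s ∈ 𝒯.cells, ∀ᵐ x ∂((surf d).restrict (frontier (cell s) ∩ ΓD)), trace s (v t) x = 0) :
    ∑ s ∈ 𝒯.cells, ∫ x in cell s, frob (symGrad (jac (G x))) (cellStress s ν (u t) (p t) x) =
      neumannTerm 𝒯 ΓN ν (u t) (p t) (v t) + ∑ s ∈ 𝒯.cells,
        (-(∫ x in cell s, (v t x).ofLp ⬝ᵥ cellDivStress s ν (u t) (p t) x) +
          eta2 𝒯 s ν u p v t + eta3 s ΓN ν u v t) := by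
  have h1 : ∀ s ∈ 𝒯.cells, ∫ x in cell s, frob (symGrad (jac (G x))) (cellStress s ν (u t) (p t) x) =
      -(∫ x in cell s, (v t x).ofLp ⬝ᵥ cellDivStress s ν (u t) (p t) x) +
      (∑ a ∈ s, ∫ x in cell (facet s a) \ frontier Ω, (trace s (v t) x).ofLp ⬝ᵥ
        (cellStress s ν (u t) (p t) x *ᵥ (outwardNormal s a).ofLp) ∂(surf d)) +
      ((∑ a ∈ s, ∫ x in cell (facet s a) ∩ ΓN, (trace s (v t) x).ofLp ⬝ᵥ
        (ν • ((cellGrad s (u t) x)ᵀ *ᵥ (outwardNormal s a).ofLp) -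
          p t x • (outwardNormal s a).ofLp) ∂(surf d)) + eta3 s ΓN ν u v t) := by
    intro s hs
    have hsS := 𝒯.isSimplex hs
    rw [(𝒯.isTrace hd hG hs).integral_frob hsS hd (𝒯.hasWeakDerivL2_cell hG hs) (hu s hs) (hp s hs) ν,
      eta3, ← Finset.sum_add_distrib, add_assoc, ← Finset.sum_add_distrib]
    congr 1
    refine Finset.sum_congr rfl fun a ha => ?_
    have hsub := cell_mono (facet_subset s a)
    rw [Triangulation.integral_facet_split hΓ hdisj hΓD (isClosed_cell _).measurableSet
      (𝒯.integrable_trace_dotProduct hd hG hs ha fun i =>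
        𝒯.extendsSmoothly_normalStress hu hp ν hs a i), ← integral_add]
    · have h0 : ∫ x in cell (facet s a) ∩ ΓD, (trace s (v t) x).ofLp ⬝ᵥ
          (cellStress s ν (u t) (p t) x *ᵥ (outwardNormal s a).ofLp) ∂(surf d) = 0 := by
        refine integral_eq_zero_of_ae ?_
        filter_upwards [ae_restrict_of_ae_restrict_of_subset
          (inter_subset_inter_left _ (hsS.facet_subset_frontier hd ha)) (hD s hs)] with x hx
        rw [hx]; simp
      rw [h0, add_zero]
      congr 1
      refine integral_congr_ae (ae_of_all _ fun x => ?_)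
      beta_reduce
      rw [cellStress_mulVec, dotProduct_add]
    · refine IntegrableOn.mono_set (t := cell (facet s a))
        (𝒯.integrable_trace_dotProduct hd hG hs ha fun i => ?_) inter_subset_left
      have e1 := ((ExtendsSmoothly.mulVec (A := fun x => (cellGrad s (u t) x)ᵀ)
        (b := fun _ => (outwardNormal s a).ofLp)
        (fun i j => (hu s hs).cellGrad hsS j i) (fun i => extendsSmoothly_const _ _) i).mono hsub)
      have e2 := (hp s hs).mono hsub
      exact .of_isSeparated ((e1.isSeparated.const_mul ν).sub
        (e2.isSeparated.mul (isSeparated_const _ (outwardNormal s a i))))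
    · refine IntegrableOn.mono_set (t := cell (facet s a))
        (𝒯.integrable_trace_dotProduct hd hG hs ha fun i => ?_) inter_subset_left
      have e1 := ((ExtendsSmoothly.mulVec (A := fun x => cellGrad s (u t) x)
        (b := fun _ => (outwardNormal s a).ofLp)
        (fun i j => (hu s hs).cellGrad hsS i j) (fun i => extendsSmoothly_const _ _) i).mono hsub)
      exact .of_isSeparated (e1.isSeparated.const_mul ν)
  rw [Finset.sum_congr rfl h1]
  simp only [Finset.sum_add_distrib]
  rw [𝒯.sum_integral_normalStress_interior hd hG hu hp ν]
  simp only [neumannTerm, eta2]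
  ring

/-- The residual at a fixed time is the sum of the signed cell indicators. -/
lemma formIntegrand_sub_loadIntegrand {Ω : Set (Sp d)} (𝒯 : Triangulation Ω) (hd : 0 < d)
    {ΓD ΓN : Set (Sp d)} (hΓ : ΓD ∪ ΓN = frontier Ω) (hdisj : Disjoint ΓD ΓN)
    (hΓD : MeasurableSet ΓD) (ν : ℝ) {f : ℝ → Sp d → Sp d}
    {u : ℝ → Sp d → Sp d} {p : ℝ → Sp d → ℝ} {w : (ℝ → Sp d → Sp d) × (ℝ → Sp d → ℝ)} {t : ℝ}
    {G : Sp d → (Sp d →L[ℝ] Sp d)} (hG : HasWeakDerivL2 Ω (w.1 t) G)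
    (hq : MemLp (w.2 t) 2 (volume.restrict Ω)) (hf : MemLp (f t) 2 (volume.restrict Ω))
    (hu : ∀ s ∈ 𝒯.cells, ExtendsSmoothly (cell s) (u t))
    (hdu : ∀ s ∈ 𝒯.cells, ExtendsSmoothly (cell s) (timeDeriv u t))
    (hp : ∀ s ∈ 𝒯.cells, ExtendsSmoothly (cell s) (p t))
    (hD : ∀ s ∈ 𝒯.cells, ∀ᵐ x ∂((surf d).restrict (frontier (cell s) ∩ ΓD)),
      trace s (w.1 t) x = 0) :
    formIntegrand 𝒯 ΓN ν u p w t - loadIntegrand Ω f w t = ∑ s ∈ 𝒯.cells,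
      (eta1 s ν f u p w.1 t + eta2 𝒯 s ν u p w.1 t + eta3 s ΓN ν u w.1 t + eta4 s u w.2 t) := by
  have hv : ∀ s ∈ 𝒯.cells, MemLp (w.1 t) 2 (volume.restrict (cell s)) := fun s hs =>
    hG.1.mono_measure (𝒯.restrict_cell_le hs)
  have hfs : ∀ s ∈ 𝒯.cells, MemLp (f t) 2 (volume.restrict (cell s)) := fun s hs =>
    hf.mono_measure (𝒯.restrict_cell_le hs)
  have hmem : ∀ {s} {g : Sp d → ℝ}, ExtendsSmoothly (cell s) g →
      MemLp g 2 ((volume : Measure (Sp d)).restrict (cell s)) := fun h => h.memLp (isCompact_cell _) _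
  have hconv : ∀ s ∈ 𝒯.cells, ∀ i, MemLp (fun x =>
      ((timeDeriv u t x).ofLp + cellGrad s (u t) x *ᵥ (u t x).ofLp) i) 2
      (volume.restrict (cell s)) := fun s hs i =>
    (hmem ((hdu s hs).coord i)).add (hmem (ExtendsSmoothly.mulVec
      (fun i j => (hu s hs).cellGrad (𝒯.isSimplex hs) i j) (fun i => (hu s hs).coord i) i))
  have hdivm : ∀ s ∈ 𝒯.cells, ∀ i, MemLp (fun x => cellDivStress s ν (u t) (p t) x i) 2
      (volume.restrict (cell s)) := fun s hs i =>
    hmem ((hu s hs).cellDivStress (𝒯.isSimplex hs) (hp s hs) ν i)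
  have hfI : ∀ s ∈ 𝒯.cells, IntegrableOn (fun x => (w.1 t x).ofLp ⬝ᵥ (f t x).ofLp) (cell s) :=
    fun s hs => integrable_dotProduct (hv s hs) fun i => MemLp.coord (hfs s hs) i
  have hcI : ∀ s ∈ 𝒯.cells, IntegrableOn (fun x => (w.1 t x).ofLp ⬝ᵥ
      ((timeDeriv u t x).ofLp + cellGrad s (u t) x *ᵥ (u t x).ofLp)) (cell s) :=
    fun s hs => integrable_dotProduct (hv s hs) (hconv s hs)
  have hdI : ∀ s ∈ 𝒯.cells, IntegrableOn (fun x => (w.1 t x).ofLp ⬝ᵥ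
      cellDivStress s ν (u t) (p t) x) (cell s) :=
    fun s hs => integrable_dotProduct (hv s hs) (hdivm s hs)
  have h1 : ∫ x in Ω, (w.1 t x).ofLp ⬝ᵥ
      ((timeDeriv u t x).ofLp + jac (weakDeriv Ω (u t) x) *ᵥ (u t x).ofLp) =
      ∑ s ∈ 𝒯.cells, ∫ x in cell s, (w.1 t x).ofLp ⬝ᵥ
        ((timeDeriv u t x).ofLp + cellGrad s (u t) x *ᵥ (u t x).ofLp) := by
    refine 𝒯.integral_eq_sum_of_ae (fun s hs => ?_) hcI
    filter_upwards [𝒯.weakDeriv_eq_cellGrad hd hu hs] with x hx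
    rw [hx]
  have h2 : ∫ x in Ω, frob (symGrad (jac (weakDeriv Ω (w.1 t) x)))
      (stress ν (jac (weakDeriv Ω (u t) x)) (p t x)) =
      ∑ s ∈ 𝒯.cells, ∫ x in cell s, frob (symGrad (jac (G x))) (cellStress s ν (u t) (p t) x) := by
    refine 𝒯.integral_eq_sum_of_ae (fun s hs => ?_) fun s hs => ?_
    · filter_upwards [𝒯.weakDeriv_eq_cellGrad hd hu hs,
        ae_mono (𝒯.restrict_cell_le hs) (hG.weakDeriv_ae_eq 𝒯.isOpen)] with x hx hx'
      rw [hx, hx', cellStress]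
    · have hGs := (hG.2.1.mono_measure (𝒯.restrict_cell_le hs))
      simp only [fun x => frob_symGrad (A := jac (G x)) (cellStress_symm s ν (u t) (p t) x)]
      refine integrable_finsetSum _ fun i _ => integrable_finsetSum _ fun j _ => ?_
      exact (MemLp.coord (memLp_clm_apply hGs aestronglyMeasurable_const
        (ae_of_all _ fun _ => le_rfl)) i).integrable_mul
        (hmem ((hu s hs).cellStress (𝒯.isSimplex hs) (hp s hs) ν i j))
  have h3 : ∫ x in Ω, w.2 t x * (jac (weakDeriv Ω (u t) x)).trace =
      ∑ s ∈ 𝒯.cells, eta4 s u w.2 t := by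
    refine 𝒯.integral_eq_sum_of_ae (g' := fun s x => w.2 t x * (cellGrad s (u t) x).trace)
      (fun s hs => ?_) fun s hs => ?_
    · filter_upwards [𝒯.weakDeriv_eq_cellGrad hd hu hs] with x hx
      rw [hx]
    · have htr : MemLp (fun x => (cellGrad s (u t) x).trace) 2 (volume.restrict (cell s)) :=
        memLp_finsetSum _ fun i _ => hmem ((hu s hs).cellGrad (𝒯.isSimplex hs) i i)
      exact (hq.mono_measure (𝒯.restrict_cell_le hs)).integrable_mul htr
  have h4 : loadIntegrand Ω f w t =
      ∑ s ∈ 𝒯.cells, ∫ x in cell s, (w.1 t x).ofLp ⬝ᵥ (f t x).ofLp := 𝒯.integral_eq_sum hfI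
  have h5 : ∀ s ∈ 𝒯.cells, eta1 s ν f u p w.1 t = (∫ x in cell s, (w.1 t x).ofLp ⬝ᵥ
      ((timeDeriv u t x).ofLp + cellGrad s (u t) x *ᵥ (u t x).ofLp)) -
      (∫ x in cell s, (w.1 t x).ofLp ⬝ᵥ cellDivStress s ν (u t) (p t) x) -
      ∫ x in cell s, (w.1 t x).ofLp ⬝ᵥ (f t x).ofLp := by
    intro s hs
    simp only [eta1, dotProduct_sub]
    rw [integral_sub ?_ (hfI s hs), integral_sub (hcI s hs) (hdI s hs)]
    exact (hcI s hs).sub (hdI s hs)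
  -- The Neumann term produced by integration by parts cancels the one subtracted in the form.
  rw [formIntegrand, h1, h2, h3, h4, sum_integral_frob 𝒯 hd hΓ hdisj hΓD ν hG hu hp hD]
  simp only [Finset.sum_add_distrib, Finset.sum_congr rfl h5, Finset.sum_sub_distrib,
    Finset.sum_neg_distrib]
  ring

end NavierStokesFEM

namespace NavierStokesFEM

variable {d : ℕ}

/-! ### Space-time test functions -/

/-- Fubini for the integrable squared norm: space-time square integrability passes to almost every
time slice. -/
lemma ae_memLp_section {α β F : Type*} [MeasurableSpace α] [MeasurableSpace β]
    [NormedAddCommGroup F] {μ : Measure α} {ν : Measure β} [SFinite μ] [SFinite ν] {f : α × β → F}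
    (hf : MemLp f 2 (μ.prod ν)) : ∀ᵐ t ∂μ, MemLp (fun x => f (t, x)) 2 ν := by
  have h1 := (memLp_two_iff_integrable_sq_norm hf.1).1 hf
  filter_upwards [hf.1.prodMk_left, h1.prod_right_ae] with t h2 h3
  exact (memLp_two_iff_integrable_sq_norm h2).2 h3

/-- The measure on the product of `(0, T)` and a cell. -/
noncomputable def cellCylinder (T : ℝ) (s : Finset (Sp d)) : Measure (ℝ × Sp d) :=
  (volume.restrict (Ioc 0 T)).prod (volume.restrict (cell s))

instance (T : ℝ) (s : Finset (Sp d)) : IsFiniteMeasure (cellCylinder T s) := by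
  unfold cellCylinder; infer_instance

lemma Triangulation.cellCylinder_le {Ω : Set (Sp d)} (𝒯 : Triangulation Ω) (T : ℝ)
    {s : Finset (Sp d)} (hs : s ∈ 𝒯.cells) : cellCylinder T s ≤ cylinder T Ω :=
  Measure.prod_mono le_rfl (𝒯.restrict_cell_le hs)

section TestPair

variable {Ω : Set (Sp d)} {𝒯 : Triangulation Ω} {ΓD : Set (Sp d)} {T : ℝ}
  {w w' : (ℝ → Sp d → Sp d) × (ℝ → Sp d → ℝ)}

lemma IsTestPair.exists_hasWeakDerivL2 (hw : IsTestPair 𝒯 ΓD T w) :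
    ∃ G : ℝ → Sp d → (Sp d →L[ℝ] Sp d),
      MemLp (fun a : ℝ × Sp d => G a.1 a.2) 2 (cylinder T Ω) ∧
      ∀ᵐ t ∂(volume.restrict (Ioc 0 T)), HasWeakDerivL2 Ω (w.1 t) (G t) := by
  obtain ⟨G, hG, h⟩ := hw.gradient
  refine ⟨G, hG, ?_⟩
  filter_upwards [h, ae_memLp_section hG, ae_memLp_section hw.velocity] with t h1 h2 h3
  exact ⟨h3, h2, h1⟩

/-- The difference of two test pairs is a test pair. -/
lemma IsTestPair.sub (hd : 0 < d) (hw : IsTestPair 𝒯 ΓD T w) (hw' : IsTestPair 𝒯 ΓD T w') :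
    IsTestPair 𝒯 ΓD T (w - w') := by
  obtain ⟨G, hG, h⟩ := hw.exists_hasWeakDerivL2
  obtain ⟨G', hG', h'⟩ := hw'.exists_hasWeakDerivL2
  refine ⟨hw.velocity.sub hw'.velocity, ⟨fun t => G t - G' t, hG.sub hG', ?_⟩, ?_,
    hw.pressure.sub hw'.pressure⟩
  · filter_upwards [h, h'] with t h1 h2
    exact (h1.sub h2).2.2
  · filter_upwards [h, h', hw.dirichlet, hw'.dirichlet] with t h1 h2 h3 h4 s hs
    have hsS := 𝒯.isSimplex hs
    -- Each trace is a separate choice, so additivity holds only almost everywhere on each facet.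
    have key : ∀ᵐ x ∂((surf d).restrict (frontier (cell s))), trace s ((w - w').1 t) x =
        trace s (w.1 t) x - trace s (w'.1 t) x := by
      rw [hsS.frontier_cell hd, ae_restrict_biUnion_finset_iff]
      intro a ha
      exact IsTrace.sub_ae_eq hsS hd (𝒯.hasWeakDerivL2_cell h1 hs) (𝒯.hasWeakDerivL2_cell h2 hs)
        (𝒯.isTrace hd h1 hs) (𝒯.isTrace hd h2 hs) (𝒯.isTrace hd (h1.sub h2) hs) ha
    filter_upwards [ae_restrict_of_ae_restrict_of_subset inter_subset_left key, h3 s hs,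
      h4 s hs] with x e1 e2 e3
    rw [e1, e2, e3, sub_zero]

end TestPair

/-! ### Integrability in time -/

section Integrability

variable {T : ℝ} {s : Finset (Sp d)}

/-- `g` agrees, on `(0, T) × cell s`, with a square integrable function. -/
def IsSquareIntegrable (T : ℝ) (s : Finset (Sp d)) (g : ℝ → Sp d → ℝ) : Prop :=
  ∃ h : ℝ × Sp d → ℝ, MemLp h 2 (cellCylinder T s) ∧
    ∀ᵐ t ∂(volume.restrict (Ioc 0 T)), ∀ x ∈ cell s, g t x = h (t, x)

lemma IsSeparated.isSquareIntegrable {g : ℝ → Sp d → ℝ} (h : IsSeparated T (cell s) g) :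
    IsSquareIntegrable T s g := by
  obtain ⟨g', hm, ⟨B, hB⟩, h⟩ := h.exists_bounded (isCompact_cell s)
  exact ⟨g', MemLp.of_bound hm.aestronglyMeasurable B (ae_of_all _ hB), h⟩

lemma IsSquareIntegrable.sub {g g' : ℝ → Sp d → ℝ} (h : IsSquareIntegrable T s g)
    (h' : IsSquareIntegrable T s g') : IsSquareIntegrable T s fun t x => g t x - g' t x := by
  obtain ⟨k, hk, h⟩ := h
  obtain ⟨k', hk', h'⟩ := h'
  refine ⟨fun a => k a - k' a, hk.sub hk', ?_⟩
  filter_upwards [h, h'] with t h1 h2 x hx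
  rw [h1 x hx, h2 x hx]

lemma integrable_integral_mul {v : ℝ → Sp d → ℝ} {g : ℝ → Sp d → ℝ}
    (hv : MemLp (fun a : ℝ × Sp d => v a.1 a.2) 2 (cellCylinder T s))
    (hg : IsSquareIntegrable T s g) :
    Integrable (fun t => ∫ x in cell s, v t x * g t x) (volume.restrict (Ioc 0 T)) := by
  obtain ⟨h, hh, hg⟩ := hg
  have h1 : Integrable (fun a : ℝ × Sp d => v a.1 a.2 * h a) (cellCylinder T s) :=
    hv.integrable_mul hh
  refine h1.integral_prod_left.congr ?_
  filter_upwards [hg] with t ht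
  refine setIntegral_congr_fun (isClosed_cell s).measurableSet fun x hx => ?_
  simp only [ht x hx]

lemma integrable_integral_dotProduct {v : ℝ → Sp d → Sp d} {g : ℝ → Sp d → Fin d → ℝ}
    (hv : MemLp (fun a : ℝ × Sp d => v a.1 a.2) 2 (cellCylinder T s))
    (hg : ∀ i, IsSquareIntegrable T s fun t x => g t x i) :
    Integrable (fun t => ∫ x in cell s, (v t x).ofLp ⬝ᵥ g t x) (volume.restrict (Ioc 0 T)) := by
  choose h hh hg using hg
  have h1 : Integrable (fun a : ℝ × Sp d => (v a.1 a.2).ofLp ⬝ᵥ fun i => h i a)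
      (cellCylinder T s) := integrable_dotProduct hv hh
  refine h1.integral_prod_left.congr ?_
  filter_upwards [ae_all_iff.2 hg] with t ht
  refine setIntegral_congr_fun (isClosed_cell s).measurableSet fun x hx => ?_
  simp only [dotProduct, ht _ x hx]

/-- Boundary integrals of traces against separated fields are integrable in time. -/
lemma integrable_integral_trace (hs : IsSimplex s) (hd : 0 < d) {a : Sp d} (ha : a ∈ s)
    {A : Set (Sp d)} (hA : MeasurableSet A) {v : ℝ → Sp d → Sp d} {G : ℝ → Sp d → (Sp d →L[ℝ] Sp d)}
    (hv : MemLp (fun a : ℝ × Sp d => v a.1 a.2) 2 (cellCylinder T s))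
    (hG : MemLp (fun a : ℝ × Sp d => G a.1 a.2) 2 (cellCylinder T s))
    (hvG : ∀ᵐ t ∂(volume.restrict (Ioc 0 T)), HasWeakDerivL2 (interior (cell s)) (v t) (G t))
    {g : ℝ → Sp d → Fin d → ℝ} (hg : ∀ i, IsSeparated T (cell (facet s a)) fun t x => g t x i) :
    Integrable (fun t => ∫ x in cell (facet s a) ∩ A, (trace s (v t) x).ofLp ⬝ᵥ g t x ∂(surf d))
      (volume.restrict (Ioc 0 T)) := by
  have hfin := hs.isFiniteMeasure_surf_facet hd ha
  choose k hkm hB hk using fun i => (hg i).exists_bounded (isCompact_cell _)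
  choose B hB using hB
  -- The restriction to `A` is absorbed into the bounded, jointly measurable weight.
  set k' : Fin d → ℝ × Sp d → ℝ := fun i b => A.indicator (fun _ => (1 : ℝ)) b.2 * k i b with hk'
  have hk'm : ∀ i, Measurable (k' i) := fun i =>
    ((measurable_const.indicator hA).comp measurable_snd).mul (hkm i)
  have hk'B : ∀ i b, |k' i b| ≤ B i := by
    intro i b
    have := hB i b
    by_cases hb : b.2 ∈ A
    · simpa [hk', indicator_of_mem hb] using this
    · simpa [hk', indicator_of_notMem hb] using (abs_nonneg _).trans this
  obtain ⟨D, -, hD⟩ := exists_cell_bound s a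
  have hw : ∀ᵐ b ∂(cellCylinder T s), ‖b.2 - a‖ ≤ D := by
    have h1 : ∀ᵐ b ∂(cellCylinder T s), b.2 ∈ cell s :=
      Measure.quasiMeasurePreserving_snd.ae (ae_restrict_mem (isClosed_cell s).measurableSet)
    exact h1.mono fun b hb => hD _ hb
  -- The trace is chosen separately at each time, so its joint measurability is not available. The
  -- radial identity replaces the facet integral by a volume integral of `v` and `G`, to which
  -- Fubini applies.
  have hint : ∀ i, Integrable (fun t => ‖outwardVector s a‖⁻¹ * ∫ x in cell s,
      (d * v t x i + G t x (x - a) i) * k' i (t, centralProj s a x))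
      (volume.restrict (Ioc 0 T)) := by
    intro i
    have h1 : MemLp (fun b : ℝ × Sp d => d * v b.1 b.2 i + G b.1 b.2 (b.2 - a) i) 2
        (cellCylinder T s) :=
      ((MemLp.coord hv i).const_mul (d : ℝ)).add (MemLp.coord (memLp_clm_apply
        (w := fun b : ℝ × Sp d => b.2 - a) hG
        (measurable_snd.sub_const a).aestronglyMeasurable hw) i)
    have h2 : Integrable (fun b : ℝ × Sp d => (d * v b.1 b.2 i + G b.1 b.2 (b.2 - a) i) *
        k' i (b.1, centralProj s a b.2)) (cellCylinder T s) :=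
      (h1.integrable one_le_two).mul_bdd ((hk'm i).comp (measurable_fst.prodMk
        ((measurable_centralProj s a).comp measurable_snd))).aestronglyMeasurable
        (ae_of_all _ fun b => hk'B i _)
    exact h2.integral_prod_left.const_mul _
  refine (integrable_finsetSum Finset.univ fun i _ => hint i).congr ?_
  filter_upwards [hvG, ae_all_iff.2 hk] with t ht hkt
  have htr := isTrace_trace hs hd ⟨G t, ht⟩
  have hrad : ∀ i, ‖outwardVector s a‖⁻¹ * ∫ x in cell s,
      (d * v t x i + G t x (x - a) i) * k' i (t, centralProj s a x) =
      ∫ x in cell (facet s a), trace s (v t) x i * k' i (t, x) ∂(surf d) := by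
    intro i
    rw [htr.integral_radial hs hd ht ha (g := fun x => k' i (t, x))
      ((hk'm i).comp measurable_prodMk_left) (fun x => hk'B i _) i,
      inv_mul_cancel_left₀ (hs.norm_outwardVector_pos hd ha).ne']
  simp only [hrad]
  rw [← integral_finsetSum]
  · rw [← setIntegral_indicator hA]
    refine setIntegral_congr_fun (isClosed_cell _).measurableSet fun x hx => ?_
    by_cases hxA : x ∈ A
    · simp only [indicator_of_mem hxA, hk', one_mul, dotProduct, hkt _ x hx]
    · simp [indicator_of_notMem hxA, hk']
  · intro i _
    exact ((MemLp.coord (htr.memLp_facet hs hd ha) i).integrable one_le_two).mul_bdd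
      ((hk'm i).comp measurable_prodMk_left).aestronglyMeasurable (ae_of_all _ fun x => hk'B i _)

end Integrability

end NavierStokesFEM

namespace NavierStokesFEM

variable {d : ℕ}

/-! ### Integrability of the error indicators -/

section Indicators

variable {Ω : Set (Sp d)} {𝒯 : Triangulation Ω} {ΓD ΓN : Set (Sp d)} {T ν : ℝ}
  {f : ℝ → Sp d → Sp d} {u : ℝ → Sp d → Sp d} {p : ℝ → Sp d → ℝ}
  {w : (ℝ → Sp d → Sp d) × (ℝ → Sp d → ℝ)} {s : Finset (Sp d)}

lemma integrable_eta1 (hs : s ∈ 𝒯.cells) (hw : IsTestPair 𝒯 ΓD T w)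
    (hf : MemLp (fun a : ℝ × Sp d => f a.1 a.2) 2 (cylinder T Ω))
    (hu : IsSeparated T (cell s) u) (hdu : IsSeparated T (cell s) (timeDeriv u))
    (hp : IsSeparated T (cell s) p) :
    Integrable (eta1 s ν f u p w.1) (volume.restrict (Ioc 0 T)) := by
  have hsS := 𝒯.isSimplex hs
  refine integrable_integral_dotProduct (hw.velocity.mono_measure (𝒯.cellCylinder_le T hs))
    fun i => IsSquareIntegrable.sub (IsSeparated.isSquareIntegrable ?_)
      ⟨_, MemLp.coord (hf.mono_measure (𝒯.cellCylinder_le T hs)) i, ae_of_all _ fun t x _ => rfl⟩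
  exact ((hdu.coord i).add (IsSeparated.mulVec (fun i j => hu.cellGrad hsS i j)
    (fun i => hu.coord i) i)).sub (hu.cellDivStress hsS hp ν i)

lemma integrable_eta4 (hs : s ∈ 𝒯.cells) (hw : IsTestPair 𝒯 ΓD T w)
    (hu : IsSeparated T (cell s) u) :
    Integrable (eta4 s u w.2) (volume.restrict (Ioc 0 T)) :=
  integrable_integral_mul (hw.pressure.mono_measure (𝒯.cellCylinder_le T hs))
    (IsSeparated.sum Finset.univ fun i _ => hu.cellGrad (𝒯.isSimplex hs) i i).isSquareIntegrable

lemma IsTestPair.integrable_integral_trace (hd : 0 < d) (hs : s ∈ 𝒯.cells)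
    (hw : IsTestPair 𝒯 ΓD T w) {a : Sp d} (ha : a ∈ s) {A : Set (Sp d)} (hA : MeasurableSet A)
    {g : ℝ → Sp d → Fin d → ℝ} (hg : ∀ i, IsSeparated T (cell (facet s a)) fun t x => g t x i) :
    Integrable (fun t => ∫ x in cell (facet s a) ∩ A, (trace s (w.1 t) x).ofLp ⬝ᵥ g t x ∂(surf d))
      (volume.restrict (Ioc 0 T)) := by
  obtain ⟨G, hG, h⟩ := hw.exists_hasWeakDerivL2
  exact NavierStokesFEM.integrable_integral_trace (𝒯.isSimplex hs) hd ha hA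
    (hw.velocity.mono_measure (𝒯.cellCylinder_le T hs)) (hG.mono_measure (𝒯.cellCylinder_le T hs))
    (h.mono fun t ht => 𝒯.hasWeakDerivL2_cell ht hs) hg

lemma integrable_eta2 (hd : 0 < d) (hs : s ∈ 𝒯.cells) (hw : IsTestPair 𝒯 ΓD T w)
    (hu : ∀ s ∈ 𝒯.cells, IsSeparated T (cell s) u) (hp : ∀ s ∈ 𝒯.cells, IsSeparated T (cell s) p) :
    Integrable (eta2 𝒯 s ν u p w.1) (volume.restrict (Ioc 0 T)) := by
  classical
  -- Removing the boundary of the domain is intersecting with its measurable complement.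
  refine integrable_finsetSum _ fun a ha => hw.integrable_integral_trace hd hs ha
    isClosed_frontier.measurableSet.compl fun i => ?_
  simp only [Pi.smul_apply, smul_eq_mul, 𝒯.jump_eq_sum_sides, Finset.sum_apply]
  refine (IsSeparated.sum _ fun q hq => ?_).const_mul _
  have hq1 := (𝒯.mem_sides.1 hq).1
  by_cases hF : facet q.1 q.2 = facet s a
  · simp only [← hF]
    exact (IsSeparated.mulVec (b := fun _ _ => (outwardNormal q.1 q.2).ofLp)
      (fun i j => (hu _ hq1).cellStress (𝒯.isSimplex hq1) (hp _ hq1) ν i j)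
      (fun i => isSeparated_const _ _) i).mono (cell_mono (facet_subset _ _))
  · simp only [if_neg hF]
    exact IsSeparated.zero

lemma integrable_eta3 (hd : 0 < d) (hs : s ∈ 𝒯.cells) (hw : IsTestPair 𝒯 ΓD T w)
    (hΓN : MeasurableSet ΓN) (hu : IsSeparated T (cell s) u) :
    Integrable (eta3 s ΓN ν u w.1) (volume.restrict (Ioc 0 T)) := by
  refine integrable_finsetSum _ fun a ha => hw.integrable_integral_trace hd hs ha hΓN fun i => ?_
  exact ((IsSeparated.mulVec (b := fun _ _ => (outwardNormal s a).ofLp)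
      (fun i j => hu.cellGrad (𝒯.isSimplex hs) i j)
      (fun i => isSeparated_const _ _) i).const_mul ν).mono (cell_mono (facet_subset _ _))

lemma integrable_loadIntegrand (hw : IsTestPair 𝒯 ΓD T w)
    (hf : MemLp (fun a : ℝ × Sp d => f a.1 a.2) 2 (cylinder T Ω)) :
    Integrable (loadIntegrand Ω f w) (volume.restrict (Ioc 0 T)) :=
  have h : Integrable (fun a : ℝ × Sp d => (w.1 a.1 a.2).ofLp ⬝ᵥ (f a.1 a.2).ofLp) (cylinder T Ω) :=
    integrable_dotProduct hw.velocity fun i => MemLp.coord hf i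
  h.integral_prod_left

/-- Error representation and estimate for an arbitrary test pair. -/
lemma weakResidual_estimate (hd : 0 < d) (hΓ : ΓD ∪ ΓN = frontier Ω) (hdisj : Disjoint ΓD ΓN)
    (hΓD : MeasurableSet ΓD) (hΓN : MeasurableSet ΓN) (hT : 0 < T)
    (hf : MemLp (fun a : ℝ × Sp d => f a.1 a.2) 2 (cylinder T Ω)) (hw : IsTestPair 𝒯 ΓD T w)
    (hu : ∀ s ∈ 𝒯.cells, IsSeparated T (cell s) u)
    (hdu : ∀ s ∈ 𝒯.cells, IsSeparated T (cell s) (timeDeriv u))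
    (hp : ∀ s ∈ 𝒯.cells, IsSeparated T (cell s) p) :
    IntervalIntegrable (loadIntegrand Ω f w) volume 0 T ∧
    IntervalIntegrable (formIntegrand 𝒯 ΓN ν u p w) volume 0 T ∧
    (∀ s ∈ 𝒯.cells, IntervalIntegrable (etaCell 𝒯 ΓN ν f u p w s) volume 0 T) ∧
    |weakResidual 𝒯 ΓN T ν f u p w| ≤ spaceEstimate 𝒯 ΓN T ν f u p w := by
  have h1 := fun s hs => integrable_eta1 (ν := ν) hs hw hf (hu s hs) (hdu s hs) (hp s hs)
  have h2 := fun s hs => integrable_eta2 (s := s) (ν := ν) hd hs hw hu hp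
  have h3 := fun s hs => integrable_eta3 (ν := ν) hd hs hw hΓN (hu s hs)
  have h4 := fun s hs => integrable_eta4 hs hw (hu s hs)
  have hL := integrable_loadIntegrand hw hf
  set R : ℝ → ℝ := fun t => ∑ s ∈ 𝒯.cells,
    (eta1 s ν f u p w.1 t + eta2 𝒯 s ν u p w.1 t + eta3 s ΓN ν u w.1 t + eta4 s u w.2 t) with hR
  have hRi : Integrable R (volume.restrict (Ioc 0 T)) := integrable_finsetSum _ fun s hs =>
    (((h1 s hs).add (h2 s hs)).add (h3 s hs)).add (h4 s hs)
  have hext : ∀ {F : Type} [NormedAddCommGroup F] [NormedSpace ℝ F] {g : ℝ → Sp d → F},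
      (∀ s ∈ 𝒯.cells, IsSeparated T (cell s) g) →
      ∀ᵐ t ∂(volume.restrict (Ioc 0 T)), ∀ s ∈ 𝒯.cells, ExtendsSmoothly (cell s) (g t) := by
    intro F _ _ g hg
    exact (Finset.eventually_all _).2 fun s hs => (hg s hs).extendsSmoothly
  have hid : ∀ᵐ t ∂(volume.restrict (Ioc 0 T)),
      formIntegrand 𝒯 ΓN ν u p w t - loadIntegrand Ω f w t = R t := by
    obtain ⟨G, -, hG⟩ := hw.exists_hasWeakDerivL2
    filter_upwards [hG, ae_memLp_section hw.pressure, ae_memLp_section hf, hext hu, hext hdu,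
      hext hp, hw.dirichlet] with t k1 k2 k3 k4 k5 k6 k7
    exact formIntegrand_sub_loadIntegrand 𝒯 hd hΓ hdisj hΓD ν k1 k2 k3 k4 k5 k6 k7
  -- Integrability of the form is read off from the identity instead of being checked term by term.
  have hA : Integrable (formIntegrand 𝒯 ΓN ν u p w) (volume.restrict (Ioc 0 T)) :=
    (hRi.add hL).congr (hid.mono fun t ht => by simp only [Pi.add_apply]; linarith)
  have hη : ∀ s ∈ 𝒯.cells, Integrable (etaCell 𝒯 ΓN ν f u p w s) (volume.restrict (Ioc 0 T)) :=
    fun s hs => (((h1 s hs).abs.add (h2 s hs).abs).add (h3 s hs).abs).add (h4 s hs).abs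
  simp only [intervalIntegrable_iff_integrableOn_Ioc_of_le hT.le]
  refine ⟨hL, hA, hη, ?_⟩
  -- The residual is minus the integral of `R`; the sign disappears under the absolute value.
  rw [weakResidual, spaceEstimate, intervalIntegral.integral_of_le hT.le,
    intervalIntegral.integral_of_le hT.le, intervalIntegral.integral_of_le hT.le, abs_sub_comm,
    ← integral_sub hA hL, integral_congr_ae hid]
  refine (abs_integral_le_integral_abs).trans
    (integral_mono hRi.abs (integrable_finsetSum _ hη) fun t => ?_)
  refine (Finset.abs_sum_le_sum_abs _ _).trans (Finset.sum_le_sum fun s _ => ?_)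
  exact (abs_add_le _ _).trans (add_le_add_left ((abs_add_le _ _).trans
    (add_le_add_left (abs_add_le _ _) _)) _)

end Indicators

end NavierStokesFEM

/-! ### The space discretization error estimate. -/

theorem mainTheorem2 (d : ℕ) (hd : d = 2 ∨ d = 3)
    -- the domain, its triangulation, and the two parts of its boundary
    (Ω ΓD ΓN : Set (Sp d)) (𝒯 : Triangulation Ω)
    (hΓ : ΓD ∪ ΓN = frontier Ω) (hΓdisj : Disjoint ΓD ΓN)
    (hΓD : MeasurableSet ΓD) (hΓN : MeasurableSet ΓN)
    -- the data of the flow problem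
    (T ν : ℝ) (hT : 0 < T) (hν : 0 < ν)
    (f : ℝ → Sp d → Sp d)
    (hf : MemLp (fun a : ℝ × Sp d => f a.1 a.2) 2 (cylinder T Ω))
    -- the discrete solution
    (τ : TimeGrid T)
    (Un : Fin (τ.M + 1) → Sp d → Sp d) (Pn : Fin (τ.M + 1) → Sp d → ℝ)
    (hUn : ∀ n, IsVh 𝒯 (Un n)) (hPn : ∀ n, IsQh 𝒯 (Pn n))
    (U : ℝ → Sp d → Sp d) (P : ℝ → Sp d → ℝ)
    (hU : IsTimeInterpolant τ Un U) (hP : IsTimeInterpolant τ Pn P)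
    -- the interpolation operator into the semi-discrete space
    (πh : (ℝ → Sp d → Sp d) × (ℝ → Sp d → ℝ) → (ℝ → Sp d → Sp d) × (ℝ → Sp d → ℝ))
    (hπ : ∀ w, IsTestPair 𝒯 ΓD T w → IsSemiDiscrete 𝒯 ΓD T (πh w))
    -- the dual solution, or any other element of the test space
    (z : ℝ → Sp d → Sp d) (y : ℝ → Sp d → ℝ) (hzy : IsTestPair 𝒯 ΓD T (z, y)) :
    IntervalIntegrable (loadIntegrand Ω f ((z, y) - πh (z, y))) volume 0 T ∧
    IntervalIntegrable (formIntegrand 𝒯 ΓN ν U P ((z, y) - πh (z, y))) volume 0 T ∧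
    (∀ s ∈ 𝒯.cells,
      IntervalIntegrable (etaCell 𝒯 ΓN ν f U P ((z, y) - πh (z, y)) s) volume 0 T) ∧
    weakResidual 𝒯 ΓN T ν f U P ((z, y) - πh (z, y)) ≤
      spaceEstimate 𝒯 ΓN T ν f U P ((z, y) - πh (z, y)) ∧
    |weakResidual 𝒯 ΓN T ν f U P ((z, y) - πh (z, y))| ≤
      spaceEstimate 𝒯 ΓN T ν f U P ((z, y) - πh (z, y)) := by
  have hd0 : 0 < d := by omega
  have hUn' : ∀ s ∈ 𝒯.cells, ∀ n, ExtendsSmoothly (cell s) (Un n) := fun s hs n =>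
    (hUn n).isPiecewiseSmooth s hs
  have hPn' : ∀ s ∈ 𝒯.cells, ∀ n, ExtendsSmoothly (cell s) (Pn n) := fun s hs n =>
    (hPn n).isPiecewiseSmooth s hs
  -- The estimate holds for every test pair, and the interpolation error is one, being a difference
  -- of test pairs.
  obtain ⟨h1, h2, h3, h4⟩ := weakResidual_estimate (ν := ν) hd0 hΓ hΓdisj hΓD hΓN hT hf
    (hzy.sub hd0 (hπ _ hzy).1) (fun s hs => hU.isSeparated (hUn' s hs))
    (fun s hs => hU.isSeparated_timeDeriv (hUn' s hs)) (fun s hs => hP.isSeparated (hPn' s hs))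
  exact ⟨h1, h2, h3, (le_abs_self _).trans h4, h4⟩
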